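/- Let $p$ be a prime, let $S$ be a scheme of characteristic $p$, and let $V$ be a vector bundle over $S$ of rank $D\ge 4$. Let $F:\mathbf{Fl}(V)\to S$ be the scheme of complete flags of $V$, with tautological flag $0=\mathcal V_0\subset\mathcal V_1\subset\dots\subset\mathcal V_D=F^*(V)$ and line bundles $\mathcal L_i=\mathcal V_i/\mathcal V_{i-1}$. Let $1\le d\le D-2$, $r\ge 0$ and $m\ge 1$ be integers. Assume that $d\ge 2$, or $m\le 2$, or $r=0$. Let $t:\mathbf S_d\to\mathbf{Fl}(V)$ be the splitting scheme of the extension $$0\to\mathcal V_d\to\mathcal V_{d+1}\to\mathcal L_{d+1}\to 0,$$ that is, the scheme over $\mathbf{Fl}(V)$ that parametrizes the sections of $\mathcal V_{d+1}\to\mathcal L_{d+1}$. Let $t^m:\mathbf S_d^m\to\mathbf{Fl}(V)$ be its $m$-fold fibered power over $\mathbf{Fl}(V)$. For $i=1,\dots,m$ let $\sigma_i:\mathcal L_{d+1}\to\mathcal V_{d+1}$ be the section over $\mathbf S_d^m$ obtained by pulling back the tautological section along the $i$-th projection $\mathbf S_d^m\to\mathbf S_d$. Write $M^{(r)}$ for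 the pullback of $M$ by the $r$-th iterate of the absolute Frobenius, and identify $\mathcal L_{d+1}^{\vee(r)}\otimes\mathcal V_{d+1}^{(r)}$ with the sheaf of homomorphisms $\mathcal Hom(\mathcal L_{d+1}^{(r)},\mathcal V_{d+1}^{(r)})$ on $\mathbf S_d^m$, so that $\sigma_i^{(r)}$ is a global section of it. Then the $\mathcal O_S$-linear map $$\mathcal O_S^{m}\longrightarrow (F\circ t^m)_*\bigl(\mathcal L_{d+1}^{\vee(r)}\otimes\mathcal V_{d+1}^{(r)}\bigr),\qquad e_i\mapsto\sigma_i^{(r)},$$ is an isomorphism. -/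

import Mathlib

open CategoryTheory Limits AlgebraicGeometry TopologicalSpace Opposite
universe u

noncomputable section

namespace TautSection

/-- The `𝒪_X`-module `M` is a vector bundle of (constant) rank `n`: it is locally isomorphic to
`𝒪^n`. -/
def IsVectorBundle {X : Scheme.{u}} (M : X.Modules) (n : ℕ) : Prop :=
  ∀ x : X, ∃ U : X.Opens, x ∈ U ∧
    Nonempty (M.restrict U.ι ≅ SheafOfModules.free (R := (U : Scheme.{u}).ringCatSheaf) (ULift.{u} (Fin n)))

/-- A complete flag of subbundles `0 = Z_0 ⊂ Z_1 ⊂ ⋯ ⊂ Z_D = E` of a vector bundle `E` of rank `D`.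
Every `Z_i` is a submodule of `E` that is a vector bundle of rank `i`, and `E / Z_i` is a vector
bundle (of rank `D - i`). -/
structure CompleteFlag {X : Scheme.{u}} (E : X.Modules) (D : ℕ) where
  sub : Fin (D + 1) → Subobject E
  mono : Monotone sub
  rank_sub : ∀ i, IsVectorBundle (sub i : X.Modules) i
  rank_quot : ∀ i, IsVectorBundle (cokernel (sub i).arrow) (D - i)

/-- The canonical isomorphism `h^* t^* M ≅ f^* M` for `f = t ∘ h`. -/
def pullbackIso {T Y X : Scheme.{u}} {h : T ⟶ Y} {t : Y ⟶ X} {f : T ⟶ X} (e : h ≫ t = f)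
    (M : X.Modules) :
    (Scheme.Modules.pullback h).obj ((Scheme.Modules.pullback t).obj M) ≅
      (Scheme.Modules.pullback f).obj M :=
  (Scheme.Modules.pullbackComp h t).app M ≪≫ (Scheme.Modules.pullbackCongr e).app M

/-- The pullback along `h` of a submodule `Z ⊂ t^* M`, as a submodule of `f^* M`, where `f = t ∘ h`:
the image of `h^* Z ⟶ h^* t^* M ≅ f^* M`. For a subbundle `Z` the map `h^* Z ⟶ f^* M` is a
monomorphism, so this is `h^* Z` itself. -/
def pullbackSub {T Y X : Scheme.{u}} {h : T ⟶ Y} {t : Y ⟶ X} {f : T ⟶ X} (e : h ≫ t = f)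
    {M : X.Modules} (Z : Subobject ((Scheme.Modules.pullback t).obj M)) :
    Subobject ((Scheme.Modules.pullback f).obj M) :=
  imageSubobject ((Scheme.Modules.pullback h).map Z.arrow ≫ (pullbackIso e M).hom)

/-- The pullback along `h` of a morphism `t^* A ⟶ t^* B`, as a morphism `f^* A ⟶ f^* B`, where
`f = t ∘ h`. -/
def pullbackHom {T Y X : Scheme.{u}} {h : T ⟶ Y} {t : Y ⟶ X} {f : T ⟶ X} (e : h ≫ t = f)
    {A B : X.Modules}
    (s : (Scheme.Modules.pullback t).obj A ⟶ (Scheme.Modules.pullback t).obj B) :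
    (Scheme.Modules.pullback f).obj A ⟶ (Scheme.Modules.pullback f).obj B :=
  (pullbackIso e A).inv ≫ (Scheme.Modules.pullback h).map s ≫ (pullbackIso e B).hom

/-- `F : X ⟶ S`, with the tautological flag `𝒱` of `F^* V`, is the scheme of complete flags of the
vector bundle `V` of rank `D`: for every `t : T ⟶ S`, the `S`-morphisms `T ⟶ X` correspond, by
pulling back `𝒱`, to the complete flags of `t^* V`. -/
structure IsFlagScheme {S : Scheme.{u}} (V : S.Modules) (D : ℕ) {X : Scheme.{u}} (F : X ⟶ S)
    (𝒱 : CompleteFlag ((Scheme.Modules.pullback F).obj V) D) : Prop where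
  existsUnique : ∀ {T : Scheme.{u}} (t : T ⟶ S)
    (Z : CompleteFlag ((Scheme.Modules.pullback t).obj V) D),
    ∃! f : T ⟶ X, ∃ e : f ≫ F = t, ∀ i, pullbackSub e (𝒱.sub i) = Z.sub i

/-- `t : Y ⟶ X`, with the tautological section `σ`, is the scheme of sections of `q : E ⟶ L` (the
splitting scheme of `0 ⟶ ker q ⟶ E ⟶ L ⟶ 0`): `σ` is a section of `t^* q`, and for every
`f : T ⟶ X` the `X`-morphisms `T ⟶ Y` correspond, by pulling back `σ`, to the sections of `f^* q`. -/
structure IsSplittingScheme {X : Scheme.{u}} {E L : X.Modules} (q : E ⟶ L)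
    {Y : Scheme.{u}} (t : Y ⟶ X)
    (σ : (Scheme.Modules.pullback t).obj L ⟶ (Scheme.Modules.pullback t).obj E) : Prop where
  section_comp : σ ≫ (Scheme.Modules.pullback t).map q = 𝟙 _
  existsUnique : ∀ {T : Scheme.{u}} (f : T ⟶ X)
    (s : (Scheme.Modules.pullback f).obj L ⟶ (Scheme.Modules.pullback f).obj E),
    s ≫ (Scheme.Modules.pullback f).map q = 𝟙 _ →
    ∃! h : T ⟶ Y, ∃ e : h ≫ t = f, pullbackHom e σ = s

/-- The `m`-fold fibered power `Y ×_X ⋯ ×_X Y`. -/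
def fiberPower {X Y : Scheme.{u}} (t : Y ⟶ X) (m : ℕ) : Scheme.{u} :=
  widePullback X (fun _ : Fin m => Y) (fun _ => t)
/-- The structure morphism `t^m` of the `m`-fold fibered power. -/
def fiberPowerBase {X Y : Scheme.{u}} (t : Y ⟶ X) (m : ℕ) : fiberPower t m ⟶ X :=
  WidePullback.base (fun _ : Fin m => t)
/-- The `i`-th projection of the `m`-fold fibered power. -/
def fiberPowerProj {X Y : Scheme.{u}} (t : Y ⟶ X) (m : ℕ) (i : Fin m) : fiberPower t m ⟶ Y :=
  WidePullback.π (fun _ : Fin m => t) i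
theorem fiberPowerProj_comp {X Y : Scheme.{u}} (t : Y ⟶ X) (m : ℕ) (i : Fin m) :
    fiberPowerProj t m i ≫ t = fiberPowerBase t m := WidePullback.π_arrow _ _


/-- The Frobenius `x ↦ x ^ p` of a ring in which `p = 0`. -/
def frobRingHom (p : ℕ) [Fact p.Prime] (R : Type u) [CommRing R] (h : (p : R) = 0) : R →+* R where
  toFun x := x ^ p
  map_one' := one_pow p
  map_mul' x y := mul_pow x y p
  map_zero' := zero_pow (Fact.out : p.Prime).ne_zero
  map_add' x y := by
    rcases subsingleton_or_nontrivial R with _ | _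
    · exact Subsingleton.elim _ _
    · have : CharP R p := (CharP.charP_iff_prime_eq_zero Fact.out).2 h
      exact add_pow_char _ _ _

theorem natCast_eq_zero {p : ℕ} {X : Scheme.{u}} (h : (p : Γ(X, ⊤)) = 0) (U : X.Opens) :
    (p : Γ(X, U)) = 0 := by
  have := congrArg (X.presheaf.map (homOfLE (le_top : U ≤ ⊤)).op).hom h
  simpa using this

theorem natCast_eq_zero_of_hom {p : ℕ} {X S : Scheme.{u}} (f : X ⟶ S) (h : (p : Γ(S, ⊤)) = 0) :
    (p : Γ(X, ⊤)) = 0 := by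
  have := congrArg f.appTop.hom h
  simpa using this

/-- The absolute Frobenius, as a morphism of ringed spaces: the identity on points, `s ↦ s ^ p` on
sections. -/
def absFrobeniusAux (p : ℕ) [Fact p.Prime] (X : Scheme.{u}) (hX : (p : Γ(X, ⊤)) = 0) :
    X.toPresheafedSpace ⟶ X.toPresheafedSpace where
  base := 𝟙 _
  c :=
    { app := fun U => CommRingCat.ofHom (frobRingHom p Γ(X, U.unop) (natCast_eq_zero hX U.unop))
      naturality := by
        intro U V i
        ext x
        exact (map_pow (X.presheaf.map i).hom x p).symm }

/-- The absolute Frobenius of a scheme of characteristic `p`. -/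
def absFrobenius (p : ℕ) [Fact p.Prime] (X : Scheme.{u}) (hX : (p : Γ(X, ⊤)) = 0) : X ⟶ X where
  toHom := absFrobeniusAux p X hX
  prop := by
    intro x
    constructor
    intro a ha
    obtain ⟨U, hxU, s, rfl⟩ := X.presheaf.exists_germ_eq a
    have key := PresheafedSpace.stalkMap_germ_apply (absFrobeniusAux p X hX) U x hxU s
    rw [key] at ha
    have h2 : IsUnit ((X.presheaf.germ U x hxU) (s ^ p)) := ha
    rw [map_pow] at h2
    exact (isUnit_pow_iff (Fact.out : p.Prime).ne_zero).1 h2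



/-- An `𝒪_U`-linear morphism `M|_U ⟶ N|_U`, given by its action on the sections over all open
subsets of `U`. -/
@[ext]
structure LocalHom {X : Scheme.{u}} (M N : X.Modules) (U : X.Opens) : Type u where
  app : ∀ W : X.Opens, W ≤ U → (Γ(M, W) →ₗ[Γ(X, W)] Γ(N, W))
  naturality : ∀ (W W' : X.Opens) (hW : W ≤ U) (h : W' ≤ W) (x : Γ(M, W)),
    N.presheaf.map (homOfLE h).op (app W hW x) =
      app W' (h.trans hW) (M.presheaf.map (homOfLE h).op x)

namespace LocalHom

variable {X : Scheme.{u}} {M N : X.Modules} {U : X.Opens}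

instance : Zero (LocalHom M N U) := ⟨⟨fun _ _ => 0, by simp⟩⟩
instance : Add (LocalHom M N U) :=
  ⟨fun a b => ⟨fun W hW => a.app W hW + b.app W hW, by simp [naturality]⟩⟩
instance : Neg (LocalHom M N U) := ⟨fun a => ⟨fun W hW => -a.app W hW, by simp [naturality]⟩⟩

@[simp] theorem zero_app (W : X.Opens) (hW : W ≤ U) : (0 : LocalHom M N U).app W hW = 0 := rfl
@[simp] theorem add_app (a b : LocalHom M N U) (W : X.Opens) (hW : W ≤ U) :
    (a + b).app W hW = a.app W hW + b.app W hW := rfl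
@[simp] theorem neg_app (a : LocalHom M N U) (W : X.Opens) (hW : W ≤ U) :
    (-a).app W hW = -a.app W hW := rfl

instance : AddCommGroup (LocalHom M N U) where
  add_assoc a b c := by ext : 3; simp [add_assoc]
  zero_add a := by ext : 3; simp
  add_zero a := by ext : 3; simp
  neg_add_cancel a := by ext : 3; simp
  add_comm a b := by ext : 3; simp [add_comm]
  nsmul := nsmulRec
  zsmul := zsmulRec

instance : SMul Γ(X, U) (LocalHom M N U) :=
  ⟨fun r a => ⟨fun W hW => X.presheaf.map (homOfLE hW).op r • a.app W hW, by
    intro W W' _ h x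
    simp only [LinearMap.smul_apply, Scheme.Modules.map_smul, a.naturality _ W' _ h]
    rw [← ConcreteCategory.comp_apply, ← Functor.map_comp]
    rfl⟩⟩

@[simp] theorem smul_app (r : Γ(X, U)) (a : LocalHom M N U) (W : X.Opens) (hW : W ≤ U) :
    (r • a).app W hW = X.presheaf.map (homOfLE hW).op r • a.app W hW := rfl

instance : Module Γ(X, U) (LocalHom M N U) where
  one_smul a := by ext : 3; simp
  mul_smul r s a := by ext : 3; simp [mul_smul]
  smul_zero r := by ext : 3; simp
  smul_add r a b := by ext : 3; simp
  add_smul r s a := by ext : 3; simp [add_smul]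
  zero_smul a := by ext : 3; simp

/-- Restriction to a smaller open. -/
def restrict {U' : X.Opens} (h : U' ≤ U) : LocalHom M N U →+ LocalHom M N U' where
  toFun a := ⟨fun W hW => a.app W (hW.trans h), fun W W' hW h' x => a.naturality W W' _ h' x⟩
  map_zero' := rfl
  map_add' _ _ := rfl

/-- The restriction to `U` of a morphism of `𝒪_X`-modules. -/
def ofHom (φ : M ⟶ N) (U : X.Opens) : LocalHom M N U where
  app W _ := { toFun := φ.app W, map_add' := map_add _, map_smul' := φ.app_smul }
  naturality _ _ _ h x :=
    (ConcreteCategory.congr_hom (φ.mapPresheaf.naturality (homOfLE h).op) x).symm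

end LocalHom

/-- The presheaf `U ↦ Hom(M|_U, N|_U)`. -/
def ihomPresheaf {X : Scheme.{u}} (M N : X.Modules) : TopCat.Presheaf Ab.{u} X where
  obj U := AddCommGrpCat.of (LocalHom M N U.unop)
  map f := AddCommGrpCat.ofHom (LocalHom.restrict f.unop.le)
  map_id _ := rfl
  map_comp _ _ := rfl

instance {X : Scheme.{u}} (M N : X.Modules) (U : (Opens X)ᵒᵖ) :
    Module (X.ringCatSheaf.obj.obj U) ((ihomPresheaf M N).obj U) :=
  inferInstanceAs (Module Γ(X, U.unop) (LocalHom M N U.unop))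

theorem ihomPresheaf_isSheaf {X : Scheme.{u}} (M N : X.Modules) :
    (ihomPresheaf M N).IsSheaf := by
  rw [TopCat.Presheaf.isSheaf_iff_isSheafUniqueGluing]
  intro ι U sf hsf
  let s : ∀ i, LocalHom M N (U i) := sf
  let F : TopCat.Sheaf Ab.{u} X := ⟨N.presheaf, N.isSheaf⟩
  have hcompat : ∀ (i j : ι) (T : X.Opens) (hi : T ≤ U i) (hj : T ≤ U j) (x : Γ(M, T)),
      (s i).app T hi x = (s j).app T hj x := by
    intro i j T hi hj x
    have h1 : (s i).restrict (inf_le_left : U i ⊓ U j ≤ U i) =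
      (s j).restrict (inf_le_right : U i ⊓ U j ≤ U j) := hsf i j
    exact congrArg (fun a : LocalHom M N (U i ⊓ U j) => a.app T (le_inf hi hj) x) h1
  have hcov : ∀ W : X.Opens, W ≤ iSup U → W ≤ ⨆ i, W ⊓ U i := fun W hW => by
    rw [← inf_iSup_eq]; exact le_inf le_rfl hW
  have hex : ∀ (W : X.Opens) (_ : W ≤ iSup U) (x : Γ(M, W)), ∃! y : Γ(N, W), ∀ i,
      N.presheaf.map (homOfLE (inf_le_left : W ⊓ U i ≤ W)).op y =
        (s i).app (W ⊓ U i) inf_le_right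
          (M.presheaf.map (homOfLE (inf_le_left : W ⊓ U i ≤ W)).op x) := by
    intro W hW x
    refine F.existsUnique_gluing' (fun i => W ⊓ U i) W (fun i => homOfLE inf_le_left) (hcov W hW)
      (fun i => (s i).app (W ⊓ U i) inf_le_right
          (M.presheaf.map (homOfLE (inf_le_left : W ⊓ U i ≤ W)).op x)) ?_
    intro i j
    have e1 := (s i).naturality (W ⊓ U i) ((W ⊓ U i) ⊓ (W ⊓ U j)) inf_le_right inf_le_left
      (M.presheaf.map (homOfLE (inf_le_left : W ⊓ U i ≤ W)).op x)
    have e2 := (s j).naturality (W ⊓ U j) ((W ⊓ U i) ⊓ (W ⊓ U j)) inf_le_right inf_le_right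
      (M.presheaf.map (homOfLE (inf_le_left : W ⊓ U j ≤ W)).op x)
    rw [← ConcreteCategory.comp_apply, ← Functor.map_comp] at e1 e2
    exact e1.trans ((hcompat i j _ _ _ _).trans e2.symm)
  have huniq : ∀ (W : X.Opens) (_ : W ≤ iSup U) (y z : Γ(N, W)),
      (∀ i, N.presheaf.map (homOfLE (inf_le_left : W ⊓ U i ≤ W)).op y =
        N.presheaf.map (homOfLE (inf_le_left : W ⊓ U i ≤ W)).op z) → y = z := fun W hW y z h =>
    F.eq_of_locally_eq' (fun i => W ⊓ U i) W (fun i => homOfLE inf_le_left) (hcov W hW) y z h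
  choose g hg using fun W hW x => (hex W hW x).exists
  let t : LocalHom M N (iSup U) :=
    { app := fun W hW =>
        { toFun := g W hW
          map_add' := fun x y => huniq W hW _ _ fun i => by
            rw [map_add, hg, hg, hg, map_add, map_add]
          map_smul' := fun r x => huniq W hW _ _ fun i => by
            rw [RingHom.id_apply, Scheme.Modules.map_smul, hg, hg, Scheme.Modules.map_smul,
              map_smul] }
      naturality := fun W W' hW h x => huniq W' (h.trans hW) _ _ fun i => by
        have e1 := (s i).naturality (W ⊓ U i) (W' ⊓ U i) inf_le_right (inf_le_inf_right _ h)
          (M.presheaf.map (homOfLE (inf_le_left : W ⊓ U i ≤ W)).op x)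
        change N.presheaf.map _ (N.presheaf.map _ (g W hW x)) = N.presheaf.map _ (g W' _ _)
        rw [hg, ← ConcreteCategory.comp_apply, ← Functor.map_comp, ← ConcreteCategory.comp_apply,
          ← Functor.map_comp]
        rw [← hg, ← ConcreteCategory.comp_apply, ← Functor.map_comp, ← ConcreteCategory.comp_apply,
          ← Functor.map_comp] at e1
        exact e1 }
  have ht : ∀ i, t.restrict (le_iSup U i) = s i := by
    intro i
    refine LocalHom.ext ?_
    funext W hW
    refine LinearMap.ext fun x => ?_
    refine huniq W (hW.trans (le_iSup U i)) _ _ fun j => ?_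
    refine (hg W (hW.trans (le_iSup U i)) x j).trans ?_
    rw [(s i).naturality W (W ⊓ U j) hW inf_le_left]
    exact hcompat _ _ _ _ _ _
  refine ⟨t, ht, ?_⟩
  intro t' ht'
  let t'' : LocalHom M N (iSup U) := t'
  refine LocalHom.ext (x := t'') ?_
  funext W hW
  refine LinearMap.ext fun x => ?_
  refine huniq W hW _ _ fun j => ?_
  have hj : t''.restrict (le_iSup U j) = s j := ht' j
  have e : ∀ z, t''.app (W ⊓ U j) (inf_le_left.trans hW) z = (s j).app (W ⊓ U j) inf_le_right z := by
    intro z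
    rw [← hj]; rfl
  rw [t''.naturality W (W ⊓ U j) hW inf_le_left, e]
  exact (hg W hW x j).symm

/-- The sheaf of homomorphisms `ℋom(M, N)`, an `𝒪_X`-module. When `M` is a line bundle it is
`M^∨ ⊗ N`. -/
def ihom {X : Scheme.{u}} (M N : X.Modules) : X.Modules where
  val := PresheafOfModules.ofPresheaf (R := X.ringCatSheaf.obj) (ihomPresheaf M N) (by
    intro U V f r a
    let a' : LocalHom M N U.unop := a
    let r' : Γ(X, U.unop) := r
    let rV : Γ(X, V.unop) := X.presheaf.map f r'
    change (r' • a').restrict f.unop.le = rV • a'.restrict f.unop.le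
    refine LocalHom.ext ?_
    funext W hW
    refine LinearMap.ext fun x => ?_
    change X.presheaf.map (homOfLE (hW.trans f.unop.le)).op r' • a'.app W (hW.trans f.unop.le) x =
      X.presheaf.map (homOfLE hW).op (X.presheaf.map f r') • a'.app W (hW.trans f.unop.le) x
    rw [← ConcreteCategory.comp_apply, ← Functor.map_comp]
    rfl)
  isSheaf := ihomPresheaf_isSheaf M N

/-- The global section of `h_* ℋom(M, N)` given by a morphism `M ⟶ N`. -/
def ihomSection {X S : Scheme.{u}} (h : X ⟶ S) {M N : X.Modules} (φ : M ⟶ N) :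
    SheafOfModules.sections ((Scheme.Modules.pushforward h).obj (ihom M N)) :=
  PresheafOfModules.sectionsMk (fun U => LocalHom.ofHom φ (h ⁻¹ᵁ U.unop)) (fun _ _ _ => rfl)


/-- The `r`-th iterate of the absolute Frobenius. Pulling back along it is the Frobenius twist
`M ↦ M^{(r)}`. -/
def frobeniusIter (p : ℕ) [Fact p.Prime] (X : Scheme.{u}) (hX : (p : Γ(X, ⊤)) = 0) : ℕ → (X ⟶ X)
  | 0 => 𝟙 X
  | r + 1 => frobeniusIter p X hX r ≫ absFrobenius p X hX

/-- The free module `𝒪_S^m`. -/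
def freeModule (S : Scheme.{u}) (m : ℕ) : S.Modules :=
  SheafOfModules.free (R := S.ringCatSheaf) (ULift.{u} (Fin m))

namespace CompleteFlag

variable {X : Scheme.{u}} {E : X.Modules} {D : ℕ} (Z : CompleteFlag E D)

/-- The inclusion `Z_i ⟶ Z_{i+1}`. -/
def incl (i : Fin D) : (Z.sub i.castSucc : X.Modules) ⟶ (Z.sub i.succ : X.Modules) :=
  Subobject.ofLE _ _ (Z.mono (Fin.castSucc_le_succ i))

/-- The graded piece `Z_{i+1} / Z_i`. -/
def gr (i : Fin D) : X.Modules := cokernel (Z.incl i)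

/-- The quotient map `Z_{i+1} ⟶ Z_{i+1} / Z_i`. -/
def toGr (i : Fin D) : (Z.sub i.succ : X.Modules) ⟶ Z.gr i := cokernel.π (Z.incl i)

end CompleteFlag

/-- Let `t : Y ⟶ X` carry `σ : t^* L ⟶ t^* E`, let `F : X ⟶ S`, and let `σ_i` be the pullback of `σ` by
the `i`-th projection of the fibered power `t^m`. This is the map
`𝒪_S^m ⟶ (F ∘ t^m)_* ℋom(L^{(r)}, E^{(r)})`, `e_i ↦ σ_i^{(r)}`. -/
def tautologicalMap (p : ℕ) [Fact p.Prime] {S X Y : Scheme.{u}} (hS : (p : Γ(S, ⊤)) = 0)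
    (F : X ⟶ S) {E L : X.Modules} (t : Y ⟶ X)
    (σ : (Scheme.Modules.pullback t).obj L ⟶ (Scheme.Modules.pullback t).obj E) (r m : ℕ) :
    freeModule S m ⟶ (Scheme.Modules.pushforward (fiberPowerBase t m ≫ F)).obj
      (ihom ((Scheme.Modules.pullback (frobeniusIter p (fiberPower t m)
          (natCast_eq_zero_of_hom (fiberPowerBase t m ≫ F) hS) r)).obj
            ((Scheme.Modules.pullback (fiberPowerBase t m)).obj L))
        ((Scheme.Modules.pullback (frobeniusIter p (fiberPower t m)
          (natCast_eq_zero_of_hom (fiberPowerBase t m ≫ F) hS) r)).obj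
            ((Scheme.Modules.pullback (fiberPowerBase t m)).obj E))) :=
  (SheafOfModules.freeHomEquiv _).symm fun i =>
    ihomSection (fiberPowerBase t m ≫ F) ((Scheme.Modules.pullback _).map
      (pullbackHom (fiberPowerProj_comp t m i.down) σ))

end TautSection

end

/-!
Write `q = p ^ r` and `k = d` (indices start at `0`, so that `σ` splits `𝒱_{k+1} ⟶ 𝒱_{k+1} / 𝒱_k`).
The claim is local on `S`: let `U = Spec A` be an affine open subset over which `V` is free. A section
`s` of the sheaf of twisted homomorphisms over the preimage of `U` is studied through its values at
points with values in `A`-algebras `B`. An invertible matrix `g` over `B` spans a flag by its columns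
`v_0, …, v_{D-1}`, and coefficients `a_nj` give `m` splittings, which map the class of `v_k` to
`v_k + ∑_{j < k} a_nj v_j`; together they determine a point of the fibered power (`IsPoint`). The
value of `s` there on the twist of the class of `v_k` (`IsValue`) is a vector `Φ(g, a)`. It is
compatible with base change, lies in the span of the `q`-th powers of `v_0, …, v_k`, and only depends
on the flag and the sections, up to the factor `c ^ q` if the class of `v_k` is multiplied by `c`
(`PointFunction`, `pointFunction`).

The heart of the proof is the determination of all these functions, `PointFunction.exists_val_eq`. Let
`l > k`; such an index exists since `d + 2 ≤ D`. When one of the vectors `v_0, …, v_k` moves in the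
plane which it spans with `v_l`, the flag moves on a projective line, and the coordinates of `Φ` are
polynomial on both of its charts. Comparing the charts bounds their exponents
(`weight_le_of_laurentHom_eq`): the coordinate with index `k` does not depend on `a`, and the one with
index `j < k` is homogeneous of degree `q` in the `a_nj` and free of the other variables
(`coeff_universal`). Now the coordinates are functions on the projective line, hence invariant when
multiples of `v_l` are added to the first vectors; they are also invariant under changes of frame
which are diagonal on the first vectors. Over a local ring these changes of frame generate the general
linear group, with the help of commutators, so that the coordinates do not depend on `g`
(`val_eq_val_one`).

It remains to see that a coordinate is additive in `a`. Adding `v_i` to `v_j` for `i < j < k` does not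
change the flag, and yields additivity if `d ≥ 2`. Adding `c v_j` to `v_k` translates the `j`-th
coordinates of all splittings by `c`; with homogeneity this suffices if `m ≤ 2`. If `r = 0`, the
coordinates are homogeneous of degree one. Thus there are `α_n` in `A` such that, over local rings,
`Φ(g, a)` is the value of `∑ α_n σ_n^{(r)}`.

A section over the preimage of `U` is zero if its values at the local rings of the fibered power are,
because flags over local schemes are spanned by frames (`exists_frame_adapted`,
`eq_zero_of_isValue`). This gives surjectivity. For injectivity, the values of the `σ_n^{(r)}` at
`g = 1` and the generic splittings over `A[X_nj]` are linearly independent over `A`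
(`eq_zero_of_sum_twistedSection`).
-/

noncomputable section

namespace TautSection

/-! ### Pulled back sections -/

section PullSec
variable {X Y T S : Scheme.{u}}

/-- Restriction of sections of an `𝒪_X`-module to a smaller open. -/
def res (M : X.Modules) {U : X.Opens} (V : X.Opens) (h : V ≤ U) : Γ(M, U) →+ Γ(M, V) :=
  (M.presheaf.map (homOfLE h).op).hom

/-- Restriction of functions to a smaller open. -/
def resFun {U : X.Opens} (V : X.Opens) (h : V ≤ U) : Γ(X, U) →+* Γ(X, V) :=
  (X.presheaf.map (homOfLE h).op).hom

theorem res_self (M : X.Modules) {U : X.Opens} (h : U ≤ U) (m : Γ(M, U)) : res M U h m = m := by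
  simp [res]

theorem res_res (M : X.Modules) {U V W : X.Opens} (h : V ≤ U) (h' : W ≤ V) (m : Γ(M, U)) :
    res M W h' (res M V h m) = res M W (h'.trans h) m := by
  have : (homOfLE (h'.trans h)).op = (homOfLE h).op ≫ (homOfLE h').op := rfl
  simp only [res]
  rw [← ConcreteCategory.comp_apply, ← Functor.map_comp, this]

theorem res_smul (M : X.Modules) {U V : X.Opens} (h : V ≤ U) (a : Γ(X, U)) (m : Γ(M, U)) :
    res M V h (a • m) = resFun V h a • res M V h m :=
  Scheme.Modules.map_smul M (homOfLE h) a m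

theorem app_res {M N : X.Modules} (φ : M ⟶ N) {U V : X.Opens} (h : V ≤ U) (m : Γ(M, U)) :
    φ.app V (res M V h m) = res N V h (φ.app U m) :=
  ConcreteCategory.congr_hom (φ.mapPresheaf.naturality (homOfLE h).op) m

theorem resFun_resFun {U V W : X.Opens} (h : V ≤ U) (h' : W ≤ V) (m : Γ(X, U)) :
    resFun W h' (resFun V h m) = resFun W (h'.trans h) m := by
  have : (homOfLE (h'.trans h)).op = (homOfLE h).op ≫ (homOfLE h').op := rfl
  simp only [resFun]
  rw [← ConcreteCategory.comp_apply, ← Functor.map_comp, this]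

theorem resFun_self {U : X.Opens} (h : U ≤ U) (m : Γ(X, U)) : resFun U h m = m := by
  simp [resFun]

/-- Functions on `U` pulled back along `f` and restricted to `V`. -/
def pullFun (f : T ⟶ X) {U : X.Opens} (V : T.Opens) (h : V ≤ f ⁻¹ᵁ U) : Γ(X, U) →+* Γ(T, V) :=
  (f.appLE U V h).hom

theorem pullFun_eq (f : T ⟶ X) {U : X.Opens} (V : T.Opens) (h : V ≤ f ⁻¹ᵁ U) (a : Γ(X, U)) :
    pullFun f V h a = resFun V h ((f.app U).hom a) := rfl

/-- The unit `M ⟶ f_* f^* M`. -/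
def pullUnit (f : T ⟶ X) (M : X.Modules) :
    M ⟶ (Scheme.Modules.pushforward f).obj ((Scheme.Modules.pullback f).obj M) :=
  (Scheme.Modules.pullbackPushforwardAdjunction f).unit.app M

/-- The pullback along `f` of a section over `U`, as a section over `f⁻¹ U`. -/
def unitSec (f : T ⟶ X) (M : X.Modules) (U : X.Opens) :
    Γ(M, U) →+ Γ((Scheme.Modules.pullback f).obj M, f ⁻¹ᵁ U) :=
  ((pullUnit f M).app U).hom

/-- The pullback along `f` of a section over `U`, restricted to `V ⊆ f⁻¹ U`. -/
def pullSec (f : T ⟶ X) (M : X.Modules) {U : X.Opens} (V : T.Opens) (h : V ≤ f ⁻¹ᵁ U) :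
    Γ(M, U) →+ Γ((Scheme.Modules.pullback f).obj M, V) :=
  (res ((Scheme.Modules.pullback f).obj M) V h).comp (unitSec f M U)

theorem pullSec_eq (f : T ⟶ X) (M : X.Modules) {U : X.Opens} (V : T.Opens) (h : V ≤ f ⁻¹ᵁ U)
    (m : Γ(M, U)) : pullSec f M V h m = res _ V h (unitSec f M U m) := rfl

theorem res_pullSec (f : T ⟶ X) (M : X.Modules) {U : X.Opens} {V V' : T.Opens} (h : V ≤ f ⁻¹ᵁ U)
    (h' : V' ≤ V) (m : Γ(M, U)) :
    res _ V' h' (pullSec f M V h m) = pullSec f M V' (h'.trans h) m :=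
  res_res _ _ _ _

theorem unitSec_res (f : T ⟶ X) (M : X.Modules) {U U' : X.Opens} (h' : U' ≤ U) (m : Γ(M, U)) :
    unitSec f M U' (res M U' h' m) =
      res _ _ ((Opens.map f.base).map (homOfLE h')).le (unitSec f M U m) :=
  app_res (pullUnit f M) h' m

theorem pullSec_res (f : T ⟶ X) (M : X.Modules) {U U' : X.Opens} {V : T.Opens}
    (h : V ≤ f ⁻¹ᵁ U') (h' : U' ≤ U) (m : Γ(M, U)) :
    pullSec f M V h (res M U' h' m) =
      pullSec f M V (h.trans ((Opens.map f.base).map (homOfLE h')).le) m := by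
  rw [pullSec_eq, unitSec_res, res_res, pullSec_eq]

theorem pullFun_resFun (f : T ⟶ X) {U U' : X.Opens} {V : T.Opens}
    (h : V ≤ f ⁻¹ᵁ U') (h' : U' ≤ U) (m : Γ(X, U)) :
    pullFun f V h (resFun U' h' m) =
      pullFun f V (h.trans ((Opens.map f.base).map (homOfLE h')).le) m := by
  simp only [pullFun, resFun]
  rw [← ConcreteCategory.comp_apply, Scheme.Hom.map_appLE]

theorem resFun_pullFun (f : T ⟶ X) {U : X.Opens} {V V' : T.Opens} (h : V ≤ f ⁻¹ᵁ U)
    (h' : V' ≤ V) (m : Γ(X, U)) :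
    resFun V' h' (pullFun f V h m) = pullFun f V' (h'.trans h) m :=
  resFun_resFun _ _ _

theorem pullSec_smul (f : T ⟶ X) (M : X.Modules) {U : X.Opens} (V : T.Opens) (h : V ≤ f ⁻¹ᵁ U)
    (a : Γ(X, U)) (m : Γ(M, U)) :
    pullSec f M V h (a • m) = pullFun f V h a • pullSec f M V h m := by
  have : unitSec f M U (a • m) = (f.app U).hom a • unitSec f M U m :=
    (pullUnit f M).app_smul a m
  rw [pullSec_eq, this, res_smul, pullSec_eq, pullFun_eq]

theorem map_unitSec (f : T ⟶ X) {M N : X.Modules} (φ : M ⟶ N) {U : X.Opens} (m : Γ(M, U)) :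
    ((Scheme.Modules.pullback f).map φ).app _ (unitSec f M U m) = unitSec f N U (φ.app U m) := by
  have e := (Scheme.Modules.pullbackPushforwardAdjunction f).unit.naturality φ
  exact (congrArg (fun ψ => Scheme.Modules.Hom.app ψ U m) e).symm

theorem map_pullSec (f : T ⟶ X) {M N : X.Modules} (φ : M ⟶ N) {U : X.Opens} (V : T.Opens)
    (h : V ≤ f ⁻¹ᵁ U) (m : Γ(M, U)) :
    ((Scheme.Modules.pullback f).map φ).app V (pullSec f M V h m) =
      pullSec f N V h (φ.app U m) := by
  rw [pullSec_eq, app_res, map_unitSec, pullSec_eq]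

/-- Morphisms out of a pullback are determined by their values on pulled back sections. -/
theorem pullback_hom_ext (f : T ⟶ X) {M : X.Modules} {K : T.Modules}
    {α β : (Scheme.Modules.pullback f).obj M ⟶ K}
    (H : ∀ (U : X.Opens) (V : T.Opens) (hV : V ≤ f ⁻¹ᵁ U) (m : Γ(M, U)),
      α.app V (pullSec f M V hV m) = β.app V (pullSec f M V hV m)) :
    α = β := by
  apply ((Scheme.Modules.pullbackPushforwardAdjunction f).homEquiv _ _).injective
  ext U m
  have h2 := H U _ le_rfl m
  rw [pullSec_eq, res_self] at h2
  simp only [Adjunction.homEquiv_unit]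
  exact h2

/-- The morphism `f^* M ⟶ K` adjoint to `M ⟶ f_* K`. -/
def pullLift (f : T ⟶ X) {M : X.Modules} {K : T.Modules}
    (φ : M ⟶ (Scheme.Modules.pushforward f).obj K) : (Scheme.Modules.pullback f).obj M ⟶ K :=
  ((Scheme.Modules.pullbackPushforwardAdjunction f).homEquiv _ _).symm φ

theorem pullLift_pullSec (f : T ⟶ X) {M : X.Modules} {K : T.Modules}
    (φ : M ⟶ (Scheme.Modules.pushforward f).obj K) {U : X.Opens} (V : T.Opens)
    (h : V ≤ f ⁻¹ᵁ U) (m : Γ(M, U)) :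
    (pullLift f φ).app V (pullSec f M V h m) = res K V h (φ.app U m) := by
  have e : (Scheme.Modules.pullbackPushforwardAdjunction f).homEquiv _ _ (pullLift f φ) = φ :=
    Equiv.apply_symm_apply _ _
  rw [Adjunction.homEquiv_unit] at e
  have e' : (pullLift f φ).app _ (unitSec f M U m) = φ.app U m :=
    congrArg (fun ψ => Scheme.Modules.Hom.app ψ U m) e
  rw [pullSec_eq, app_res, e']

theorem pullbackComp_pullSec (h : T ⟶ Y) (t : Y ⟶ X) (M : X.Modules) {U : X.Opens} {V : Y.Opens}
    {V' : T.Opens} (hV : V ≤ t ⁻¹ᵁ U) (hV' : V' ≤ h ⁻¹ᵁ V) (m : Γ(M, U)) :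
    ((Scheme.Modules.pullbackComp h t).hom.app M).app V'
        (pullSec h _ V' hV' (pullSec t M V hV m)) =
      pullSec (h ≫ t) M V' (hV'.trans ((Opens.map h.base).map (homOfLE hV)).le) m := by
  have e := unit_conjugateEquiv ((Scheme.Modules.pullbackPushforwardAdjunction t).comp
    (Scheme.Modules.pullbackPushforwardAdjunction h))
      (Scheme.Modules.pullbackPushforwardAdjunction (h ≫ t))
      (Scheme.Modules.pullbackComp h t).inv M
  rw [Scheme.Modules.conjugateEquiv_pullbackComp_inv] at e
  let I : (Scheme.Modules.pullback h).obj ((Scheme.Modules.pullback t).obj M) ≅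
      (Scheme.Modules.pullback (h ≫ t)).obj M := (Scheme.Modules.pullbackComp h t).app M
  have e' : unitSec h _ _ (unitSec t M U m) =
      I.inv.app (h ⁻¹ᵁ t ⁻¹ᵁ U) (unitSec (h ≫ t) M U m) :=
    congrArg (fun ψ => Scheme.Modules.Hom.app ψ U m) e
  change I.hom.app V' _ = _
  have hI : ∀ x : Γ((Scheme.Modules.pullback (h ≫ t)).obj M, h ⁻¹ᵁ t ⁻¹ᵁ U),
      I.hom.app _ (I.inv.app _ x) = x := fun x => by
    rw [← ConcreteCategory.comp_apply, ← Scheme.Modules.Hom.comp_app, Iso.inv_hom_id]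
    rfl
  rw [pullSec_eq t, pullSec_res, pullSec_eq, e', app_res, pullSec_eq]
  exact congrArg (res ((Scheme.Modules.pullback (h ≫ t)).obj M) V' _) (hI _)

theorem pullbackCongr_pullSec {f g : T ⟶ X} (e : f = g) (M : X.Modules) {U : X.Opens}
    {V : T.Opens} (hV : V ≤ f ⁻¹ᵁ U) (m : Γ(M, U)) :
    ((Scheme.Modules.pullbackCongr e).hom.app M).app V (pullSec f M V hV m) =
      pullSec g M V (e ▸ hV) m := by
  subst e
  simp [Scheme.Modules.pullbackCongr]

theorem pullbackIso_pullSec {h : T ⟶ Y} {t : Y ⟶ X} {f : T ⟶ X} (e : h ≫ t = f) (M : X.Modules)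
    {U : X.Opens} {V : Y.Opens}
    {V' : T.Opens} (hV : V ≤ t ⁻¹ᵁ U) (hV' : V' ≤ h ⁻¹ᵁ V) (hf : V' ≤ f ⁻¹ᵁ U) (m : Γ(M, U)) :
    (pullbackIso e M).hom.app V' (pullSec h _ V' hV' (pullSec t M V hV m)) =
      pullSec f M V' hf m := by
  have := pullbackComp_pullSec h t M hV hV' m
  simp only [pullbackIso, Iso.trans_hom, Iso.app_hom, Scheme.Modules.Hom.comp_app,
    ConcreteCategory.comp_apply]
  rw [this, pullbackCongr_pullSec e]

end PullSec

/-! ### Frames -/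

section Frames
variable {X Y T S : Scheme.{u}}

/-- The sections `e_i` over `U` form a frame of `M|_U`: over every open subset of `U` they are a
basis of the sections. -/
def IsFrame {ι : Type} [Fintype ι] (M : X.Modules) {U : X.Opens} (e : ι → Γ(M, U)) : Prop :=
  ∀ (V : X.Opens) (h : V ≤ U), Function.Bijective
    (fun a : ι → Γ(X, V) => ∑ i, a i • res M V h (e i))

variable {ι : Type} [Fintype ι]

theorem IsFrame.res {M : X.Modules} {U : X.Opens} {e : ι → Γ(M, U)} (he : IsFrame M e)
    {V : X.Opens} (h : V ≤ U) : IsFrame M (fun i => res M V h (e i)) := by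
  intro W hW
  simpa only [res_res] using he W (hW.trans h)

theorem app_sum_smul {M N : X.Modules} (φ : M ⟶ N) {V : X.Opens} (a : ι → Γ(X, V))
    (m : ι → Γ(M, V)) : φ.app V (∑ i, a i • m i) = ∑ i, a i • φ.app V (m i) := by
  rw [map_sum]
  exact Finset.sum_congr rfl fun i _ => φ.app_smul _ _

theorem app_bijective {M N : X.Modules} (φ : M ⟶ N) [IsIso φ] (V : X.Opens) :
    Function.Bijective (φ.app V) :=
  ConcreteCategory.bijective_of_isIso (φ.app V)

theorem isIso_of_bijective {M N : X.Modules} (φ : M ⟶ N)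
    (h : ∀ V : X.Opens, Function.Bijective (φ.app V)) : IsIso φ := by
  rw [Scheme.Modules.Hom.isIso_iff_isIso_app]
  exact fun V => (ConcreteCategory.isIso_iff_bijective _).2 (h V)

theorem IsFrame.map_iso {M N : X.Modules} (φ : M ⟶ N) [IsIso φ] {U : X.Opens} {e : ι → Γ(M, U)}
    (he : IsFrame M e) : IsFrame N (fun i => φ.app U (e i)) := by
  intro V h
  have := (app_bijective φ V).comp (he V h)
  convert this using 2 with a
  simp only [Function.comp_apply, app_sum_smul, app_res]

/-- A morphism which sends a frame to a frame is an isomorphism. -/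
theorem isIso_of_frame {M N : X.Modules} (φ : M ⟶ N) {e : ι → Γ(M, (⊤ : X.Opens))}
    (he : IsFrame M e) (h : IsFrame N (fun i => φ.app ⊤ (e i))) : IsIso φ := by
  refine isIso_of_bijective φ fun V => ?_
  have h1 := h V le_top
  have h2 := he V le_top
  rw [← Function.Bijective.of_comp_iff _ h2]
  convert h1 using 2 with a
  simp only [Function.comp_apply, app_sum_smul, app_res]

/-- The section of the sheaf of modules `M` given by a global section. -/
def toSections (M : X.Modules) (m : Γ(M, (⊤ : X.Opens))) : SheafOfModules.sections M :=
  PresheafOfModules.sectionsMk (fun U => res M U.unop le_top m) (fun _ _ f => res_res M le_top f.unop.le m)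

/-- The standard global sections of the free module. -/
def freeSec (X : Scheme.{u}) (n : ℕ) (i : Fin n) : Γ(freeModule X n, (⊤ : X.Opens)) :=
  (SheafOfModules.freeSection (R := X.ringCatSheaf) (ULift.up.{u} i)).eval (op ⊤)

/-- The morphism `𝒪^n ⟶ M` given by `n` global sections. -/
def frameHom {n : ℕ} (M : X.Modules) (e : Fin n → Γ(M, (⊤ : X.Opens))) : freeModule X n ⟶ M :=
  (SheafOfModules.freeHomEquiv (R := X.ringCatSheaf) M).symm fun i => toSections M (e i.down)

theorem freeHomEquiv_symm_app_freeSec {n : ℕ} (M : X.Modules)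
    (s : ULift.{u} (Fin n) → SheafOfModules.sections M) (i : Fin n) :
    Scheme.Modules.Hom.app (M := freeModule X n) (N := M)
      ((SheafOfModules.freeHomEquiv (R := X.ringCatSheaf) M).symm s) ⊤ (freeSec X n i) =
      (s ⟨i⟩).eval (op ⊤) :=
  congrArg (fun t : SheafOfModules.sections M => t.eval (op ⊤))
    (SheafOfModules.sectionsMap_freeHomEquiv_symm_freeSection (R := X.ringCatSheaf) s ⟨i⟩)

theorem frameHom_freeSec {n : ℕ} (M : X.Modules) (e : Fin n → Γ(M, (⊤ : X.Opens))) (i : Fin n) :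
    (frameHom M e).app ⊤ (freeSec X n i) = e i :=
  (freeHomEquiv_symm_app_freeSec M _ i).trans (res_self _ _ _)

theorem freeModule_hom_ext {n : ℕ} {M : X.Modules} {φ ψ : freeModule X n ⟶ M}
    (h : ∀ i, φ.app ⊤ (freeSec X n i) = ψ.app ⊤ (freeSec X n i)) : φ = ψ := by
  apply (SheafOfModules.freeHomEquiv (R := X.ringCatSheaf) M).injective
  funext i
  refine PresheafOfModules.sections_ext _ _ fun U => ?_
  have e (χ : freeModule X n ⟶ M) :
    (SheafOfModules.freeHomEquiv (R := X.ringCatSheaf) M χ i).val U =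
      res M U.unop le_top (χ.app ⊤ (freeSec X n i.down)) :=
    ((SheafOfModules.freeHomEquiv (R := X.ringCatSheaf) M χ i).property
      (homOfLE (le_top : U.unop ≤ ⊤)).op).symm
  rw [e, e, h]

/-- The structure sheaf as an `𝒪_X`-module. -/
def unitModule (X : Scheme.{u}) : X.Modules := SheafOfModules.unit X.ringCatSheaf

/-- Functions as sections of the structure sheaf. -/
def funSec (V : X.Opens) : Γ(X, V) ≃+ Γ(unitModule X, V) := AddEquiv.refl Γ(X, V)

theorem smul_funSec {V : X.Opens} (a b : Γ(X, V)) : a • funSec V b = funSec V (a * b) := rfl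

theorem res_funSec {U V : X.Opens} (h : V ≤ U) (a : Γ(X, U)) :
    res _ V h (funSec U a) = funSec V (resFun V h a) := rfl

/-- The `i`-th coordinate of `𝒪^n`. -/
def freeCoord (X : Scheme.{u}) (n : ℕ) (i : Fin n) : freeModule X n ⟶ unitModule X :=
  frameHom (unitModule X) fun j => funSec ⊤ (if j = i then 1 else 0)

/-- The section `m` as a morphism `𝒪 ⟶ M`. -/
def secHom (M : X.Modules) (m : Γ(M, (⊤ : X.Opens))) : unitModule X ⟶ M :=
  (SheafOfModules.unitHomEquiv (R := X.ringCatSheaf) M).symm (toSections M m)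

theorem secHom_app (M : X.Modules) (m : Γ(M, (⊤ : X.Opens))) (V : X.Opens) (a : Γ(X, V)) :
    (secHom M m).app V (funSec V a) = a • res M V le_top m := by
  have h1 : (secHom M m).app V (funSec V 1) = res M V le_top m :=
    congrArg (fun t : SheafOfModules.sections M => t.eval (op V))
      ((SheafOfModules.unitHomEquiv (R := X.ringCatSheaf) M).apply_symm_apply (toSections M m))
  have h2 := (secHom M m).app_smul a (funSec V 1)
  rw [h1] at h2
  rw [← h2, smul_funSec, mul_one]

/-- Evaluation of morphisms on a section, as an additive map. -/
def evalHom {M N : X.Modules} {V : X.Opens} (x : Γ(M, V)) : (M ⟶ N) →+ Γ(N, V) where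
  toFun φ := φ.app V x
  map_zero' := rfl
  map_add' _ _ := rfl

theorem sum_app {M N : X.Modules} {κ : Type*} (s : Finset κ) (φ : κ → (M ⟶ N)) {V : X.Opens}
    (x : Γ(M, V)) : (∑ i ∈ s, φ i).app V x = ∑ i ∈ s, (φ i).app V x :=
  map_sum (evalHom x) φ s

theorem freeCoord_res_freeSec (n : ℕ) (i j : Fin n) (V : X.Opens) :
    (freeCoord X n i).app V (res _ V le_top (freeSec X n j)) =
      funSec V (if j = i then 1 else 0) := by
  rw [app_res, freeCoord, frameHom_freeSec, res_funSec]
  split_ifs <;> simp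

theorem freeModule_id (n : ℕ) :
    ∑ i, freeCoord X n i ≫ secHom (freeModule X n) (freeSec X n i) = 𝟙 _ := by
  refine freeModule_hom_ext fun j => ?_
  rw [sum_app]
  have h (i : Fin n) : (freeCoord X n i ≫ secHom (freeModule X n) (freeSec X n i)).app ⊤
      (freeSec X n j) = if j = i then freeSec X n j else 0 := by
    have h1 := freeCoord_res_freeSec (X := X) n i j ⊤
    rw [res_self] at h1
    rw [Scheme.Modules.Hom.comp_app, ConcreteCategory.comp_apply, h1, secHom_app, res_self]
    split_ifs with h
    · rw [one_smul, h]
    · rw [zero_smul]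
  simp only [h, Finset.sum_ite_eq, Finset.mem_univ, if_true]
  rfl

theorem isFrame_freeSec (n : ℕ) : IsFrame (freeModule X n) (freeSec X n) := by
  intro V hV
  constructor
  · intro a b hab
    funext i
    have h (c : Fin n → Γ(X, V)) : (freeCoord X n i).app V
        (∑ j, c j • res (freeModule X n) V hV (freeSec X n j)) = funSec V (c i) := by
      rw [app_sum_smul]
      simp only [freeCoord_res_freeSec, smul_funSec, ← map_sum]
      simp
    apply (funSec V).injective
    rw [← h a, ← h b]
    exact congrArg _ hab
  · intro x
    refine ⟨fun i => (funSec V).symm ((freeCoord X n i).app V x), ?_⟩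
    have := congrArg (fun φ => Scheme.Modules.Hom.app φ V x) (freeModule_id (X := X) n)
    simp only [sum_app, Scheme.Modules.Hom.comp_app, ConcreteCategory.comp_apply] at this
    refine Eq.trans (Finset.sum_congr rfl fun i _ => ?_) this
    rw [← secHom_app, AddEquiv.apply_symm_apply]

theorem isIso_frameHom {n : ℕ} {M : X.Modules} {e : Fin n → Γ(M, (⊤ : X.Opens))}
    (he : IsFrame M e) : IsIso (frameHom M e) := by
  refine isIso_of_frame _ (isFrame_freeSec n) ?_
  simpa only [frameHom_freeSec] using he

theorem le_preimage_top (f : T ⟶ X) (V : T.Opens) : V ≤ f ⁻¹ᵁ ⊤ := le_top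

/-- The morphism `𝒪_T^n ⟶ f^* 𝒪_X^n` given by the pulled back standard sections is inverse to the
adjoint of `𝒪_X^n ⟶ f_* 𝒪_T^n`. -/
theorem isFrame_pullSec_freeSec (f : T ⟶ X) (n : ℕ) :
    IsFrame ((Scheme.Modules.pullback f).obj (freeModule X n))
      (fun i => pullSec f _ ⊤ (le_preimage_top f ⊤) (freeSec X n i)) := by
  let φ := frameHom ((Scheme.Modules.pullback f).obj (freeModule X n))
    (fun i => pullSec f _ ⊤ (le_preimage_top f ⊤) (freeSec X n i))
  let ψ : (Scheme.Modules.pullback f).obj (freeModule X n) ⟶ freeModule T n :=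
    pullLift f (frameHom ((Scheme.Modules.pushforward f).obj (freeModule T n)) (freeSec T n))
  have hφ (V : T.Opens) (i : Fin n) : φ.app V (res _ V le_top (freeSec T n i)) =
      pullSec f _ V (le_preimage_top f V) (freeSec X n i) := by
    rw [app_res, frameHom_freeSec, res_pullSec]
  have hψ (V : T.Opens) (i : Fin n) : ψ.app V (pullSec f _ V (le_preimage_top f V) (freeSec X n i)) =
      res _ V le_top (freeSec T n i) := by
    refine (pullLift_pullSec f _ V (le_preimage_top f V) _).trans ?_
    exact congrArg (fun x : Γ(freeModule T n, f ⁻¹ᵁ ⊤) => res _ V (le_preimage_top f V) x)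
      (frameHom_freeSec ((Scheme.Modules.pushforward f).obj (freeModule T n)) (freeSec T n) i)
  have h1 : φ ≫ ψ = 𝟙 _ := freeModule_hom_ext fun i => by
    have h1 := hφ ⊤ i
    rw [res_self] at h1
    rw [Scheme.Modules.Hom.comp_app, ConcreteCategory.comp_apply, h1, hψ, res_self]
    rfl
  have h2 : ψ ≫ φ = 𝟙 _ := by
    refine pullback_hom_ext f fun U V hV m => ?_
    obtain ⟨a, rfl⟩ := (isFrame_freeSec (X := X) n U le_top).2 m
    simp only [map_sum, pullSec_smul, Scheme.Modules.Hom.app_smul, pullSec_res]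
    refine Finset.sum_congr rfl fun i _ => ?_
    rw [Scheme.Modules.Hom.comp_app, ConcreteCategory.comp_apply, hψ, hφ]
    rfl
  have : IsIso φ := ⟨ψ, h1, h2⟩
  have h := (isFrame_freeSec (X := T) n).map_iso φ
  simp only [φ, frameHom_freeSec] at h
  exact h

/-- The pullback of a global frame is a frame. -/
theorem IsFrame.pullSec_top (f : T ⟶ X) {n : ℕ} {M : X.Modules} {e : Fin n → Γ(M, (⊤ : X.Opens))}
    (he : IsFrame M e) : IsFrame ((Scheme.Modules.pullback f).obj M)
      (fun i => pullSec f M ⊤ (le_preimage_top f ⊤) (e i)) := by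
  have := isIso_frameHom he
  have h := (isFrame_pullSec_freeSec f n).map_iso ((Scheme.Modules.pullback f).map (frameHom M e))
  have h' (i : Fin n) : ((Scheme.Modules.pullback f).map (frameHom M e)).app ⊤
      (pullSec f _ ⊤ (le_preimage_top f ⊤) (freeSec X n i)) = pullSec f M ⊤ (le_preimage_top f ⊤) (e i) :=
    (map_pullSec f (frameHom M e) ⊤ (le_preimage_top f ⊤) _).trans (congrArg _ (frameHom_freeSec M e i))
  simp only [h'] at h
  exact h

theorem pullSec_openImmersion_bijective (f : T ⟶ X) [IsOpenImmersion f] (M : X.Modules)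
    (W : T.Opens) (U : X.Opens) (hU : U = f ''ᵁ W) (h : W ≤ f ⁻¹ᵁ U) :
    Function.Bijective (pullSec f M (U := U) W h) := by
  subst hU
  let φ := (Scheme.Modules.restrictFunctorIsoPullback f).app M
  have e : ∀ x : Γ(M, f ''ᵁ W), φ.hom.app W x = pullSec f M W h x := by
    intro x
    have e1 := Adjunction.unit_leftAdjointUniq_hom_app (Scheme.Modules.restrictAdjunction f)
      (Scheme.Modules.pullbackPushforwardAdjunction f) M
    have e2 : φ.hom.app (f ⁻¹ᵁ f ''ᵁ W) (res M _ (f.image_preimage_le _) x) =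
        unitSec f M _ x := congrArg (fun φ => Scheme.Modules.Hom.app φ (f ''ᵁ W) x) e1
    rw [pullSec_eq, ← e2]
    refine Eq.trans ?_ (app_res φ.hom h _)
    congr 1
    refine ((res_res M _ _ _).trans (res_self M le_rfl x)).symm
  have := app_bijective φ.hom W
  have e' : (fun x : Γ(M, f ''ᵁ W) => φ.hom.app W x) = pullSec f M W h := funext e
  rw [← e']
  exact this

end Frames

/-! ### Frames of pullbacks and local frames -/

section LocalFrames
variable {X Y T S : Scheme.{u}} {ι : Type} [Fintype ι]

theorem pullFun_openImmersion_bijective (f : T ⟶ X) [IsOpenImmersion f]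
    (W : T.Opens) (U : X.Opens) (hU : U = f ''ᵁ W) (h : W ≤ f ⁻¹ᵁ U) :
    Function.Bijective (pullFun f (U := U) W h) := by
  subst hU
  have : IsIso (f.appLE (f ''ᵁ W) W h) := by
    rw [← Scheme.Hom.appIso_hom']
    infer_instance
  exact ConcreteCategory.bijective_of_isIso (f.appLE (f ''ᵁ W) W h)

theorem pullSec_sum_smul (f : T ⟶ X) (M : X.Modules) {U : X.Opens} (V : T.Opens)
    (h : V ≤ f ⁻¹ᵁ U) (a : ι → Γ(X, U)) (m : ι → Γ(M, U)) :
    pullSec f M V h (∑ i, a i • m i) = ∑ i, pullFun f V h (a i) • pullSec f M V h (m i) := by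
  rw [map_sum]
  exact Finset.sum_congr rfl fun i _ => pullSec_smul _ _ _ _ _ _

/-- Along an open immersion, sections form a frame if and only if their pullbacks do; this reduces
statements on local frames to global ones. -/
theorem isFrame_iff_openImmersion (f : T ⟶ X) [IsOpenImmersion f] (M : X.Modules) {U : X.Opens}
    (W : T.Opens) (hU : U = f ''ᵁ W) (h : W ≤ f ⁻¹ᵁ U) (e : ι → Γ(M, U)) :
    IsFrame M e ↔ IsFrame ((Scheme.Modules.pullback f).obj M) (fun i => pullSec f M W h (e i)) := by
  have key (V : X.Opens) (W' : T.Opens) (hV : V ≤ U) (hW : W' ≤ W) (hVW : V = f ''ᵁ W') :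
      Function.Bijective (fun a : ι → Γ(X, V) => ∑ i, a i • res M V hV (e i)) ↔
      Function.Bijective (fun a : ι → Γ(T, W') => ∑ i, a i • res _ W' hW (pullSec f M W h (e i))) := by
    have h' : W' ≤ f ⁻¹ᵁ V := by rw [hVW, f.preimage_image_eq]
    have b1 := pullSec_openImmersion_bijective f M W' V hVW h'
    have b2 := pullFun_openImmersion_bijective f W' V hVW h'
    have b3 : Function.Bijective (fun (a : ι → Γ(X, V)) (i : ι) => pullFun f W' h' (a i)) :=
      (Equiv.piCongrRight fun _ : ι => Equiv.ofBijective _ b2).bijective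
    rw [← Function.Bijective.of_comp_iff' b1, ← Function.Bijective.of_comp_iff _ b3]
    refine Eq.to_iff (congrArg _ (funext fun a => ?_))
    simp only [Function.comp_apply, pullSec_sum_smul, pullSec_res, res_pullSec]
  constructor
  · intro he W' hW
    refine (key (f ''ᵁ W') W' ?_ hW rfl).1 (he _ _)
    rw [hU]; exact f.image_mono hW
  · intro he V hV
    have e1 : V = f ''ᵁ (f ⁻¹ᵁ V) := by
      rw [f.image_preimage_eq_opensRange_inf, eq_comm, inf_eq_right]
      exact hV.trans (hU ▸ f.image_le_opensRange W)
    refine (key V (f ⁻¹ᵁ V) hV ?_ e1).2 (he _ _)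
    have : f ⁻¹ᵁ V ≤ f ⁻¹ᵁ f ''ᵁ W := f.preimage_mono (hU ▸ hV)
    rwa [f.preimage_image_eq] at this

theorem isFrame_iff_ι (M : X.Modules) {U : X.Opens} (e : ι → Γ(M, U)) :
    IsFrame M e ↔ IsFrame ((Scheme.Modules.pullback U.ι).obj M)
      (fun i => pullSec U.ι M (⊤ : (U : Scheme.{u}).Opens) (by simp) (e i)) :=
  isFrame_iff_openImmersion U.ι M ⊤ (by simp) _ e

/-- The pullback of a local frame is a frame. -/
theorem IsFrame.pullSec (f : T ⟶ X) {n : ℕ} {M : X.Modules} {U : X.Opens} {e : Fin n → Γ(M, U)}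
    (he : IsFrame M e) {V : T.Opens} (h : V ≤ f ⁻¹ᵁ U) :
    IsFrame ((Scheme.Modules.pullback f).obj M) (fun i => pullSec f M V h (e i)) := by
  -- Restricted to `U` and `V` the frames are global, and `f` induces a morphism `V ⟶ U`.
  rw [isFrame_iff_ι] at he ⊢
  have h1 := he.pullSec_top (f.resLE U V h)
  have h2 := h1.map_iso (pullbackIso (f.resLE_comp_ι h) M).hom
  have hVf : (⊤ : (V : Scheme.{u}).Opens) ≤ (V.ι ≫ f) ⁻¹ᵁ U := by
    rw [Scheme.Hom.comp_preimage]
    exact (by simp : (⊤ : (V : Scheme.{u}).Opens) ≤ V.ι ⁻¹ᵁ V).trans (V.ι.preimage_mono h)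
  have h3 := h2.map_iso (pullbackIso (rfl : V.ι ≫ f = V.ι ≫ f) M).inv
  have key (i : Fin n) : (pullbackIso (rfl : V.ι ≫ f = V.ι ≫ f) M).inv.app ⊤
      ((pullbackIso (f.resLE_comp_ι h) M).hom.app ⊤ (TautSection.pullSec (f.resLE U V h) _ ⊤
        (le_preimage_top (f.resLE U V h) ⊤)
        (TautSection.pullSec U.ι M (⊤ : (U : Scheme.{u}).Opens) (by simp) (e i)))) =
      TautSection.pullSec V.ι _ (⊤ : (V : Scheme.{u}).Opens) (by simp) (TautSection.pullSec f M V h (e i)) := by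
    apply (app_bijective (pullbackIso (rfl : V.ι ≫ f = V.ι ≫ f) M).hom ⊤).1
    rw [pullbackIso_pullSec _ _ _ _ hVf, pullbackIso_pullSec _ _ _ _ hVf]
    rw [← ConcreteCategory.comp_apply, ← Scheme.Modules.Hom.comp_app, Iso.inv_hom_id]
    rfl
  simp only [key] at h3
  exact h3

/-- A vector bundle has local frames. -/
theorem IsVectorBundle.exists_frame {M : X.Modules} {n : ℕ} (h : IsVectorBundle M n) (x : X) :
    ∃ U : X.Opens, x ∈ U ∧ ∃ e : Fin n → Γ(M, U), IsFrame M e := by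
  obtain ⟨U, hx, ⟨φ⟩⟩ := h x
  refine ⟨U, hx, ?_⟩
  let φ' : freeModule U n ≅ M.restrict U.ι := φ.symm
  let ψ := φ' ≪≫ (Scheme.Modules.restrictFunctorIsoPullback U.ι).app M
  have h1 := (isFrame_freeSec n).map_iso ψ.hom
  have b := pullSec_openImmersion_bijective U.ι M (⊤ : (U : Scheme.{u}).Opens) U (by simp) (by simp)
  choose e he using fun i => b.2 (ψ.hom.app ⊤ (freeSec U n i))
  refine ⟨e, (isFrame_iff_ι M e).2 ?_⟩
  simp only [he]
  exact h1

theorem IsFrame.isVectorBundle {M : X.Modules} {n : ℕ} {e : Fin n → Γ(M, (⊤ : X.Opens))}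
    (he : IsFrame M e) : IsVectorBundle M n := by
  intro x
  refine ⟨⊤, trivial, ⟨?_⟩⟩
  have := isIso_frameHom (he.pullSec_top (⊤ : X.Opens).ι)
  exact (Scheme.Modules.restrictFunctorIsoPullback (⊤ : X.Opens).ι).app M ≪≫
    (asIso (frameHom _ (fun i => TautSection.pullSec (⊤ : X.Opens).ι M ⊤ (le_preimage_top _ ⊤) (e i)))).symm

end LocalFrames

/-! ### The flag spanned by a frame -/

section StandardFlag
variable {X Y T S : Scheme.{u}} {ι : Type} [Fintype ι]

/-- Morphisms out of a module with a global frame are determined by their values on the frame. -/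
theorem IsFrame.hom_ext {M N : X.Modules} {e : ι → Γ(M, (⊤ : X.Opens))} (he : IsFrame M e)
    {φ ψ : M ⟶ N} (h : ∀ i, φ.app ⊤ (e i) = ψ.app ⊤ (e i)) : φ = ψ := by
  ext V m
  obtain ⟨a, rfl⟩ := (he V le_top).2 m
  simp only [app_sum_smul, app_res, h]

/-- The morphism defined on a module with a global frame by the images of the frame. -/
def IsFrame.desc {n : ℕ} {M N : X.Modules} {e : Fin n → Γ(M, (⊤ : X.Opens))} (he : IsFrame M e)
    (m : Fin n → Γ(N, (⊤ : X.Opens))) : M ⟶ N :=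
  letI := isIso_frameHom he
  inv (frameHom M e) ≫ frameHom N m

theorem IsFrame.desc_apply {n : ℕ} {M N : X.Modules} {e : Fin n → Γ(M, (⊤ : X.Opens))}
    (he : IsFrame M e) (m : Fin n → Γ(N, (⊤ : X.Opens))) (i : Fin n) :
    (he.desc m).app ⊤ (e i) = m i := by
  have := isIso_frameHom he
  have h : frameHom M e ≫ he.desc m = frameHom N m := by simp [IsFrame.desc]
  rw [← frameHom_freeSec N m, ← h, Scheme.Modules.Hom.comp_app, ConcreteCategory.comp_apply,
    frameHom_freeSec]

theorem mono_of_injective {M N : X.Modules} (φ : M ⟶ N)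
    (h : ∀ V : X.Opens, Function.Injective (φ.app V)) : Mono φ := by
  refine ⟨fun {K} α β hab => ?_⟩
  ext V m
  apply h V
  have := congrArg (fun χ => Scheme.Modules.Hom.app χ V m) hab
  simpa only [Scheme.Modules.Hom.comp_app, ConcreteCategory.comp_apply] using this

/-- The inclusion of the span of the first `k` members of a frame. -/
def flagMap {D : ℕ} {E : X.Modules} (e : Fin D → Γ(E, (⊤ : X.Opens))) (k : ℕ) (hk : k ≤ D) :
    freeModule X k ⟶ E :=
  frameHom E fun j => e (Fin.castLE hk j)

theorem sum_castLE {D k : ℕ} (hk : k ≤ D) {A : Type*} [AddCommMonoid A] (f : Fin D → A)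
    (hf : ∀ j : Fin D, k ≤ j → f j = 0) : ∑ j, f j = ∑ j : Fin k, f (Fin.castLE hk j) := by
  obtain ⟨l, rfl⟩ := Nat.exists_eq_add_of_le hk
  rw [Fin.sum_univ_add]
  have : ∑ i : Fin l, f (Fin.natAdd k i) = 0 :=
    Finset.sum_eq_zero fun i _ => hf _ (by simp)
  rw [this, add_zero]
  rfl

/-- A map which sends a frame to the first members of a frame is injective on sections. -/
theorem IsFrame.injective_of_castLE {D k : ℕ} (hk : k ≤ D) {Z E : X.Modules} {U : X.Opens}
    {e : Fin D → Γ(E, U)} (he : IsFrame E e)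
    {z : Fin k → Γ(Z, U)} (hz : IsFrame Z z) (i : Z ⟶ E)
    (hi : ∀ j, i.app U (z j) = e (Fin.castLE hk j)) {V : X.Opens} (hV : V ≤ U) :
    Function.Injective (i.app V) := by
  intro x y hxy
  obtain ⟨a, rfl⟩ := (hz V hV).2 x
  obtain ⟨b, rfl⟩ := (hz V hV).2 y
  simp only [app_sum_smul, app_res, hi] at hxy
  have h (c : Fin k → Γ(X, V)) : ∑ j, c j • TautSection.res E V hV (e (Fin.castLE hk j)) =
      ∑ j : Fin D, (if h : (j : ℕ) < k then c ⟨j, h⟩ else 0) • TautSection.res E V hV (e j) := by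
    rw [sum_castLE hk]
    · simp
    · intro j hj
      rw [dif_neg (not_lt.2 hj), zero_smul]
  rw [h, h] at hxy
  have h2 := (he V hV).1 hxy
  have : a = b := by
    funext j
    have := congrFun h2 (Fin.castLE hk j)
    simpa using this
  rw [this]

theorem mono_flagMap {D : ℕ} {E : X.Modules} {e : Fin D → Γ(E, (⊤ : X.Opens))} (he : IsFrame E e)
    (k : ℕ) (hk : k ≤ D) : Mono (flagMap e k hk) :=
  mono_of_injective _ fun _ => he.injective_of_castLE hk (isFrame_freeSec k) _
    (fun j => frameHom_freeSec _ _ j) le_top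

/-- The cokernel of a map into a module with a frame `e`, whose image is spanned by the first `k`
members of `e`, has the other members as a frame. -/
theorem IsFrame.cokernel {D : ℕ} {Z E : X.Modules} {e : Fin D → Γ(E, (⊤ : X.Opens))}
    (he : IsFrame E e) (k : ℕ) (hk : k ≤ D) (i : Z ⟶ E)
    (hi : ∀ {K : X.Modules} (g : E ⟶ K), i ≫ g = 0 ↔ ∀ j : Fin k, g.app ⊤ (e (Fin.castLE hk j)) = 0) :
    IsFrame (Limits.cokernel i) (fun j : Fin (D - k) =>
      (Limits.cokernel.π i).app ⊤ (e ⟨k + j, by omega⟩)) := by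
  let q : E ⟶ freeModule X (D - k) := he.desc fun j =>
    if h : k ≤ j then freeSec X (D - k) ⟨j - k, by omega⟩ else 0
  have hq : i ≫ q = 0 := (hi q).2 fun j => by
    simp only [q, he.desc_apply]
    rw [dif_neg (by simp)]
  let s : freeModule X (D - k) ⟶ E := frameHom E fun j => e ⟨k + j, by omega⟩
  let α : Limits.cokernel i ⟶ freeModule X (D - k) := Limits.cokernel.desc i q hq
  let β := s ≫ Limits.cokernel.π i
  have hπ : ∀ j : Fin k, (Limits.cokernel.π i).app ⊤ (e (Fin.castLE hk j)) = 0 :=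
    (hi (Limits.cokernel.π i)).1 (cokernel.condition i)
  have h1 : α ≫ β = 𝟙 _ := by
    rw [← cancel_epi (Limits.cokernel.π i)]
    refine he.hom_ext fun j => ?_
    simp only [α, β, cokernel.π_desc_assoc, Category.comp_id, Scheme.Modules.Hom.comp_app,
      ConcreteCategory.comp_apply, q, he.desc_apply]
    split_ifs with h
    · simp only [s, frameHom_freeSec]
      congr 2
      ext
      simp; omega
    · rw [map_zero, map_zero]
      exact (hπ ⟨j, by omega⟩).symm
  have h2 : β ≫ α = 𝟙 _ := by
    refine freeModule_hom_ext fun j => ?_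
    simp only [α, β, Category.assoc, cokernel.π_desc, Scheme.Modules.Hom.comp_app,
      ConcreteCategory.comp_apply, s, frameHom_freeSec, q, he.desc_apply]
    rw [dif_pos (by simp)]
    simp
  have : IsIso β := ⟨α, h2, h1⟩
  have h := (isFrame_freeSec (X := X) (D - k)).map_iso β
  simp only [β, s, Scheme.Modules.Hom.comp_app, ConcreteCategory.comp_apply, frameHom_freeSec] at h
  exact h

theorem comp_eq_zero_iff {k : ℕ} {Z E K : X.Modules} {z : Fin k → Γ(Z, (⊤ : X.Opens))}
    (hz : IsFrame Z z) (i : Z ⟶ E) (g : E ⟶ K) : i ≫ g = 0 ↔ ∀ j, g.app ⊤ (i.app ⊤ (z j)) = 0 := by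
  constructor
  · intro h j
    have := congrArg (fun χ => Scheme.Modules.Hom.app χ ⊤ (z j)) h
    exact this
  · intro h
    refine hz.hom_ext fun j => ?_
    rw [Scheme.Modules.Hom.comp_app, ConcreteCategory.comp_apply, h]
    rfl

/-- The frame of `Z_k`, the span of the first `k` members of the frame `e`. -/
def flagSec {D : ℕ} {E : X.Modules} {e : Fin D → Γ(E, (⊤ : X.Opens))} (he : IsFrame E e)
    (k : ℕ) (hk : k ≤ D) (j : Fin k) :
    letI := mono_flagMap he k hk
    Γ((Subobject.mk (flagMap e k hk) : X.Modules), (⊤ : X.Opens)) :=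
  letI := mono_flagMap he k hk
  (Subobject.underlyingIso (flagMap e k hk)).inv.app ⊤ (freeSec X k j)

theorem isFrame_flagSec {D : ℕ} {E : X.Modules} {e : Fin D → Γ(E, (⊤ : X.Opens))}
    (he : IsFrame E e) (k : ℕ) (hk : k ≤ D) : IsFrame _ (flagSec he k hk) :=
  letI := mono_flagMap he k hk
  (isFrame_freeSec k).map_iso (Subobject.underlyingIso (flagMap e k hk)).inv

theorem arrow_flagSec {D : ℕ} {E : X.Modules} {e : Fin D → Γ(E, (⊤ : X.Opens))}
    (he : IsFrame E e) (k : ℕ) (hk : k ≤ D) (j : Fin k) :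
    letI := mono_flagMap he k hk
    (Subobject.mk (flagMap e k hk)).arrow.app ⊤ (flagSec he k hk j) = e (Fin.castLE hk j) := by
  have := mono_flagMap he k hk
  rw [flagSec, ← ConcreteCategory.comp_apply, ← Scheme.Modules.Hom.comp_app,
    Subobject.underlyingIso_arrow, flagMap, frameHom_freeSec]

/-- The complete flag spanned by a frame: its `k`-th member is the span of the first `k` members of
the frame. -/
def flagOfFrame {D : ℕ} {E : X.Modules} {e : Fin D → Γ(E, (⊤ : X.Opens))} (he : IsFrame E e) :
    CompleteFlag E D where
  sub k := letI := mono_flagMap he k (Nat.lt_succ_iff.1 k.2)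
    Subobject.mk (flagMap e k (Nat.lt_succ_iff.1 k.2))
  mono k l hkl := by
    have := mono_flagMap he k (Nat.lt_succ_iff.1 k.2)
    have := mono_flagMap he l (Nat.lt_succ_iff.1 l.2)
    refine Subobject.mk_le_mk_of_comm
      (frameHom _ fun j => freeSec X l (Fin.castLE hkl j)) (freeModule_hom_ext fun j => ?_)
    simp only [flagMap, Scheme.Modules.Hom.comp_app, ConcreteCategory.comp_apply, frameHom_freeSec]
    rfl
  rank_sub k := (isFrame_flagSec he k _).isVectorBundle
  rank_quot k := by
    refine (he.cokernel k (Nat.lt_succ_iff.1 k.2) _ fun g => ?_).isVectorBundle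
    rw [comp_eq_zero_iff (isFrame_flagSec he k _)]
    simp only [arrow_flagSec]

end StandardFlag

/-! ### Local properties of sections and morphisms -/

section LocalToGlobal
variable {X Y T S : Scheme.{u}}

theorem section_ext {M : X.Modules} {V : X.Opens} {x y : Γ(M, V)}
    (h : ∀ p ∈ V, ∃ (U : X.Opens) (hU : U ≤ V), p ∈ U ∧ res M U hU x = res M U hU y) : x = y := by
  choose U hU hp he using h
  refine TopCat.Sheaf.eq_of_locally_eq' (⟨M.presheaf, M.isSheaf⟩ : TopCat.Sheaf Ab.{u} X)
    (fun p : V => U p.1 p.2) V (fun p => homOfLE (hU p.1 p.2)) ?_ x y (fun p => he p.1 p.2)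
  intro p hpV
  exact Opens.mem_iSup.2 ⟨⟨p, hpV⟩, hp p hpV⟩

theorem section_glue {M : X.Modules} {V : X.Opens} {κ : Type u} (U : κ → X.Opens)
    (hU : ∀ i, U i ≤ V) (hc : V ≤ iSup U) (s : ∀ i, Γ(M, U i))
    (hs : ∀ i j, res M (U i ⊓ U j) inf_le_left (s i) = res M (U i ⊓ U j) inf_le_right (s j)) :
    ∃ y : Γ(M, V), ∀ i, res M (U i) (hU i) y = s i :=
  (TopCat.Sheaf.existsUnique_gluing' (⟨M.presheaf, M.isSheaf⟩ : TopCat.Sheaf Ab.{u} X)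
    U V (fun i => homOfLE (hU i)) hc s hs).exists

/-- A morphism is an isomorphism as soon as it is bijective on sections over a basis of opens. -/
theorem isIso_of_basis {M N : X.Modules} (φ : M ⟶ N)
    (h : ∀ (V : X.Opens) (x : X), x ∈ V → ∃ U : X.Opens, U ≤ V ∧ x ∈ U ∧
      Function.Bijective (φ.app U)) : IsIso φ := by
  have hinj (V : X.Opens) : Function.Injective (φ.app V) := fun a b hab => by
    refine section_ext fun p hp => ?_
    obtain ⟨U, hU, hpU, hb⟩ := h V p hp
    refine ⟨U, hU, hpU, hb.1 ?_⟩
    rw [app_res, app_res, hab]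
  refine isIso_of_bijective φ fun V => ⟨hinj V, fun y => ?_⟩
  choose U hU hpU hb using fun p : V => h V p.1 p.2
  choose s hs using fun p : V => (hb p).2 (res N (U p) (hU p) y)
  obtain ⟨x, hx⟩ := section_glue U hU
    (fun p hp => Opens.mem_iSup.2 ⟨⟨p, hp⟩, hpU ⟨p, hp⟩⟩) s (fun i j => by
      apply hinj
      rw [app_res, app_res, hs, hs, res_res, res_res])
  refine ⟨x, section_ext fun p hp => ⟨U ⟨p, hp⟩, hU _, hpU ⟨p, hp⟩, ?_⟩⟩
  rw [← app_res, hx, hs]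

/-- The section `y` is locally in the image of `φ`. -/
def LocallyInImage {M N : X.Modules} (φ : M ⟶ N) {V : X.Opens} (y : Γ(N, V)) : Prop :=
  ∀ p ∈ V, ∃ (U : X.Opens) (hU : U ≤ V), p ∈ U ∧ ∃ x : Γ(M, U), φ.app U x = res N U hU y

theorem LocallyInImage.add {M N : X.Modules} {φ : M ⟶ N} {V : X.Opens} {a b : Γ(N, V)}
    (ha : LocallyInImage φ a) (hb : LocallyInImage φ b) : LocallyInImage φ (a + b) := by
  intro p hp
  obtain ⟨U, hU, hpU, x, hx⟩ := ha p hp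
  obtain ⟨U', hU', hpU', x', hx'⟩ := hb p hp
  refine ⟨U ⊓ U', inf_le_left.trans hU, ⟨hpU, hpU'⟩,
    res M _ inf_le_left x + res M _ inf_le_right x', ?_⟩
  rw [map_add, app_res, app_res, hx, hx', res_res, res_res, map_add]

theorem LocallyInImage.smul {M N : X.Modules} {φ : M ⟶ N} {V : X.Opens} {a : Γ(N, V)}
    (ha : LocallyInImage φ a) (c : Γ(X, V)) : LocallyInImage φ (c • a) := by
  intro p hp
  obtain ⟨U, hU, hpU, x, hx⟩ := ha p hp
  refine ⟨U, hU, hpU, resFun U hU c • x, ?_⟩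
  rw [Scheme.Modules.Hom.app_smul, hx, res_smul]

theorem LocallyInImage.res {M N : X.Modules} {φ : M ⟶ N} {V V' : X.Opens} {a : Γ(N, V)}
    (ha : LocallyInImage φ a) (h : V' ≤ V) : LocallyInImage φ (res N V' h a) := by
  intro p hp
  obtain ⟨U, hU, hpU, x, hx⟩ := ha p (h hp)
  refine ⟨U ⊓ V', inf_le_right, ⟨hpU, hp⟩, TautSection.res M _ inf_le_left x, ?_⟩
  rw [app_res, hx, res_res, res_res]

/-- The subsheaf of sections which are locally in the image of `φ`. -/
def locImage {M N : X.Modules} (φ : M ⟶ N) : N.val.Submodule where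
  obj V :=
    { carrier := {y | LocallyInImage φ (V := V.unop) y}
      add_mem' := fun ha hb => LocallyInImage.add ha hb
      zero_mem' := fun p hp => ⟨V.unop, le_rfl, hp, 0, by
        rw [map_zero]; exact (map_zero (res N _ _)).symm⟩
      smul_mem' := fun c _ hy => LocallyInImage.smul hy c }
  map f _ hy := LocallyInImage.res (V := _) hy f.unop.le

theorem locImage_isSheaf {M N : X.Modules} (φ : M ⟶ N) :
    TopCat.Presheaf.IsSheaf (X := X) ((locImage φ).toPresheafOfModules.presheaf : TopCat.Presheaf Ab.{u} X) := by
  rw [TopCat.Presheaf.isSheaf_iff_isSheafUniqueGluing]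
  intro ι U sf hsf
  let s : ∀ i, (locImage φ).obj (op (U i)) := sf
  have hs : ∀ i j, res N (U i ⊓ U j) inf_le_left ((s i).1 : Γ(N, U i)) =
      res N (U i ⊓ U j) inf_le_right ((s j).1 : Γ(N, U j)) := fun i j =>
    congrArg (fun a : (locImage φ).obj (op (U i ⊓ U j)) => a.1) (hsf i j)
  obtain ⟨y, hy⟩ := section_glue U (le_iSup U) le_rfl (fun i => ((s i).1 : Γ(N, U i))) hs
  have hmem : (y : N.val.obj (op (iSup U))) ∈ (locImage φ).obj (op (iSup U)) := by
    intro p hp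
    obtain ⟨i, hi⟩ := Opens.mem_iSup.1 hp
    obtain ⟨U', hU', hpU, x, hx⟩ := (s i).2 p hi
    refine ⟨U', hU'.trans (le_iSup U i), hpU, x, hx.trans ?_⟩
    have := hy i
    rw [← res_res N (le_iSup U i) hU', this]
  refine ⟨(⟨y, hmem⟩ : (locImage φ).obj (op (iSup U))), fun i => Subtype.ext (hy i), ?_⟩
  intro t ht
  refine Subtype.ext (section_ext (M := N) fun p hp => ?_)
  obtain ⟨i, hi⟩ := Opens.mem_iSup.1 hp
  exact ⟨U i, le_iSup U i, hi, (congrArg Subtype.val (ht i)).trans (hy i).symm⟩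

/-- An epimorphism of `𝒪_X`-modules is locally surjective. -/
theorem exists_local_preimage {M N : X.Modules} (φ : M ⟶ N) [Epi φ] {V : X.Opens} (y : Γ(N, V))
    {p : X} (hp : p ∈ V) : ∃ (U : X.Opens) (hU : U ≤ V), p ∈ U ∧
      ∃ x : Γ(M, U), φ.app U x = res N U hU y := by
  -- The inclusion of the image sheaf is a monomorphism, and an epimorphism because `φ` factors
  -- through it; hence it is an isomorphism.
  let I : X.Modules := ⟨(locImage φ).toPresheafOfModules, locImage_isSheaf φ⟩
  let i : I ⟶ N := ⟨(locImage φ).ι⟩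
  let π : M ⟶ I := ⟨PresheafOfModules.homMk
    { app := fun V => AddCommGrpCat.ofHom
        { toFun := fun x => (⟨φ.app V.unop x, fun p hp => ⟨V.unop, le_rfl, hp, x, (res_self _ _ _).symm⟩⟩ :
            (locImage φ).obj V)
          map_zero' := Subtype.ext (map_zero (φ.app V.unop).hom)
          map_add' := fun a b => Subtype.ext (map_add (φ.app V.unop).hom a b) }
      naturality := fun V V' f => by
        ext x
        exact Subtype.ext (app_res φ f.unop.le x) }
    (fun V c x => Subtype.ext (φ.app_smul c x))⟩
  have h : π ≫ i = φ := rfl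
  have : Mono i := mono_of_injective i fun V a b hab => Subtype.ext hab
  have : Epi i := epi_of_epi_fac h
  have : IsIso i := isIso_of_mono_of_epi i
  obtain ⟨z, hz⟩ := (app_bijective i V).2 y
  obtain ⟨U, hU, hpU, x, hx⟩ := z.2 p hp
  exact ⟨U, hU, hpU, x, hx.trans (congrArg (res N U hU) hz)⟩

theorem exists_open_le_finite {n : ℕ} (x : X) (U : Fin n → X.Opens) (hx : ∀ i, x ∈ U i) :
    ∃ W : X.Opens, x ∈ W ∧ ∀ i, W ≤ U i := by
  induction n with
  | zero => exact ⟨⊤, trivial, fun i => i.elim0⟩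
  | succ n ih =>
    obtain ⟨W, hW, h⟩ := ih (fun i => U i.succ) fun i => hx _
    refine ⟨W ⊓ U 0, ⟨hW, hx 0⟩, fun i => ?_⟩
    refine Fin.cases inf_le_right (fun i => inf_le_left.trans (h i)) i

/-- Near every point, `M` has a frame with `n` members. -/
def HasLocalFrames (M : X.Modules) (n : ℕ) : Prop :=
  ∀ x : X, ∃ U : X.Opens, x ∈ U ∧ ∃ e : Fin n → Γ(M, U), IsFrame M e

theorem HasLocalFrames.pullback {M : X.Modules} {n : ℕ} (h : HasLocalFrames M n) (f : T ⟶ X) :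
    HasLocalFrames ((Scheme.Modules.pullback f).obj M) n := by
  intro x
  obtain ⟨U, hx, e, he⟩ := h (f x)
  exact ⟨f ⁻¹ᵁ U, hx, _, he.pullSec f le_rfl⟩

/-- The map given in frames by an invertible matrix is bijective. -/
theorem bijective_of_matrix {n : ℕ} {A B : X.Modules} (φ : A ⟶ B) {W : X.Opens}
    {a : Fin n → Γ(A, W)} {b : Fin n → Γ(B, W)} (ha : IsFrame A a) (hb : IsFrame B b)
    (C D : Matrix (Fin n) (Fin n) Γ(X, W)) (hDC : D * C = 1)
    (hC : ∀ j, φ.app W (a j) = ∑ i, C j i • b i) : Function.Bijective (φ.app W) := by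
  have hCD : C * D = 1 := mul_eq_one_comm.1 hDC
  have ha' := ha W le_rfl
  have hb' := hb W le_rfl
  simp only [res_self] at ha' hb'
  rw [← Function.Bijective.of_comp_iff _ ha']
  have e : (φ.app W) ∘ (fun v : Fin n → Γ(X, W) => ∑ i, v i • a i) =
      (fun v => ∑ i, v i • b i) ∘ (fun v => Matrix.vecMul v C) := by
    funext v
    simp only [Function.comp_apply, app_sum_smul, hC, Matrix.vecMul, dotProduct,
      Finset.sum_smul, Finset.smul_sum, smul_smul]
    exact Finset.sum_comm
  rw [e]
  refine hb'.comp (Function.bijective_iff_has_inverse.2 ⟨fun v => Matrix.vecMul v D, ?_, ?_⟩)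
  · intro v; simp [Matrix.vecMul_vecMul, hCD]
  · intro v; simp [Matrix.vecMul_vecMul, hDC]

/-- An epimorphism between vector bundles of the same rank is an isomorphism. -/
theorem isIso_of_epi_of_rank {n : ℕ} {A B : X.Modules} (φ : A ⟶ B) [Epi φ]
    (hA : HasLocalFrames A n) (hB : HasLocalFrames B n) : IsIso φ := by
  refine isIso_of_basis φ fun V x hx => ?_
  obtain ⟨U₁, hx₁, a, ha⟩ := hA x
  obtain ⟨U₂, hx₂, b, hb⟩ := hB x
  -- Lifting a frame of `B` locally gives a matrix `D` with `D * C = 1`, where `C` is the matrix of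
  -- `φ`; both are square, so `C` is invertible.
  choose U' hU' hxU' y' hy' using fun i => exists_local_preimage φ (b i) hx₂
  obtain ⟨W', hxW', hW'⟩ := exists_open_le_finite x U' hxU'
  let W := W' ⊓ V ⊓ U₁ ⊓ U₂
  have hWV : W ≤ V := inf_le_left.trans (inf_le_left.trans inf_le_right)
  have hW₁ : W ≤ U₁ := inf_le_left.trans inf_le_right
  have hW₂ : W ≤ U₂ := inf_le_right
  have hWU (i) : W ≤ U' i := (inf_le_left.trans (inf_le_left.trans inf_le_left)).trans (hW' i)
  have ha' := ha.res hW₁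
  have hb' := hb.res hW₂
  have haW := ha' W le_rfl
  have hbW := hb' W le_rfl
  simp only [res_self] at haW hbW
  choose C hC using fun j => hbW.2 (φ.app W (res A W hW₁ (a j)))
  choose D hD using fun i => haW.2 (res A W (hWU i) (y' i))
  refine ⟨W, hWV, ⟨⟨⟨hxW', hx⟩, hx₁⟩, hx₂⟩,
    bijective_of_matrix φ ha' hb' (Matrix.of C) (Matrix.of D) ?_ (fun j => (hC j).symm)⟩
  ext i k
  have h1 : φ.app W (res A W (hWU i) (y' i)) = res B W hW₂ (b i) := by
    rw [app_res, hy', res_res]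
  rw [← hD, app_sum_smul] at h1
  simp only [← hC, Finset.smul_sum, smul_smul] at h1
  rw [Finset.sum_comm] at h1
  simp only [← Finset.sum_smul] at h1
  have h2 : (fun k => ∑ j, D i j * C j k) = fun k => if i = k then (1 : Γ(X, W)) else 0 := by
    apply hbW.1
    simp only [h1, ite_smul, one_smul, zero_smul, Finset.sum_ite_eq, Finset.mem_univ, if_true]
  rw [Matrix.mul_apply, Matrix.one_apply]
  exact congrFun h2 k

end LocalToGlobal

/-! ### Compatibilities of iterated pullbacks -/

section Coherence
variable {X Y Z T T' S : Scheme.{u}}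

theorem comp_app_apply {M N K : X.Modules} (φ : M ⟶ N) (ψ : N ⟶ K) {U : X.Opens} (x : Γ(M, U)) :
    (φ ≫ ψ).app U x = ψ.app U (φ.app U x) := rfl

/-- A morphism of modules on global sections. (Being a plain function, it is compared argument by
argument in definitional equality checks.) -/
def ap {M N : X.Modules} (φ : M ⟶ N) (x : Γ(M, (⊤ : X.Opens))) : Γ(N, (⊤ : X.Opens)) := φ.app ⊤ x

section
variable {M N K : X.Modules} (φ : M ⟶ N)

theorem ap_eq (x : Γ(M, (⊤ : X.Opens))) : ap φ x = φ.app ⊤ x := rfl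

theorem ap_comp (ψ : N ⟶ K) (x : Γ(M, (⊤ : X.Opens))) : ap (φ ≫ ψ) x = ap ψ (ap φ x) := rfl

theorem ap_id (x : Γ(M, (⊤ : X.Opens))) : ap (𝟙 M) x = x := rfl

theorem ap_zero_hom (x : Γ(M, (⊤ : X.Opens))) : ap (0 : M ⟶ N) x = 0 := rfl

theorem ap_add (x y : Γ(M, (⊤ : X.Opens))) : ap φ (x + y) = ap φ x + ap φ y := map_add _ _ _

theorem ap_smul (a : Γ(X, (⊤ : X.Opens))) (x : Γ(M, (⊤ : X.Opens))) : ap φ (a • x) = a • ap φ x :=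
  Scheme.Modules.Hom.app_smul _ _ _

theorem ap_sum_smul {ι : Type} [Fintype ι] (a : ι → Γ(X, (⊤ : X.Opens)))
    (x : ι → Γ(M, (⊤ : X.Opens))) : ap φ (∑ i, a i • x i) = ∑ i, a i • ap φ (x i) :=
  app_sum_smul φ a x

end

theorem iso_hom_inv_app {M N : X.Modules} (φ : M ≅ N) (U : X.Opens) (x : Γ(M, U)) :
    φ.inv.app U (φ.hom.app U x) = x := by
  rw [← comp_app_apply, Iso.hom_inv_id]
  rfl

theorem pullbackIso_inv_pullSec {h : T ⟶ Y} {t : Y ⟶ X} {f : T ⟶ X} (e : h ≫ t = f)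
    (M : X.Modules) {U : X.Opens} {V : Y.Opens}
    {V' : T.Opens} (hV : V ≤ t ⁻¹ᵁ U) (hV' : V' ≤ h ⁻¹ᵁ V) (hf : V' ≤ f ⁻¹ᵁ U) (m : Γ(M, U)) :
    (pullbackIso e M).inv.app V' (pullSec f M V' hf m) =
      pullSec h _ V' hV' (pullSec t M V hV m) := by
  rw [← pullbackIso_pullSec e M hV hV' hf, iso_hom_inv_app]

/-- Morphisms out of an iterated pullback are determined by their values on sections pulled back
twice. -/
theorem pullback_hom_ext₂ (h : T ⟶ Y) (t : Y ⟶ X) {M : X.Modules} {K : T.Modules}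
    {α β : (Scheme.Modules.pullback h).obj ((Scheme.Modules.pullback t).obj M) ⟶ K}
    (H : ∀ (U : X.Opens) (V : Y.Opens) (hV : V ≤ t ⁻¹ᵁ U) (V' : T.Opens) (hV' : V' ≤ h ⁻¹ᵁ V)
      (m : Γ(M, U)), α.app V' (pullSec h _ V' hV' (pullSec t M V hV m)) =
        β.app V' (pullSec h _ V' hV' (pullSec t M V hV m))) :
    α = β := by
  rw [← cancel_epi (pullbackIso (rfl : h ≫ t = h ≫ t) M).inv]
  refine pullback_hom_ext (h ≫ t) fun U V hV m => ?_
  rw [comp_app_apply, comp_app_apply,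
    pullbackIso_inv_pullSec (rfl : h ≫ t = h ≫ t) M (V := t ⁻¹ᵁ U) le_rfl hV hV m]
  exact H U _ _ _ _ m

theorem pullbackIso_naturality {h : T ⟶ Y} {t : Y ⟶ X} {f : T ⟶ X} (e : h ≫ t = f)
    {M N : X.Modules} (φ : M ⟶ N) :
    (pullbackIso e M).hom ≫ (Scheme.Modules.pullback f).map φ =
      (Scheme.Modules.pullback h).map ((Scheme.Modules.pullback t).map φ) ≫
        (pullbackIso e N).hom := by
  refine pullback_hom_ext₂ h t fun U V hV V' hV' m => ?_
  have hU : V' ≤ f ⁻¹ᵁ U := by rw [← e]; exact hV'.trans (h.preimage_mono hV)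
  rw [comp_app_apply, comp_app_apply, map_pullSec, map_pullSec, pullbackIso_pullSec e M _ _ hU,
    pullbackIso_pullSec e N _ _ hU, map_pullSec]

theorem pullback_hom_ext₃ (h : T ⟶ Y) (f : Y ⟶ X) (g : X ⟶ Z) {M : Z.Modules} {K : T.Modules}
    {α β : (Scheme.Modules.pullback h).obj ((Scheme.Modules.pullback f).obj
      ((Scheme.Modules.pullback g).obj M)) ⟶ K}
    (H : ∀ (U : Z.Opens) (V : X.Opens) (hV : V ≤ g ⁻¹ᵁ U) (V' : Y.Opens) (hV' : V' ≤ f ⁻¹ᵁ V)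
      (V'' : T.Opens) (hV'' : V'' ≤ h ⁻¹ᵁ V') (m : Γ(M, U)),
        α.app V'' (pullSec h _ V'' hV'' (pullSec f _ V' hV' (pullSec g M V hV m))) =
        β.app V'' (pullSec h _ V'' hV'' (pullSec f _ V' hV' (pullSec g M V hV m)))) :
    α = β := by
  rw [← cancel_epi ((Scheme.Modules.pullback h).map (pullbackIso (rfl : f ≫ g = f ≫ g) M).inv)]
  refine pullback_hom_ext₂ h (f ≫ g) fun U V hV V' hV' m => ?_
  rw [comp_app_apply, comp_app_apply, map_pullSec,
    pullbackIso_inv_pullSec (rfl : f ≫ g = f ≫ g) M (V := g ⁻¹ᵁ U) le_rfl hV hV m]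
  exact H U _ _ _ _ _ _ m

/-- Both ways of identifying `h^* f^* g^* M` with a single pullback agree. -/
theorem pullbackIso_assoc {h : T ⟶ Y} {f : Y ⟶ X} {g : X ⟶ Z} {hf : T ⟶ X} {fg : Y ⟶ Z}
    {hfg : T ⟶ Z} (e₁ : h ≫ f = hf) (e₂ : f ≫ g = fg) (e₃ : hf ≫ g = hfg) (e₄ : h ≫ fg = hfg)
    (M : Z.Modules) :
    (pullbackIso e₁ _).hom ≫ (pullbackIso e₃ M).hom =
      (Scheme.Modules.pullback h).map (pullbackIso e₂ M).hom ≫ (pullbackIso e₄ M).hom := by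
  refine pullback_hom_ext₃ h f g fun U V hV V' hV' V'' hV'' m => ?_
  have h1 : V' ≤ fg ⁻¹ᵁ U := by rw [← e₂]; exact hV'.trans (f.preimage_mono hV)
  have h2 : V'' ≤ hf ⁻¹ᵁ V := by rw [← e₁]; exact hV''.trans (h.preimage_mono hV')
  have h3 : V'' ≤ hfg ⁻¹ᵁ U := by rw [← e₃]; exact h2.trans (hf.preimage_mono hV)
  rw [comp_app_apply, comp_app_apply, map_pullSec, pullbackIso_pullSec e₁ _ hV' hV'' h2,
    pullbackIso_pullSec e₂ M hV hV' h1, pullbackIso_pullSec e₃ M hV h2 h3,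
    pullbackIso_pullSec e₄ M h1 hV'' h3]

end Coherence

/-! ### Adapted frames -/

section AdaptedFrames
variable {X Y T T' S Fl : Scheme.{u}}

theorem IsFrame.map_iso_of_eq {ι : Type} [Fintype ι] {M N : X.Modules} (φ : M ⟶ N) [IsIso φ]
    {U : X.Opens} {e : ι → Γ(M, U)} (he : IsFrame M e) {e' : ι → Γ(N, U)}
    (h : ∀ i, e' i = φ.app U (e i)) : IsFrame N e' := by
  rw [funext h]
  exact he.map_iso φ

/-- The sections `∑ i, H i j • e_i` for an invertible matrix `H` form a frame if the `e_i` do. -/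
theorem IsFrame.matrix {n : ℕ} {M : X.Modules} {U : X.Opens} {e : Fin n → Γ(M, U)}
    (he : IsFrame M e) (H H' : Matrix (Fin n) (Fin n) Γ(X, U)) (h : H * H' = 1)
    {e' : Fin n → Γ(M, U)} (he' : ∀ j, e' j = ∑ i, H i j • e i) : IsFrame M e' := by
  rw [funext he']
  have h' : H' * H = 1 := mul_eq_one_comm.1 h
  intro V hV
  let G : Matrix (Fin n) (Fin n) Γ(X, V) := H.map (resFun V hV)
  let G' : Matrix (Fin n) (Fin n) Γ(X, V) := H'.map (resFun V hV)
  have hG : G * G' = 1 := by rw [← Matrix.map_mul, h, Matrix.map_one _ (map_zero _) (map_one _)]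
  have hG' : G' * G = 1 := by rw [← Matrix.map_mul, h', Matrix.map_one _ (map_zero _) (map_one _)]
  have e1 : (fun a : Fin n → Γ(X, V) => ∑ j, a j • TautSection.res M V hV (∑ i, H i j • e i)) =
      (fun a => ∑ i, a i • TautSection.res M V hV (e i)) ∘ (fun a => G.mulVec a) := by
    funext a
    simp only [Function.comp_apply, map_sum, res_smul, Matrix.mulVec, dotProduct, G,
      Matrix.map_apply, Finset.smul_sum, Finset.sum_smul, smul_smul]
    rw [Finset.sum_comm]
    simp only [mul_comm]
  rw [e1]
  refine (he V hV).comp (Function.bijective_iff_has_inverse.2 ⟨fun v => G'.mulVec v, ?_, ?_⟩)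
  · intro v; simp [Matrix.mulVec_mulVec, hG']
  · intro v; simp [Matrix.mulVec_mulVec, hG]

variable {V : S.Modules} {D : ℕ} {F : Fl ⟶ S}
  (𝒱 : CompleteFlag ((Scheme.Modules.pullback F).obj V) D)

/-- The map `f^* 𝒱_k ⟶ t^* V` for `f ≫ F = t`. -/
def flagIncl (f : T ⟶ Fl) {t : T ⟶ S} (e : f ≫ F = t) (k : Fin (D + 1)) :
    (Scheme.Modules.pullback f).obj (𝒱.sub k : Fl.Modules) ⟶ (Scheme.Modules.pullback t).obj V :=
  (Scheme.Modules.pullback f).map (𝒱.sub k).arrow ≫ (pullbackIso e V).hom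

/-- The pullback of `𝒱_k` along `f : T ⟶ Fl` is the span of the first `k` members of `b`. -/
def AdaptedAt (f : T ⟶ Fl) {t : T ⟶ S} (e : f ≫ F = t)
    (b : Fin D → Γ((Scheme.Modules.pullback t).obj V, (⊤ : T.Opens))) (k : Fin (D + 1)) : Prop :=
  ∃ w : Fin k → Γ((Scheme.Modules.pullback f).obj (𝒱.sub k : Fl.Modules), (⊤ : T.Opens)),
    IsFrame _ w ∧ ∀ j, ap (flagIncl 𝒱 f e k) (w j) = b (Fin.castLE (Nat.lt_succ_iff.1 k.2) j)

/-- The frame `b` of `t^* V` is adapted to `f : T ⟶ Fl`: the pullback of `𝒱_k` along `f` is the span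
of the first `k` members of `b`, for all `k`. -/
structure Adapted (f : T ⟶ Fl) {t : T ⟶ S} (e : f ≫ F = t)
    (b : Fin D → Γ((Scheme.Modules.pullback t).obj V, (⊤ : T.Opens))) : Prop where
  isFrame : IsFrame _ b
  at' : ∀ k, AdaptedAt 𝒱 f e b k

variable {𝒱}

theorem AdaptedAt.intro {f : T ⟶ Fl} {t : T ⟶ S} {e : f ≫ F = t}
    {b : Fin D → Γ((Scheme.Modules.pullback t).obj V, (⊤ : T.Opens))} {k : Fin (D + 1)}
    {w : Fin k → Γ((Scheme.Modules.pullback f).obj (𝒱.sub k : Fl.Modules), (⊤ : T.Opens))}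
    (hw : IsFrame _ w) (hwb : ∀ j, ap (flagIncl 𝒱 f e k) (w j) =
      b (Fin.castLE (Nat.lt_succ_iff.1 k.2) j)) : AdaptedAt 𝒱 f e b k := ⟨w, hw, hwb⟩

theorem Adapted.exists_frame {f : T ⟶ Fl} {t : T ⟶ S} {e : f ≫ F = t}
    {b : Fin D → Γ((Scheme.Modules.pullback t).obj V, (⊤ : T.Opens))} (h : Adapted 𝒱 f e b)
    (k : Fin (D + 1)) : ∃ w : Fin k → Γ((Scheme.Modules.pullback f).obj
      (𝒱.sub k : Fl.Modules), (⊤ : T.Opens)), IsFrame _ w ∧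
        ∀ j, ap (flagIncl 𝒱 f e k) (w j) = b (Fin.castLE (Nat.lt_succ_iff.1 k.2) j) :=
  h.at' k

theorem Adapted.injective {f : T ⟶ Fl} {t : T ⟶ S} {e : f ≫ F = t}
    {b : Fin D → Γ((Scheme.Modules.pullback t).obj V, (⊤ : T.Opens))} (h : Adapted 𝒱 f e b)
    (k : Fin (D + 1)) (U : T.Opens) : Function.Injective ((flagIncl 𝒱 f e k).app U) := by
  obtain ⟨w, hw, hwb⟩ := h.exists_frame k
  exact h.isFrame.injective_of_castLE _ hw _ (fun j => (ap_eq _ _).symm.trans (hwb j)) le_top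

/-- The pulled back flag is the one spanned by an adapted frame. -/
theorem Adapted.pullbackSub_eq {f : T ⟶ Fl} {t : T ⟶ S} {e : f ≫ F = t}
    {b : Fin D → Γ((Scheme.Modules.pullback t).obj V, (⊤ : T.Opens))} (h : Adapted 𝒱 f e b)
    (k : Fin (D + 1)) : pullbackSub e (𝒱.sub k) = (flagOfFrame h.isFrame).sub k := by
  have hk := Nat.lt_succ_iff.1 k.2
  obtain ⟨w, hw, hwb⟩ := h.exists_frame k
  have : Mono (flagIncl 𝒱 f e k) := mono_of_injective _ (h.injective k)
  have := mono_flagMap h.isFrame k hk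
  change imageSubobject (flagIncl 𝒱 f e k) = Subobject.mk (flagMap b k hk)
  rw [imageSubobject_mono]
  have hi : IsIso (frameHom _ w) := isIso_frameHom hw
  refine Subobject.mk_eq_mk_of_comm _ _ (asIso (frameHom _ w)).symm ?_
  rw [Iso.symm_hom, Iso.inv_comp_eq]
  refine freeModule_hom_ext fun j => ?_
  rw [asIso_hom, comp_app_apply, frameHom_freeSec, flagMap, frameHom_freeSec, ← hwb, ap_eq]

theorem CompleteFlag.hasLocalFrames_sub (𝒱 : CompleteFlag ((Scheme.Modules.pullback F).obj V) D)
    (k : Fin (D + 1)) : HasLocalFrames (𝒱.sub k : Fl.Modules) k :=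
  fun x => (𝒱.rank_sub k).exists_frame x

/-- Conversely, a frame spanning the pulled back flag is adapted: `f^* 𝒱_k` maps onto the span of
the first `k` members, a bundle of the same rank, hence isomorphically. -/
theorem adapted_of_pullbackSub_eq {f : T ⟶ Fl} {t : T ⟶ S} (e : f ≫ F = t)
    {b : Fin D → Γ((Scheme.Modules.pullback t).obj V, (⊤ : T.Opens))} (hb : IsFrame _ b)
    (h : ∀ k, pullbackSub e (𝒱.sub k) = (flagOfFrame hb).sub k) : Adapted 𝒱 f e b := by
  refine .mk hb fun k => ?_
  have hk := Nat.lt_succ_iff.1 k.2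
  have := mono_flagMap hb k hk
  have h' : imageSubobject (flagIncl 𝒱 f e k) = Subobject.mk (flagMap b k hk) := h k
  let φ := factorThruImageSubobject (flagIncl 𝒱 f e k) ≫ (Subobject.isoOfEq _ _ h').hom
  have hφ : φ ≫ (Subobject.mk (flagMap b k hk)).arrow = flagIncl 𝒱 f e k := by simp [φ]
  have : Epi φ := epi_comp _ _
  have hw := isFrame_flagSec hb k hk
  have : IsIso φ := isIso_of_epi_of_rank φ ((𝒱.hasLocalFrames_sub k).pullback f)
    fun x => ⟨⊤, trivial, _, hw⟩
  obtain ⟨w', hw'⟩ : ∃ w' : Fin k → Γ((Scheme.Modules.pullback f).obj (𝒱.sub k : Fl.Modules),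
    (⊤ : T.Opens)), ∀ j, w' j = ap (inv φ) (flagSec hb k hk j) := ⟨_, fun _ => rfl⟩
  refine .intro (hw.map_iso_of_eq (inv φ) hw') fun j => ?_
  rw [hw', ← ap_comp, ← hφ, IsIso.inv_hom_id_assoc, ap_eq, arrow_flagSec]

theorem pullbackIso_comp_flagIncl (f : T ⟶ Fl) {t : T ⟶ S} (e : f ≫ F = t) (h : T' ⟶ T)
    {f' : T' ⟶ Fl} (hf : h ≫ f = f') {t' : T' ⟶ S} (ht : h ≫ t = t') (e' : f' ≫ F = t')
    (k : Fin (D + 1)) : (pullbackIso hf _).hom ≫ flagIncl 𝒱 f' e' k =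
      (Scheme.Modules.pullback h).map (flagIncl 𝒱 f e k) ≫ (pullbackIso ht V).hom := by
  rw [flagIncl, flagIncl, Functor.map_comp, Category.assoc, ← pullbackIso_assoc hf e e' ht,
    ← Category.assoc, ← Category.assoc, pullbackIso_naturality]

theorem ap_map_pullSec (f : T ⟶ X) {M N : X.Modules} (φ : M ⟶ N) (m : Γ(M, (⊤ : X.Opens))) :
    ap ((Scheme.Modules.pullback f).map φ) (pullSec f M ⊤ (le_preimage_top f ⊤) m) =
      pullSec f N ⊤ (le_preimage_top f ⊤) (ap φ m) :=
  map_pullSec f φ ⊤ _ m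

/-- Global functions pulled back along `h`. -/
abbrev pullTop (h : T' ⟶ T) : Γ(T, (⊤ : T.Opens)) →+* Γ(T', (⊤ : T'.Opens)) :=
  pullFun h ⊤ (le_preimage_top h ⊤)

/-- Global sections of `t^* V` pulled back along `h : T' ⟶ T`, as sections of `t'^* V` for
`t' = t ∘ h`. -/
def pullAmb (h : T' ⟶ T) {t : T ⟶ X} {t' : T' ⟶ X} (ht : h ≫ t = t') (V : X.Modules)
    (x : Γ((Scheme.Modules.pullback t).obj V, (⊤ : T.Opens))) :
    Γ((Scheme.Modules.pullback t').obj V, (⊤ : T'.Opens)) :=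
  ap (pullbackIso ht V).hom (pullSec h _ ⊤ (le_preimage_top h ⊤) x)

section
variable (h : T' ⟶ T) {t : T ⟶ X} {t' : T' ⟶ X} (ht : h ≫ t = t') (V : X.Modules)

theorem pullAmb_eq (x : Γ((Scheme.Modules.pullback t).obj V, (⊤ : T.Opens))) : pullAmb h ht V x =
    ap (pullbackIso ht V).hom (pullSec h _ ⊤ (le_preimage_top h ⊤) x) := rfl

theorem pullAmb_add (x y : Γ((Scheme.Modules.pullback t).obj V, (⊤ : T.Opens))) :
    pullAmb h ht V (x + y) = pullAmb h ht V x + pullAmb h ht V y := by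
  rw [pullAmb_eq, map_add, ap_add, pullAmb_eq, pullAmb_eq]

theorem pullAmb_smul (a : Γ(T, (⊤ : T.Opens)))
    (x : Γ((Scheme.Modules.pullback t).obj V, (⊤ : T.Opens))) :
    pullAmb h ht V (a • x) = pullTop h a • pullAmb h ht V x := by
  rw [pullAmb_eq, pullSec_smul, ap_smul, pullAmb_eq]

theorem pullAmb_sum_smul {ι : Type} [Fintype ι] (a : ι → Γ(T, (⊤ : T.Opens)))
    (x : ι → Γ((Scheme.Modules.pullback t).obj V, (⊤ : T.Opens))) :
    pullAmb h ht V (∑ i, a i • x i) = ∑ i, pullTop h (a i) • pullAmb h ht V (x i) := by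
  rw [pullAmb_eq, pullSec_sum_smul, ap_sum_smul]
  simp only [pullAmb_eq]

end

theorem IsFrame.map_pullSec_top (h : T' ⟶ T) {M : T.Modules} {N : T'.Modules}
    (φ : (Scheme.Modules.pullback h).obj M ⟶ N) [IsIso φ] {n : ℕ}
    {b : Fin n → Γ(M, (⊤ : T.Opens))} (hb : IsFrame _ b) {b' : Fin n → Γ(N, (⊤ : T'.Opens))}
    (hb' : ∀ j, b' j = ap φ (TautSection.pullSec h _ ⊤ (le_preimage_top h ⊤) (b j))) :
    IsFrame N b' := by
  rw [funext hb']
  exact (hb.pullSec_top h).map_iso φ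

theorem IsFrame.pullAmb (h : T' ⟶ T) {t : T ⟶ S} {t' : T' ⟶ S} (ht : h ≫ t = t')
    {V : S.Modules} {n : ℕ} {b : Fin n → Γ((Scheme.Modules.pullback t).obj V, (⊤ : T.Opens))}
    (hb : IsFrame _ b) {b' : Fin n → Γ((Scheme.Modules.pullback t').obj V, (⊤ : T'.Opens))}
    (hb' : ∀ j, b' j = TautSection.pullAmb h ht V (b j)) : IsFrame _ b' :=
  hb.map_pullSec_top h (pullbackIso ht V).hom fun j => by
    rw [hb', pullAmb_eq]

theorem flagIncl_pullAmb (f : T ⟶ Fl) {t : T ⟶ S} (e : f ≫ F = t) (h : T' ⟶ T) {f' : T' ⟶ Fl}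
    (hf : h ≫ f = f') {t' : T' ⟶ S} (ht : h ≫ t = t') (e' : f' ≫ F = t') (k : Fin (D + 1))
    (w : Γ((Scheme.Modules.pullback f).obj (𝒱.sub k : Fl.Modules), (⊤ : T.Opens))) :
    ap (flagIncl 𝒱 f' e' k) (pullAmb h hf _ w) =
      pullAmb h ht V (ap (flagIncl 𝒱 f e k) w) := by
  rw [pullAmb_eq, pullAmb_eq, ← ap_comp, pullbackIso_comp_flagIncl f e h hf ht e', ap_comp,
    ap_map_pullSec]

theorem Adapted.pullback {f : T ⟶ Fl} {t : T ⟶ S} {e : f ≫ F = t}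
    {b : Fin D → Γ((Scheme.Modules.pullback t).obj V, (⊤ : T.Opens))} (hb : Adapted 𝒱 f e b)
    (h : T' ⟶ T) {f' : T' ⟶ Fl} (hf : h ≫ f = f') {t' : T' ⟶ S} (ht : h ≫ t = t')
    (e' : f' ≫ F = t') {b' : Fin D → Γ((Scheme.Modules.pullback t').obj V, (⊤ : T'.Opens))}
    (hb' : ∀ j, b' j = pullAmb h ht V (b j)) : Adapted 𝒱 f' e' b' := by
  refine .mk (hb.isFrame.pullAmb h ht hb') fun k => ?_
  obtain ⟨w, hw, hwb⟩ := hb.exists_frame k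
  obtain ⟨w', hw'⟩ : ∃ w' : Fin k → Γ((Scheme.Modules.pullback f').obj (𝒱.sub k : Fl.Modules),
    (⊤ : T'.Opens)), ∀ j, w' j = pullAmb h hf _ (w j) := ⟨_, fun _ => rfl⟩
  refine .intro (hw.pullAmb h hf hw') fun j => ?_
  rw [hw', flagIncl_pullAmb f e h hf ht e', hwb, hb']

theorem app_castLE_of_triangular {M N : T.Modules} (φ : M ⟶ N) {k : ℕ} (hk : k ≤ D)
    (H : Matrix (Fin D) (Fin D) Γ(T, (⊤ : T.Opens))) (hu : ∀ i j, j < i → H i j = 0)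
    {w w' : Fin k → Γ(M, (⊤ : T.Opens))} {b b' : Fin D → Γ(N, (⊤ : T.Opens))}
    (hwb : ∀ j, ap φ (w j) = b (Fin.castLE hk j))
    (hw' : ∀ j, w' j = ∑ i, H.submatrix (Fin.castLE hk) (Fin.castLE hk) i j • w i)
    (hb' : ∀ j, b' j = ∑ i, H i j • b i) (j : Fin k) :
    ap φ (w' j) = b' (Fin.castLE hk j) := by
  rw [hw', ap_sum_smul, hb', sum_castLE hk _ fun l hl => by
    rw [hu l _ (Fin.lt_def.2 (lt_of_lt_of_le j.2 hl)), zero_smul]]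
  exact Finset.sum_congr rfl fun i _ => by rw [hwb, Matrix.submatrix_apply]

/-- A frame which differs from an adapted one by an upper triangular matrix is adapted. -/
theorem Adapted.change {f : T ⟶ Fl} {t : T ⟶ S} {e : f ≫ F = t}
    {b : Fin D → Γ((Scheme.Modules.pullback t).obj V, (⊤ : T.Opens))} (hb : Adapted 𝒱 f e b)
    (H H' : Matrix (Fin D) (Fin D) Γ(T, (⊤ : T.Opens))) (h : H * H' = 1)
    (hu : ∀ i j, j < i → H i j = 0) (hu' : ∀ i j, j < i → H' i j = 0)
    {b' : Fin D → Γ((Scheme.Modules.pullback t).obj V, (⊤ : T.Opens))}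
    (hb' : ∀ j, b' j = ∑ i, H i j • b i) : Adapted 𝒱 f e b' := by
  refine .mk (hb.isFrame.matrix H H' h hb') fun k => ?_
  have hk := Nat.lt_succ_iff.1 k.2
  obtain ⟨w, hw, hwb⟩ := hb.exists_frame k
  have hc : (H.submatrix (Fin.castLE hk) (Fin.castLE hk)) *
      (H'.submatrix (Fin.castLE hk) (Fin.castLE hk)) = 1 := by
    ext i j
    have := congrFun (congrFun h (Fin.castLE hk i)) (Fin.castLE hk j)
    rw [Matrix.mul_apply, sum_castLE hk _ fun l hl => by
      rw [hu' l _ (Fin.lt_def.2 (lt_of_lt_of_le j.2 hl)), mul_zero]] at this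
    rw [Matrix.mul_apply]
    simp only [Matrix.submatrix_apply]
    rw [this, Matrix.one_apply, Matrix.one_apply]
    simp
  obtain ⟨w', hw'⟩ : ∃ w' : Fin k → Γ((Scheme.Modules.pullback f).obj (𝒱.sub k : Fl.Modules),
    (⊤ : T.Opens)), ∀ j, w' j = ∑ i, H.submatrix (Fin.castLE hk) (Fin.castLE hk) i j • w i :=
    ⟨_, fun _ => rfl⟩
  exact .intro (hw.matrix _ _ hc hw') (app_castLE_of_triangular _ hk H hu hwb hw' hb')

/-- A point of the flag scheme is determined by an adapted frame. -/
theorem Adapted.unique (hF : IsFlagScheme V D F 𝒱) {f f' : T ⟶ Fl} {t : T ⟶ S} {e : f ≫ F = t}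
    {e' : f' ≫ F = t} {b : Fin D → Γ((Scheme.Modules.pullback t).obj V, (⊤ : T.Opens))}
    (hb : Adapted 𝒱 f e b) (hb' : Adapted 𝒱 f' e' b) : f = f' :=
  (hF.existsUnique t (flagOfFrame hb.isFrame)).unique ⟨e, hb.pullbackSub_eq⟩ ⟨e', hb'.pullbackSub_eq⟩

/-- Every frame is adapted to a point of the flag scheme. -/
theorem exists_adapted (hF : IsFlagScheme V D F 𝒱) {t : T ⟶ S}
    {b : Fin D → Γ((Scheme.Modules.pullback t).obj V, (⊤ : T.Opens))} (hb : IsFrame _ b) :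
    ∃ (f : T ⟶ Fl) (e : f ≫ F = t), Adapted 𝒱 f e b := by
  obtain ⟨f, ⟨e, h⟩, -⟩ := hF.existsUnique t (flagOfFrame hb)
  exact ⟨f, e, adapted_of_pullbackSub_eq e hb h⟩

end AdaptedFrames

/-! ### Graded pieces in an adapted frame -/

section GradedPiece
variable {X Y T T' S Fl : Scheme.{u}}

/-- Pullback is right exact: it commutes with cokernels. -/
theorem comp_pullback_cokernel_π {X T : Scheme.{u}} (f : T ⟶ X) {Z E : X.Modules} (i : Z ⟶ E) :
    ∃ φ : cokernel ((Scheme.Modules.pullback f).map i) ≅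
      (Scheme.Modules.pullback f).obj (cokernel i),
      cokernel.π _ ≫ φ.hom = (Scheme.Modules.pullback f).map (cokernel.π i) := by
  have : (Scheme.Modules.pullback f).PreservesZeroMorphisms :=
    Functor.preservesZeroMorphisms_of_isLeftAdjoint _
  refine ⟨(PreservesCokernel.iso (Scheme.Modules.pullback f) i).symm, ?_⟩
  rw [Iso.symm_hom, Iso.comp_inv_eq]
  exact (PreservesCokernel.π_iso_hom _ _).symm

theorem IsFrame.reindex {ι κ : Type} [Fintype ι] [Fintype κ] {M : X.Modules} {U : X.Opens}
    {e : ι → Γ(M, U)} (he : IsFrame M e) (σ : κ ≃ ι) : IsFrame M (fun i => e (σ i)) := by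
  intro V hV
  have := (he V hV).comp (σ.arrowCongr (Equiv.refl Γ(X, V))).bijective
  convert this using 2 with a
  simp only [Function.comp_apply, Equiv.arrowCongr_apply, Equiv.coe_refl, id]
  exact Fintype.sum_equiv σ _ _ (by simp)

theorem injective_ap {M N : X.Modules} (φ : M ⟶ N)
    (h : Function.Injective (φ.app (⊤ : X.Opens))) : Function.Injective (ap φ) := h

theorem IsFrame.cokernel_of_frame {D k : ℕ} {Z E : X.Modules} {z : Fin k → Γ(Z, (⊤ : X.Opens))}
    (hz : IsFrame Z z) {e : Fin D → Γ(E, (⊤ : X.Opens))} (he : IsFrame E e) (hk : k ≤ D)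
    (i : Z ⟶ E) (h : ∀ j, ap i (z j) = e (Fin.castLE hk j)) :
    IsFrame (Limits.cokernel i) (fun j : Fin (D - k) =>
      ap (Limits.cokernel.π i) (e ⟨k + j, by omega⟩)) :=
  he.cokernel k hk i fun g => (comp_eq_zero_iff hz _ g).trans
    (forall_congr' fun j => by rw [← h, ap_eq])

/-- If `i : Z ⟶ E` is given in frames by the inclusion of the first `n` among `n + 1` members, then
the image of the last member is a frame of the pullback of the cokernel. -/
theorem isFrame_pullback_cokernel (f : T ⟶ X) {Z E : X.Modules} (i : Z ⟶ E) {n : ℕ}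
    {z : Fin n → Γ((Scheme.Modules.pullback f).obj Z, (⊤ : T.Opens))} (hz : IsFrame _ z)
    {w : Fin (n + 1) → Γ((Scheme.Modules.pullback f).obj E, (⊤ : T.Opens))} (hw : IsFrame _ w)
    (h : ∀ j, ap ((Scheme.Modules.pullback f).map i) (z j) = w j.castSucc)
    {l : Fin 1 → Γ((Scheme.Modules.pullback f).obj (cokernel i), (⊤ : T.Opens))}
    (hl : l 0 = ap ((Scheme.Modules.pullback f).map (cokernel.π i)) (w (Fin.last n))) :
    IsFrame _ l := by
  obtain ⟨φ, hφ⟩ := comp_pullback_cokernel_π f i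
  have key := hz.cokernel_of_frame hw (Nat.le_succ n) ((Scheme.Modules.pullback f).map i) h
  refine (key.reindex (finCongr (by omega : 1 = n + 1 - n))).map_iso_of_eq φ.hom fun j => ?_
  have hj : (⟨n + (finCongr (by omega : 1 = n + 1 - n) j), by omega⟩ : Fin (n + 1)) =
    Fin.last n := Fin.ext (by simp)
  rw [Subsingleton.elim j 0, hl, ← hφ, ap_comp, ← ap_eq, ← hj, Subsingleton.elim j 0]

theorem toGr_comp_eq_zero {E : X.Modules} {D : ℕ} (Z : CompleteFlag E D) (k : Fin D) :
    Z.incl k ≫ Z.toGr k = 0 := cokernel.condition _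

variable {V : S.Modules} {D : ℕ} {F : Fl ⟶ S}
  {𝒱 : CompleteFlag ((Scheme.Modules.pullback F).obj V) D}

theorem map_incl_flagIncl (f : T ⟶ Fl) {t : T ⟶ S} (e : f ≫ F = t) (k : Fin D) :
    (Scheme.Modules.pullback f).map (𝒱.incl k) ≫ flagIncl 𝒱 f e k.succ =
      flagIncl 𝒱 f e k.castSucc := by
  rw [flagIncl, flagIncl, ← Category.assoc, ← Functor.map_comp, CompleteFlag.incl,
    Subobject.ofLE_arrow]

/-- The pullback of `𝒱_{k+1} ⟶ 𝒱_{k+1} / 𝒱_k` along `f`. -/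
def pullGr (𝒱 : CompleteFlag ((Scheme.Modules.pullback F).obj V) D) (f : T ⟶ Fl) (k : Fin D) :
    (Scheme.Modules.pullback f).obj (𝒱.sub k.succ : Fl.Modules) ⟶
      (Scheme.Modules.pullback f).obj (𝒱.gr k) :=
  (Scheme.Modules.pullback f).map (𝒱.toGr k)

theorem Adapted.ap_injective {f : T ⟶ Fl} {t : T ⟶ S} {e : f ≫ F = t}
    {b : Fin D → Γ((Scheme.Modules.pullback t).obj V, (⊤ : T.Opens))} (h : Adapted 𝒱 f e b)
    (k : Fin (D + 1)) : Function.Injective (ap (flagIncl 𝒱 f e k)) :=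
  injective_ap _ (h.injective k ⊤)

/-- In an adapted frame, `𝒱_{k+1}` is spanned by the first `k + 1` members, `𝒱_{k+1} / 𝒱_k` by the
image of the last of these, and the other ones map to `0` in it. -/
theorem Adapted.exists_frame_gr {f : T ⟶ Fl} {t : T ⟶ S} {e : f ≫ F = t}
    {b : Fin D → Γ((Scheme.Modules.pullback t).obj V, (⊤ : T.Opens))} (h : Adapted 𝒱 f e b)
    (k : Fin D) : ∃ w : Fin (k + 1) → Γ((Scheme.Modules.pullback f).obj
      (𝒱.sub k.succ : Fl.Modules), (⊤ : T.Opens)), IsFrame _ w ∧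
      ap (flagIncl 𝒱 f e k.succ) (w (Fin.last k)) = b k ∧
      (∀ j : Fin k, ap (flagIncl 𝒱 f e k.succ) (w j.castSucc) = b (Fin.castLE k.2.le j)) ∧
      (∀ l : Fin 1 → Γ((Scheme.Modules.pullback f).obj (𝒱.gr k), (⊤ : T.Opens)),
        l 0 = ap (pullGr 𝒱 f k) (w (Fin.last k)) → IsFrame _ l) ∧
      ∀ j : Fin k, ap (pullGr 𝒱 f k) (w j.castSucc) = 0 := by
  obtain ⟨w, hw, hwb⟩ := h.exists_frame k.succ
  obtain ⟨z, hz, hzb⟩ := h.exists_frame k.castSucc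
  have hzw : ∀ j : Fin k, ap ((Scheme.Modules.pullback f).map (𝒱.incl k)) (z j) =
      w (Fin.castSucc (n := k) j) := by
    intro j
    apply h.ap_injective k.succ
    rw [← ap_comp, map_incl_flagIncl, hwb]
    exact hzb j
  refine ⟨w, hw, hwb _, fun j => hwb _, fun l hl => isFrame_pullback_cokernel f (𝒱.incl k) hz hw hzw hl, fun j => ?_⟩
  rw [← hzw, ← ap_comp, pullGr, ← Functor.map_comp, toGr_comp_eq_zero]
  have : (Scheme.Modules.pullback f).PreservesZeroMorphisms :=
    Functor.preservesZeroMorphisms_of_isLeftAdjoint _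
  rw [Functor.map_zero, ap_zero_hom]

end GradedPiece

/-! ### Points of the fibered power -/

section FiberPowerPoints
variable {X Y T T' : Scheme.{u}} {E L : X.Modules} {q : E ⟶ L} {t : Y ⟶ X}
  {σ : (Scheme.Modules.pullback t).obj L ⟶ (Scheme.Modules.pullback t).obj E} {m : ℕ}

theorem pullbackHom_comp {h : T ⟶ Y} {f : T ⟶ X} (e : h ≫ t = f)
    (hσ : σ ≫ (Scheme.Modules.pullback t).map q = 𝟙 _) :
    pullbackHom e σ ≫ (Scheme.Modules.pullback f).map q = 𝟙 _ := by
  rw [pullbackHom, Category.assoc, Category.assoc, pullbackIso_naturality, ← Category.assoc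
    ((Scheme.Modules.pullback h).map σ), ← Functor.map_comp, hσ, CategoryTheory.Functor.map_id, Category.id_comp,
    Iso.inv_hom_id]

theorem pullbackIso_comp_pullbackHom {g : T ⟶ Y} {f : T ⟶ X} (e₂ : g ≫ t = f) (h : T' ⟶ T)
    {g' : T' ⟶ Y} {f' : T' ⟶ X} (e₁ : h ≫ g = g') (e₃ : g' ≫ t = f') (e₄ : h ≫ f = f') :
    (pullbackIso e₄ L).hom ≫ pullbackHom e₃ σ =
      (Scheme.Modules.pullback h).map (pullbackHom e₂ σ) ≫ (pullbackIso e₄ E).hom := by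
  rw [← cancel_epi ((Scheme.Modules.pullback h).map (pullbackIso e₂ L).hom), ← Category.assoc,
    ← pullbackIso_assoc e₁ e₂ e₃ e₄, pullbackHom, pullbackHom, Category.assoc,
    Iso.hom_inv_id_assoc, ← Category.assoc, pullbackIso_naturality, Category.assoc,
    pullbackIso_assoc e₁ e₂ e₃ e₄, ← Category.assoc, ← Category.assoc, ← Functor.map_comp,
    ← Functor.map_comp, Iso.hom_inv_id_assoc]

theorem pullbackHom_pullAmb {g : T ⟶ Y} {f : T ⟶ X} (e₂ : g ≫ t = f) (h : T' ⟶ T)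
    {g' : T' ⟶ Y} {f' : T' ⟶ X} (e₁ : h ≫ g = g') (e₃ : g' ≫ t = f') (e₄ : h ≫ f = f')
    (y : Γ((Scheme.Modules.pullback f).obj L, (⊤ : T.Opens))) :
    ap (pullbackHom e₃ σ) (pullAmb h e₄ L y) = pullAmb h e₄ E (ap (pullbackHom e₂ σ) y) := by
  rw [pullAmb_eq, pullAmb_eq, ← ap_comp, pullbackIso_comp_pullbackHom e₂ h e₁ e₃ e₄, ap_comp,
    ap_map_pullSec]

theorem comp_fiberPowerProj_comp {x : T ⟶ fiberPower t m} {f : T ⟶ X}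
    (ex : x ≫ fiberPowerBase t m = f) (i : Fin m) : (x ≫ fiberPowerProj t m i) ≫ t = f := by
  rw [Category.assoc, fiberPowerProj_comp, ex]

variable (σ) in
/-- The `i`-th of the sections of `f^* E ⟶ f^* L` corresponding to a point `x` of the fibered power
over `f`. -/
def pointSec (x : T ⟶ fiberPower t m) {f : T ⟶ X} (ex : x ≫ fiberPowerBase t m = f) (i : Fin m) :
    (Scheme.Modules.pullback f).obj L ⟶ (Scheme.Modules.pullback f).obj E :=
  pullbackHom (comp_fiberPowerProj_comp ex i) σ

/-- The universal property of the fibered power: any `m` sections over `f` come from a point of it.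
-/
theorem exists_point (hσ : IsSplittingScheme q t σ) (f : T ⟶ X)
    (s : Fin m → ((Scheme.Modules.pullback f).obj L ⟶ (Scheme.Modules.pullback f).obj E))
    (hs : ∀ i, s i ≫ (Scheme.Modules.pullback f).map q = 𝟙 _) :
    ∃ (x : T ⟶ fiberPower t m) (ex : x ≫ fiberPowerBase t m = f), ∀ i, pointSec σ x ex i = s i := by
  choose h he _ using fun i => hσ.existsUnique f (s i) (hs i)
  choose e hh using he
  let x : T ⟶ fiberPower t m := WidePullback.lift f h e
  have hx (i : Fin m) : x ≫ fiberPowerProj t m i = h i := WidePullback.lift_π _ _ _ _ _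
  refine ⟨x, WidePullback.lift_base _ _ _ _, fun i => ?_⟩
  rw [← hh i]
  simp only [pointSec, hx]

theorem point_ext (hσ : IsSplittingScheme q t σ) {f : T ⟶ X} {x x' : T ⟶ fiberPower t m}
    (ex : x ≫ fiberPowerBase t m = f) (ex' : x' ≫ fiberPowerBase t m = f)
    (h : ∀ i, pointSec σ x ex i = pointSec σ x' ex' i) : x = x' := by
  refine WidePullback.hom_ext _ _ _ (fun i => ?_) (ex.trans ex'.symm)
  exact (hσ.existsUnique f (pointSec σ x ex i) (pullbackHom_comp _ hσ.section_comp)).unique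
    ⟨_, rfl⟩ ⟨_, (h i).symm⟩

theorem pointSec_pullAmb {x : T ⟶ fiberPower t m} {f : T ⟶ X} (ex : x ≫ fiberPowerBase t m = f)
    (h : T' ⟶ T) {x' : T' ⟶ fiberPower t m} {f' : T' ⟶ X} (ex' : x' ≫ fiberPowerBase t m = f')
    (hx : h ≫ x = x') (hf : h ≫ f = f') (i : Fin m)
    (y : Γ((Scheme.Modules.pullback f).obj L, (⊤ : T.Opens))) :
    ap (pointSec σ x' ex' i) (pullAmb h hf L y) =
      pullAmb h hf E (ap (pointSec σ x ex i) y) := by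
  unfold pointSec
  exact pullbackHom_pullAmb (comp_fiberPowerProj_comp ex i) h (by rw [← hx, Category.assoc])
    (comp_fiberPowerProj_comp ex' i) hf y

/-- A splitting of `q` over a scheme on which `w_n` maps to a frame of the quotient can be
prescribed by adding any combination of the other `w_j` to `w_n`. -/
theorem exists_section {A E L : T.Modules} {q : E ⟶ L} (I : E ⟶ A) {n : ℕ}
    {w : Fin (n + 1) → Γ(E, (⊤ : T.Opens))}
    (hl : ∀ l : Fin 1 → Γ(L, (⊤ : T.Opens)), l 0 = ap q (w (Fin.last n)) → IsFrame L l)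
    (h0 : ∀ j : Fin n, ap q (w j.castSucc) = 0) (c : Fin n → Γ(T, (⊤ : T.Opens))) :
    ∃ s : L ⟶ E, s ≫ q = 𝟙 _ ∧ ap I (ap s (ap q (w (Fin.last n)))) =
      ap I (w (Fin.last n)) + ∑ j, c j • ap I (w j.castSucc) := by
  obtain ⟨l, hl0⟩ : ∃ l : Fin 1 → Γ(L, (⊤ : T.Opens)), ∀ j, l j = ap q (w (Fin.last n)) :=
    ⟨fun _ => ap q (w (Fin.last n)), fun _ => rfl⟩
  have hF := hl l (hl0 0)
  have hs := hF.desc_apply (fun _ => w (Fin.last n) + ∑ j, c j • w j.castSucc) 0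
  refine ⟨hF.desc fun _ => w (Fin.last n) + ∑ j, c j • w j.castSucc, hF.hom_ext fun j => ?_, ?_⟩
  · rw [Subsingleton.elim j 0, comp_app_apply, hs, ← ap_eq, ap_add, ap_sum_smul]
    simp only [h0, smul_zero, Finset.sum_const_zero, add_zero]
    exact (hl0 0).symm
  · rw [← hl0 0, ap_eq _ (l 0), hs, ap_add, ap_sum_smul]

theorem section_eq {E L : T.Modules} {y : Γ(L, (⊤ : T.Opens))}
    (hl : ∀ l : Fin 1 → Γ(L, (⊤ : T.Opens)), l 0 = y → IsFrame L l)
    {s s' : L ⟶ E} (h : ap s y = ap s' y) : s = s' :=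
  (hl (fun _ => y) rfl).hom_ext fun _ => h

end FiberPowerPoints

/-! ### Points given by a frame and splittings -/

section AdaptedPoints
variable {T T' S Fl Sd : Scheme.{u}} {V : S.Modules} {D : ℕ} {F : Fl ⟶ S}
  {𝒱 : CompleteFlag ((Scheme.Modules.pullback F).obj V) D} {k : Fin D} {t : Sd ⟶ Fl}
  {σ : (Scheme.Modules.pullback t).obj (𝒱.gr k) ⟶
    (Scheme.Modules.pullback t).obj (𝒱.sub k.succ : Fl.Modules)} {m : ℕ}

/-- The vector `b_k + ∑_{j < k} c_j b_j`. -/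
def shifted {M : T.Modules} (k : Fin D) (b : Fin D → Γ(M, (⊤ : T.Opens)))
    (c : Fin k → Γ(T, (⊤ : T.Opens))) : Γ(M, (⊤ : T.Opens)) :=
  b k + ∑ j, c j • b (Fin.castLE k.2.le j)

variable (σ) in
/-- The point `x` of the fibered power corresponds to the flag spanned by the frame `b` and the
sections given by the class of `b_k ↦ b_k + ∑_{j < k} a_ij b_j`. -/
structure IsPoint (x : T ⟶ fiberPower t m) {f : T ⟶ Fl} (ex : x ≫ fiberPowerBase t m = f)
    {t₀ : T ⟶ S} (e : f ≫ F = t₀) (b : Fin D → Γ((Scheme.Modules.pullback t₀).obj V, (⊤ : T.Opens)))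
    (a : Fin m → Fin k → Γ(T, (⊤ : T.Opens))) : Prop where
  adapted : Adapted 𝒱 f e b
  sec : ∀ i (w : Γ((Scheme.Modules.pullback f).obj (𝒱.sub k.succ : Fl.Modules), (⊤ : T.Opens))),
    ap (flagIncl 𝒱 f e k.succ) w = b k →
    ap (flagIncl 𝒱 f e k.succ) (ap (pointSec σ x ex i) (ap (pullGr 𝒱 f k) w)) =
      shifted k b (a i)

/-- Every frame and all splittings `a` come from a point of the fibered power. -/
theorem exists_isPoint (hF : IsFlagScheme V D F 𝒱) (hσ : IsSplittingScheme (𝒱.toGr k) t σ)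
    {t₀ : T ⟶ S} {b : Fin D → Γ((Scheme.Modules.pullback t₀).obj V, (⊤ : T.Opens))}
    (hb : IsFrame _ b) (a : Fin m → Fin k → Γ(T, (⊤ : T.Opens))) :
    ∃ (x : T ⟶ fiberPower t m) (f : T ⟶ Fl) (ex : x ≫ fiberPowerBase t m = f) (e : f ≫ F = t₀),
      IsPoint σ x ex e b a := by
  obtain ⟨f, e, had⟩ := exists_adapted hF hb
  obtain ⟨w, hw, hk, hwb, hl, h0⟩ := had.exists_frame_gr k
  choose s hs hs' using fun i => exists_section (flagIncl 𝒱 f e k.succ) hl h0 (a i)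
  obtain ⟨x, ex, hx⟩ := exists_point hσ f s hs
  refine ⟨x, f, ex, e, had, fun i w' hw' => ?_⟩
  have : w' = w (Fin.last k) := had.ap_injective k.succ (hw'.trans hk.symm)
  rw [this, hx, hs', shifted, hk]
  simp only [hwb]

/-- A point of the fibered power is determined by a frame and the splittings `a`. -/
theorem IsPoint.unique (hF : IsFlagScheme V D F 𝒱) (hσ : IsSplittingScheme (𝒱.toGr k) t σ)
    {x x' : T ⟶ fiberPower t m} {f f' : T ⟶ Fl} {ex : x ≫ fiberPowerBase t m = f}
    {ex' : x' ≫ fiberPowerBase t m = f'} {t₀ : T ⟶ S} {e : f ≫ F = t₀} {e' : f' ≫ F = t₀}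
    {b : Fin D → Γ((Scheme.Modules.pullback t₀).obj V, (⊤ : T.Opens))}
    {a : Fin m → Fin k → Γ(T, (⊤ : T.Opens))} (h : IsPoint σ x ex e b a)
    (h' : IsPoint σ x' ex' e' b a) : x = x' := by
  obtain rfl := Adapted.unique hF h.adapted h'.adapted
  obtain ⟨w, hw, hk, hwb, hl, h0⟩ := h.adapted.exists_frame_gr k
  refine point_ext hσ ex ex' fun i => section_eq hl ?_
  apply h.adapted.ap_injective k.succ
  rw [h.sec i _ hk, h'.sec i _ hk]

theorem flagIncl_pullAmb' {f : T ⟶ Fl} {t₀ : T ⟶ S} {e : f ≫ F = t₀} (h : T' ⟶ T) {f' : T' ⟶ Fl}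
    (hf : h ≫ f = f') {t' : T' ⟶ S} (ht : h ≫ t₀ = t') {e' : f' ≫ F = t'} {l : Fin (D + 1)}
    {w : Γ((Scheme.Modules.pullback f).obj (𝒱.sub l : Fl.Modules), (⊤ : T.Opens))}
    {v : Γ((Scheme.Modules.pullback t₀).obj V, (⊤ : T.Opens))}
    (hw : ap (flagIncl 𝒱 f e l) w = v) :
    ap (flagIncl 𝒱 f' e' l) (pullAmb h hf _ w) = pullAmb h ht V v := by
  rw [flagIncl_pullAmb f e h hf ht e', hw]

theorem pullGr_pullAmb (f : T ⟶ Fl) (h : T' ⟶ T) {f' : T' ⟶ Fl} (hf : h ≫ f = f')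
    (w : Γ((Scheme.Modules.pullback f).obj (𝒱.sub k.succ : Fl.Modules), (⊤ : T.Opens))) :
    ap (pullGr 𝒱 f' k) (pullAmb h hf _ w) = pullAmb h hf _ (ap (pullGr 𝒱 f k) w) := by
  rw [pullAmb_eq, pullAmb_eq, pullGr, ← ap_comp, pullbackIso_naturality, ap_comp, ap_map_pullSec,
    pullGr]

theorem pullAmb_shifted (h : T' ⟶ T) {t₀ : T ⟶ S} {t' : T' ⟶ S} (ht : h ≫ t₀ = t')
    (b : Fin D → Γ((Scheme.Modules.pullback t₀).obj V, (⊤ : T.Opens)))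
    (c : Fin k → Γ(T, (⊤ : T.Opens)))
    {b' : Fin D → Γ((Scheme.Modules.pullback t').obj V, (⊤ : T'.Opens))}
    (hb' : ∀ j, b' j = pullAmb h ht V (b j)) :
    pullAmb h ht V (shifted k b c) = shifted k b' (fun j => pullTop h (c j)) := by
  rw [shifted, shifted, pullAmb_add, pullAmb_sum_smul, hb']
  simp only [hb']

theorem IsPoint.pullback {x : T ⟶ fiberPower t m} {f : T ⟶ Fl}
    {ex : x ≫ fiberPowerBase t m = f} {t₀ : T ⟶ S} {e : f ≫ F = t₀}
    {b : Fin D → Γ((Scheme.Modules.pullback t₀).obj V, (⊤ : T.Opens))}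
    {a : Fin m → Fin k → Γ(T, (⊤ : T.Opens))} (hx : IsPoint σ x ex e b a) (h : T' ⟶ T)
    {x' : T' ⟶ fiberPower t m} {f' : T' ⟶ Fl} (ex' : x' ≫ fiberPowerBase t m = f')
    {t' : T' ⟶ S} (e' : f' ≫ F = t') (hx' : h ≫ x = x') (hf : h ≫ f = f') (ht : h ≫ t₀ = t')
    {b' : Fin D → Γ((Scheme.Modules.pullback t').obj V, (⊤ : T'.Opens))}
    (hb' : ∀ j, b' j = pullAmb h ht V (b j)) :
    IsPoint σ x' ex' e' b' (fun i j => pullTop h (a i j)) := by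
  have had := hx.adapted.pullback h hf ht e' hb'
  refine ⟨had, fun i w' hw' => ?_⟩
  obtain ⟨w, -, hk, -, -⟩ := hx.adapted.exists_frame_gr k
  generalize w (Fin.last k) = w₀ at hk
  have : w' = pullAmb h hf _ w₀ :=
    had.ap_injective k.succ (hw'.trans ((hb' k).trans (flagIncl_pullAmb' h hf ht hk).symm))
  rw [this, pullGr_pullAmb, pointSec_pullAmb ex h ex' hx' hf, flagIncl_pullAmb' h hf ht
    (hx.sec i w₀ hk), pullAmb_shifted h ht b (a i) hb']

theorem castLE_castSucc (k : Fin D) (j : Fin k) :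
    Fin.castLE (Nat.succ_le_of_lt k.2) j.castSucc = Fin.castLE k.2.le j := rfl

theorem castLE_last (k : Fin D) : Fin.castLE (Nat.succ_le_of_lt k.2) (Fin.last k) = k := rfl

/-- Changing the frame `b` by an upper triangular matrix `H`: the vectors `b_k + ∑ a_ij b_j` get
multiplied by `H_kk`. -/
theorem IsPoint.change {x : T ⟶ fiberPower t m} {f : T ⟶ Fl}
    {ex : x ≫ fiberPowerBase t m = f} {t₀ : T ⟶ S} {e : f ≫ F = t₀}
    {b : Fin D → Γ((Scheme.Modules.pullback t₀).obj V, (⊤ : T.Opens))}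
    {a : Fin m → Fin k → Γ(T, (⊤ : T.Opens))} (hx : IsPoint σ x ex e b a)
    (H H' : Matrix (Fin D) (Fin D) Γ(T, (⊤ : T.Opens))) (h : H * H' = 1)
    (hu : ∀ i j, j < i → H i j = 0) (hu' : ∀ i j, j < i → H' i j = 0)
    {b' : Fin D → Γ((Scheme.Modules.pullback t₀).obj V, (⊤ : T.Opens))}
    (hb' : ∀ j, b' j = ∑ i, H i j • b i) {a' : Fin m → Fin k → Γ(T, (⊤ : T.Opens))}
    (ha' : ∀ i, shifted k b' (a' i) = H k k • shifted k b (a i)) :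
    IsPoint σ x ex e b' a' := by
  have had := hx.adapted.change H H' h hu hu' hb'
  refine ⟨had, fun i w' hw' => ?_⟩
  obtain ⟨w, -, hk, hwb, -, h0⟩ := hx.adapted.exists_frame_gr k
  have hw'' : w' = H k k • w (Fin.last k) +
      ∑ j : Fin k, H (Fin.castLE k.2.le j) k • w j.castSucc := by
    apply had.ap_injective k.succ
    rw [hw', hb', ap_add, ap_smul, ap_sum_smul,
      sum_castLE (Nat.succ_le_of_lt k.2) _ fun l hl => by
        rw [hu l k (Fin.lt_def.2 hl), zero_smul], Fin.sum_univ_castSucc, add_comm, hk]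
    simp only [hwb, castLE_castSucc, castLE_last]
  have hgr : ap (pullGr 𝒱 f k) w' = H k k • ap (pullGr 𝒱 f k) (w (Fin.last k)) := by
    rw [hw'', ap_add, ap_smul, ap_sum_smul]
    simp only [h0, smul_zero, Finset.sum_const_zero, add_zero]
  rw [hgr, ap_smul, ap_smul, hx.sec i _ hk, ha']

end AdaptedPoints

/-! ### Pulling back local homomorphisms -/

section PullLocal
variable {P T T' : Scheme.{u}} {M N : P.Modules} {W : P.Opens}

theorem LocalHom.app_res (s : LocalHom M N W) {O O' : P.Opens} (hO : O ≤ W) (h : O' ≤ O)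
    (m : Γ(M, O)) : s.app O' (h.trans hO) (res M O' h m) = res N O' h (s.app O hO m) :=
  (s.naturality O O' hO h m).symm

theorem le_preimage_inf (x : T ⟶ P) (hx : (⊤ : T.Opens) ≤ x ⁻¹ᵁ W) (O : P.Opens) :
    x ⁻¹ᵁ O ≤ x ⁻¹ᵁ (O ⊓ W) := fun _ hp => ⟨hp, hx trivial⟩

/-- The pullback along `x` of `s m`, for a section `m` over `O`. The morphism `s` is only defined on
`W`, but `O` and `O ⊓ W` have the same preimage under `x`. -/
def pullLocalFun (x : T ⟶ P) (hx : (⊤ : T.Opens) ≤ x ⁻¹ᵁ W) (s : LocalHom M N W) (O : P.Opens) :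
    Γ(M, O) →+ Γ((Scheme.Modules.pullback x).obj N, x ⁻¹ᵁ O) :=
  (pullSec x N (x ⁻¹ᵁ O) (le_preimage_inf x hx O)).comp
    ((s.app (O ⊓ W) inf_le_right).toAddMonoidHom.comp (res M (O ⊓ W) inf_le_left))

theorem pullLocalFun_apply (x : T ⟶ P) (hx : (⊤ : T.Opens) ≤ x ⁻¹ᵁ W) (s : LocalHom M N W)
    (O : P.Opens) (m : Γ(M, O)) : pullLocalFun x hx s O m =
      pullSec x N (x ⁻¹ᵁ O) (le_preimage_inf x hx O)
        (s.app (O ⊓ W) inf_le_right (res M (O ⊓ W) inf_le_left m)) := rfl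

theorem res_pullLocalFun (x : T ⟶ P) (hx : (⊤ : T.Opens) ≤ x ⁻¹ᵁ W) (s : LocalHom M N W)
    {O O' : P.Opens} (hO : O' ≤ O) (hW : O' ≤ W) {V : T.Opens} (hV : V ≤ x ⁻¹ᵁ O')
    (hV' : V ≤ x ⁻¹ᵁ O) (m : Γ(M, O)) :
    res _ V hV' (pullLocalFun x hx s O m) = pullSec x N V hV (s.app O' hW (res M O' hO m)) := by
  rw [pullLocalFun_apply, res_pullSec, ← res_res M inf_le_left (le_inf hO hW) m,
    LocalHom.app_res s inf_le_right (le_inf hO hW), pullSec_res]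

theorem pullLocalFun_res (x : T ⟶ P) (hx : (⊤ : T.Opens) ≤ x ⁻¹ᵁ W) (s : LocalHom M N W)
    {O O' : P.Opens} (hO : O' ≤ O) (m : Γ(M, O)) : pullLocalFun x hx s O' (res M O' hO m) =
      res _ (x ⁻¹ᵁ O') (x.preimage_mono hO) (pullLocalFun x hx s O m) := by
  rw [res_pullLocalFun x hx s (inf_le_left.trans hO) inf_le_right (le_preimage_inf x hx O'),
    pullLocalFun_apply, res_res]

theorem pullLocalFun_smul (x : T ⟶ P) (hx : (⊤ : T.Opens) ≤ x ⁻¹ᵁ W) (s : LocalHom M N W)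
    (O : P.Opens) (a : Γ(P, O)) (m : Γ(M, O)) : pullLocalFun x hx s O (a • m) =
      pullFun x (x ⁻¹ᵁ O) le_rfl a • pullLocalFun x hx s O m := by
  rw [pullLocalFun_apply, res_smul, map_smul, pullSec_smul, pullFun_resFun, pullLocalFun_apply]

/-- The morphism `M ⟶ x_* x^* N` given by `m ↦ x^* (s m)`. -/
def pullLocalAux (x : T ⟶ P) (hx : (⊤ : T.Opens) ≤ x ⁻¹ᵁ W) (s : LocalHom M N W) :
    M ⟶ (Scheme.Modules.pushforward x).obj ((Scheme.Modules.pullback x).obj N) :=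
  ⟨PresheafOfModules.homMk
    { app := fun O => AddCommGrpCat.ofHom (pullLocalFun x hx s O.unop)
      naturality := by
        intro O O' i
        ext m
        exact pullLocalFun_res x hx s i.unop.le m }
    (fun O a m => (pullLocalFun_smul x hx s O.unop a m).trans (by
      have : pullFun x (x ⁻¹ᵁ O.unop) le_rfl (a : Γ(P, O.unop)) = (x.app O.unop).hom a :=
        (pullFun_eq x _ _ _).trans (resFun_self _ _)
      exact congrArg (· • pullLocalFun x hx s O.unop m) this))⟩

/-- The pullback along `x : T ⟶ P` of a morphism `s : M|_W ⟶ N|_W`, if `x` factors through `W`. -/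
def pullLocal (x : T ⟶ P) (hx : (⊤ : T.Opens) ≤ x ⁻¹ᵁ W) (s : LocalHom M N W) :
    (Scheme.Modules.pullback x).obj M ⟶ (Scheme.Modules.pullback x).obj N :=
  pullLift x (pullLocalAux x hx s)

theorem pullLocal_pullSec (x : T ⟶ P) (hx : (⊤ : T.Opens) ≤ x ⁻¹ᵁ W) (s : LocalHom M N W)
    {O : P.Opens} (hO : O ≤ W) {V : T.Opens} (hV : V ≤ x ⁻¹ᵁ O) (m : Γ(M, O)) :
    (pullLocal x hx s).app V (pullSec x M V hV m) = pullSec x N V hV (s.app O hO m) := by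
  refine (pullLift_pullSec x (pullLocalAux x hx s) V hV m).trans ?_
  refine (res_pullLocalFun x hx s le_rfl hO hV hV m).trans ?_
  rw [res_self]

/-- If `x` factors through `W`, it is enough to test on sections over open subsets of `W`. -/
theorem pullback_hom_ext_local (x : T ⟶ P) (hx : (⊤ : T.Opens) ≤ x ⁻¹ᵁ W) {K : T.Modules}
    {α β : (Scheme.Modules.pullback x).obj M ⟶ K}
    (H : ∀ (O : P.Opens) (_ : O ≤ W) (V : T.Opens) (hV : V ≤ x ⁻¹ᵁ O) (m : Γ(M, O)),
      α.app V (pullSec x M V hV m) = β.app V (pullSec x M V hV m)) : α = β := by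
  refine pullback_hom_ext x fun O V hV m => ?_
  have h := H (O ⊓ W) inf_le_right V (hV.trans (le_preimage_inf x hx O)) (res M _ inf_le_left m)
  rwa [pullSec_res] at h

theorem pullLocal_add (x : T ⟶ P) (hx : (⊤ : T.Opens) ≤ x ⁻¹ᵁ W) (s s' : LocalHom M N W) :
    pullLocal x hx (s + s') = pullLocal x hx s + pullLocal x hx s' := by
  refine pullback_hom_ext_local x hx fun O hO V hV m => ?_
  have : (pullLocal x hx s + pullLocal x hx s').app V (pullSec x M V hV m) =
    (pullLocal x hx s).app V (pullSec x M V hV m) +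
      (pullLocal x hx s').app V (pullSec x M V hV m) := rfl
  rw [this, pullLocal_pullSec x hx _ hO, pullLocal_pullSec x hx _ hO, pullLocal_pullSec x hx _ hO,
    LocalHom.add_app, LinearMap.add_apply, map_add]

/-- Multiplication by a global function. -/
def mulHom (M : T.Modules) (c : Γ(T, (⊤ : T.Opens))) : M ⟶ M :=
  ⟨PresheafOfModules.homMk
    { app := fun O => AddCommGrpCat.ofHom
        (DistribSMul.toAddMonoidHom Γ(M, O.unop) (resFun O.unop le_top c))
      naturality := by
        intro O O' i
        ext m
        refine Eq.trans ?_ (res_smul M i.unop.le (resFun O.unop le_top c) m).symm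
        rw [resFun_resFun]
        rfl }
    (fun O a m => smul_comm (M := Γ(T, O.unop)) (N := Γ(T, O.unop)) (α := Γ(M, O.unop))
      (resFun O.unop le_top c) a m)⟩

theorem mulHom_app (M : T.Modules) (c : Γ(T, (⊤ : T.Opens))) (V : T.Opens) (m : Γ(M, V)) :
    (mulHom M c).app V m = resFun V le_top c • m := rfl

theorem pullLocal_smul (x : T ⟶ P) (hx : (⊤ : T.Opens) ≤ x ⁻¹ᵁ W) (s : LocalHom M N W)
    (a : Γ(P, W)) (y : Γ((Scheme.Modules.pullback x).obj M, (⊤ : T.Opens))) :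
    ap (pullLocal x hx (a • s)) y = pullFun x ⊤ hx a • ap (pullLocal x hx s) y := by
  let c := pullFun x ⊤ hx a
  have key : pullLocal x hx (a • s) = pullLocal x hx s ≫ mulHom _ c := by
    refine pullback_hom_ext_local x hx fun O hO V hV m => ?_
    rw [pullLocal_pullSec x hx _ hO, comp_app_apply, pullLocal_pullSec x hx _ hO, mulHom_app,
      LocalHom.smul_app, LinearMap.smul_apply]
    refine (pullSec_smul x N V hV (resFun O hO a) _).trans ?_
    rw [pullFun_resFun, resFun_pullFun]
  rw [key, ap_comp, ap_eq (mulHom _ c), mulHom_app, resFun_self]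

theorem pullLocal_ofHom (x : T ⟶ P) (hx : (⊤ : T.Opens) ≤ x ⁻¹ᵁ W) (φ : M ⟶ N) :
    pullLocal x hx (LocalHom.ofHom φ W) = (Scheme.Modules.pullback x).map φ := by
  refine pullback_hom_ext_local x hx fun O hO V hV m => ?_
  rw [pullLocal_pullSec x hx _ hO, map_pullSec]
  rfl

theorem pullbackIso_comp_pullLocal (x : T ⟶ P) (hx : (⊤ : T.Opens) ≤ x ⁻¹ᵁ W)
    (s : LocalHom M N W) (h : T' ⟶ T) {x' : T' ⟶ P} (e : h ≫ x = x')
    (hx' : (⊤ : T'.Opens) ≤ x' ⁻¹ᵁ W) :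
    (pullbackIso e M).hom ≫ pullLocal x' hx' s =
      (Scheme.Modules.pullback h).map (pullLocal x hx s) ≫ (pullbackIso e N).hom := by
  rw [← cancel_epi (pullbackIso e M).inv, Iso.inv_hom_id_assoc]
  refine pullback_hom_ext_local x' hx' fun O hO V hV m => ?_
  have hV' : V ≤ h ⁻¹ᵁ (x ⁻¹ᵁ O) := by rw [← e] at hV; exact hV
  rw [pullLocal_pullSec x' hx' s hO, comp_app_apply, comp_app_apply,
    pullbackIso_inv_pullSec e M le_rfl hV' hV, map_pullSec, pullLocal_pullSec x hx s hO,
    pullbackIso_pullSec e N le_rfl hV' hV]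

end PullLocal

/-! ### The iterated Frobenius -/

section Frobenius
variable {X Y T T' P Fl S : Scheme.{u}} (p : ℕ) [Fact p.Prime]

theorem absFrobenius_naturality (f : X ⟶ Y) (hX : (p : Γ(X, ⊤)) = 0) (hY : (p : Γ(Y, ⊤)) = 0) :
    absFrobenius p X hX ≫ f = f ≫ absFrobenius p Y hY := by
  apply Scheme.Hom.ext'
  apply LocallyRingedSpace.Hom.ext'
  refine PresheafedSpace.ext _ _ rfl ?_
  ext U a
  have h : (f.app U).hom a ^ p = (f.app U).hom (a ^ p) := (map_pow _ _ _).symm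
  refine Eq.trans ?_ h
  exact resFun_self (X := X) le_rfl ((f.app U).hom a ^ p)

theorem absFrobenius_app (hX : (p : Γ(X, ⊤)) = 0) (a : Γ(X, (⊤ : X.Opens))) :
    pullTop (absFrobenius p X hX) a = a ^ p := by
  rw [pullFun_eq]
  exact resFun_self _ _

theorem frobeniusIter_naturality (f : X ⟶ Y) (hX : (p : Γ(X, ⊤)) = 0) (hY : (p : Γ(Y, ⊤)) = 0)
    (r : ℕ) : frobeniusIter p X hX r ≫ f = f ≫ frobeniusIter p Y hY r := by
  induction r with
  | zero => exact (Category.id_comp f).trans (Category.comp_id f).symm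
  | succ r ih =>
    rw [frobeniusIter, frobeniusIter, Category.assoc, absFrobenius_naturality p f hX hY,
      ← Category.assoc, ih, Category.assoc]

theorem pullTop_id (a : Γ(X, (⊤ : X.Opens))) : pullTop (𝟙 X) a = a := by
  rw [pullFun_eq]
  exact resFun_self _ _

theorem pullTop_comp (f : X ⟶ Y) (g : Y ⟶ T) (a : Γ(T, (⊤ : T.Opens))) :
    pullTop (f ≫ g) a = pullTop f (pullTop g a) := by
  simp only [pullFun]
  rw [← ConcreteCategory.comp_apply, Scheme.Hom.appLE_comp_appLE]

theorem pullTop_frobeniusIter (hX : (p : Γ(X, ⊤)) = 0) (r : ℕ) (a : Γ(X, (⊤ : X.Opens))) :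
    pullTop (frobeniusIter p X hX r) a = a ^ p ^ r := by
  induction r with
  | zero => rw [frobeniusIter, pullTop_id, pow_zero, pow_one]
  | succ r ih => rw [frobeniusIter, pullTop_comp, absFrobenius_app, map_pow, ih, ← pow_mul, pow_succ]

end Frobenius

/-! ### Twisted homomorphisms at a point -/

section Twist
variable {X P T T' : Scheme.{u}} {φ : P ⟶ P} {π : P ⟶ X} {W : P.Opens} {L E : X.Modules}

/-- The identification `x^* φ^* π^* G ≅ z^* G` for `z = π ∘ φ ∘ x`. -/
def twIso {x : T ⟶ P} {y : T ⟶ P} {z : T ⟶ X} (e₁ : x ≫ φ = y) (e₂ : y ≫ π = z) (G : X.Modules) :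
    (Scheme.Modules.pullback x).obj ((Scheme.Modules.pullback φ).obj
      ((Scheme.Modules.pullback π).obj G)) ≅ (Scheme.Modules.pullback z).obj G :=
  pullbackIso e₁ _ ≪≫ pullbackIso e₂ G

/-- The pullback along `x` of a morphism `φ^* π^* L ⟶ φ^* π^* E` on `W`, as a morphism
`z^* L ⟶ z^* E`. -/
def twHom {x : T ⟶ P} {y : T ⟶ P} {z : T ⟶ X} (hx : (⊤ : T.Opens) ≤ x ⁻¹ᵁ W)
    (e₁ : x ≫ φ = y) (e₂ : y ≫ π = z)
    (s : LocalHom ((Scheme.Modules.pullback φ).obj ((Scheme.Modules.pullback π).obj L))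
      ((Scheme.Modules.pullback φ).obj ((Scheme.Modules.pullback π).obj E)) W) :
    (Scheme.Modules.pullback z).obj L ⟶ (Scheme.Modules.pullback z).obj E :=
  (twIso e₁ e₂ L).inv ≫ pullLocal x hx s ≫ (twIso e₁ e₂ E).hom

section
variable {x : T ⟶ P} {y : T ⟶ P} {z : T ⟶ X} (hx : (⊤ : T.Opens) ≤ x ⁻¹ᵁ W)
    (e₁ : x ≫ φ = y) (e₂ : y ≫ π = z)
    (s s' : LocalHom ((Scheme.Modules.pullback φ).obj ((Scheme.Modules.pullback π).obj L))
      ((Scheme.Modules.pullback φ).obj ((Scheme.Modules.pullback π).obj E)) W)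
    (l : Γ((Scheme.Modules.pullback z).obj L, (⊤ : T.Opens)))

theorem ap_comp_add_comp {K M N G : T.Modules} (a : K ⟶ M) (α β : M ⟶ N) (b : N ⟶ G)
    (l : Γ(K, (⊤ : T.Opens))) :
    ap (a ≫ (α + β) ≫ b) l = ap (a ≫ α ≫ b) l + ap (a ≫ β ≫ b) l := by
  have (y : Γ(M, (⊤ : T.Opens))) : ap (α + β) y = ap α y + ap β y := rfl
  rw [ap_comp, ap_comp, this, ap_add, ap_comp, ap_comp, ap_comp, ap_comp]

theorem ap_comp_smul_comp {K M N G : T.Modules} (a : K ⟶ M) (α β : M ⟶ N) (b : N ⟶ G)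
    (c : Γ(T, (⊤ : T.Opens))) (h : ∀ y, ap α y = c • ap β y) (l : Γ(K, (⊤ : T.Opens))) :
    ap (a ≫ α ≫ b) l = c • ap (a ≫ β ≫ b) l := by
  rw [ap_comp, ap_comp, h, ap_smul, ap_comp, ap_comp]

theorem ap_twHom_add : ap (twHom hx e₁ e₂ (s + s')) l =
    ap (twHom hx e₁ e₂ s) l + ap (twHom hx e₁ e₂ s') l := by
  rw [twHom, twHom, twHom, pullLocal_add, ap_comp_add_comp]

theorem ap_twHom_smul (a : Γ(P, W)) : ap (twHom hx e₁ e₂ (a • s)) l =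
    pullFun x ⊤ hx a • ap (twHom hx e₁ e₂ s) l := by
  exact ap_comp_smul_comp _ _ _ _ _ (pullLocal_smul x hx s a) l

/-- At a point, the twist of a morphism is the pullback of this morphism along the Frobenius of the
point. -/
theorem twHom_ofHom (τ : (Scheme.Modules.pullback π).obj L ⟶ (Scheme.Modules.pullback π).obj E) :
    twHom hx e₁ e₂ (LocalHom.ofHom ((Scheme.Modules.pullback φ).map τ) W) = pullbackHom e₂ τ := by
  rw [twHom, pullLocal_ofHom, Iso.inv_comp_eq, twIso, twIso, Iso.trans_hom, Iso.trans_hom,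
    ← Category.assoc, ← pullbackIso_naturality, pullbackHom, Category.assoc, Category.assoc,
    Iso.hom_inv_id_assoc]

variable (h : T' ⟶ T) {x' : T' ⟶ P} {y' : T' ⟶ P} {z' : T' ⟶ X}
  (e₁' : x' ≫ φ = y') (e₂' : y' ≫ π = z')

theorem map_twIso_comp (ex : h ≫ x = x') (ez : h ≫ z = z') (G : X.Modules) :
    (Scheme.Modules.pullback h).map (twIso e₁ e₂ G).hom ≫ (pullbackIso ez G).hom =
      (pullbackIso ex _).hom ≫ (twIso e₁' e₂' G).hom := by
  have ey : h ≫ y = y' := by rw [← e₁, ← e₁', ← ex, Category.assoc]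
  rw [twIso, twIso, Iso.trans_hom, Iso.trans_hom, Functor.map_comp, Category.assoc,
    ← pullbackIso_assoc ey e₂ e₂' ez, ← Category.assoc, ← pullbackIso_assoc ex e₁ e₁' ey,
    Category.assoc]

theorem pullbackIso_comp_twHom (ex : h ≫ x = x') (ez : h ≫ z = z')
    (hx' : (⊤ : T'.Opens) ≤ x' ⁻¹ᵁ W) :
    (pullbackIso ez L).hom ≫ twHom hx' e₁' e₂' s =
      (Scheme.Modules.pullback h).map (twHom hx e₁ e₂ s) ≫ (pullbackIso ez E).hom := by
  rw [← cancel_epi ((Scheme.Modules.pullback h).map (twIso e₁ e₂ L).hom), ← Category.assoc,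
    map_twIso_comp e₁ e₂ h e₁' e₂' ex ez, twHom, twHom, Category.assoc, Iso.hom_inv_id_assoc,
    ← Category.assoc (pullbackIso ex _).hom, pullbackIso_comp_pullLocal x hx s h ex hx',
    Category.assoc, ← map_twIso_comp e₁ e₂ h e₁' e₂' ex ez, ← Category.assoc, ← Category.assoc,
    ← Functor.map_comp, ← Functor.map_comp, Iso.hom_inv_id_assoc]

theorem twHom_pullAmb (ex : h ≫ x = x') (ez : h ≫ z = z')
    (hx' : (⊤ : T'.Opens) ≤ x' ⁻¹ᵁ W) :
    ap (twHom hx' e₁' e₂' s) (pullAmb h ez L l) = pullAmb h ez E (ap (twHom hx e₁ e₂ s) l) := by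
  rw [pullAmb_eq, pullAmb_eq, ← ap_comp, pullbackIso_comp_twHom hx e₁ e₂ s h e₁' e₂' ex ez hx',
    ap_comp, ap_map_pullSec]

end

end Twist

/-! ### Values of twisted homomorphisms -/

section Values
variable {T T' T'' X S Fl Sd : Scheme.{u}}

theorem pullAmb_pullAmb (g : T'' ⟶ T') (h : T' ⟶ T) {gh : T'' ⟶ T} (e₁ : g ≫ h = gh)
    {t : T ⟶ X} {t' : T' ⟶ X} {t'' : T'' ⟶ X} (e₂ : h ≫ t = t') (e₃ : gh ≫ t = t'')
    (e₄ : g ≫ t' = t'') (V : X.Modules)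
    (y : Γ((Scheme.Modules.pullback t).obj V, (⊤ : T.Opens))) :
    pullAmb g e₄ V (pullAmb h e₂ V y) = pullAmb gh e₃ V y := by
  rw [pullAmb_eq, pullAmb_eq, ← ap_map_pullSec, ← ap_comp, ← pullbackIso_assoc e₁ e₂ e₃ e₄,
    ap_comp, ap_eq (pullbackIso e₁ _).hom,
    pullbackIso_pullSec e₁ _ _ _ (le_preimage_top gh ⊤), pullAmb_eq]

variable {V : S.Modules} {D : ℕ} {F : Fl ⟶ S}
  {𝒱 : CompleteFlag ((Scheme.Modules.pullback F).obj V) D} {k : Fin D} {t : Sd ⟶ Fl}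
  {σ : (Scheme.Modules.pullback t).obj (𝒱.gr k) ⟶
    (Scheme.Modules.pullback t).obj (𝒱.sub k.succ : Fl.Modules)} {m : ℕ}
  {φP : fiberPower t m ⟶ fiberPower t m} {W : (fiberPower t m).Opens}

/-- The section of the pullback of `𝒱_{k+1}` corresponding to the member `b_k` of an adapted
frame. -/
def Adapted.topSec {f : T ⟶ Fl} {t₀ : T ⟶ S} {e : f ≫ F = t₀}
    {b : Fin D → Γ((Scheme.Modules.pullback t₀).obj V, (⊤ : T.Opens))} (h : Adapted 𝒱 f e b)
    (k : Fin D) : Γ((Scheme.Modules.pullback f).obj (𝒱.sub k.succ : Fl.Modules), (⊤ : T.Opens)) :=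
  (h.exists_frame_gr k).choose (Fin.last k)

theorem Adapted.flagIncl_topSec {f : T ⟶ Fl} {t₀ : T ⟶ S} {e : f ≫ F = t₀}
    {b : Fin D → Γ((Scheme.Modules.pullback t₀).obj V, (⊤ : T.Opens))} (h : Adapted 𝒱 f e b)
    (k : Fin D) : ap (flagIncl 𝒱 f e k.succ) (h.topSec k) = b k :=
  (h.exists_frame_gr k).choose_spec.2.1

theorem Adapted.eq_topSec {f : T ⟶ Fl} {t₀ : T ⟶ S} {e : f ≫ F = t₀}
    {b : Fin D → Γ((Scheme.Modules.pullback t₀).obj V, (⊤ : T.Opens))} (h : Adapted 𝒱 f e b)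
    {w : Γ((Scheme.Modules.pullback f).obj (𝒱.sub k.succ : Fl.Modules), (⊤ : T.Opens))}
    (hw : ap (flagIncl 𝒱 f e k.succ) w = b k) : w = h.topSec k :=
  h.ap_injective k.succ (hw.trans (h.flagIncl_topSec k).symm)

theorem comp_base_of_comm {x : T ⟶ fiberPower t m} {f : T ⟶ Fl}
    (ex : x ≫ fiberPowerBase t m = f) {φ : T ⟶ T} (hφ : φ ≫ x = x ≫ φP) :
    (x ≫ φP) ≫ fiberPowerBase t m = φ ≫ f := by
  rw [← hφ, Category.assoc, ex]

theorem comp_comp_eq {f : T ⟶ Fl} {t₀ : T ⟶ S} (e : f ≫ F = t₀) (φ : T ⟶ T) :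
    (φ ≫ f) ≫ F = φ ≫ t₀ := by
  rw [Category.assoc, e]

variable (𝒱 k φP W) in
/-- The sections over `W` of the homomorphisms from the twist of `𝒱_{k+1}/𝒱_k` to that of
`𝒱_{k+1}`. -/
abbrev TwistedHom :=
  LocalHom ((Scheme.Modules.pullback φP).obj
      ((Scheme.Modules.pullback (fiberPowerBase t m)).obj (𝒱.gr k)))
    ((Scheme.Modules.pullback φP).obj
      ((Scheme.Modules.pullback (fiberPowerBase t m)).obj (𝒱.sub k.succ : Fl.Modules))) W

/-- The value of `s` at the point `x` on the twist of the class of `w`, as a section of the twist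
of `t₀^* V`. -/
def valueOn (s : TwistedHom 𝒱 k φP W) {x : T ⟶ fiberPower t m} (hx : (⊤ : T.Opens) ≤ x ⁻¹ᵁ W)
    {f : T ⟶ Fl} (ex : x ≫ fiberPowerBase t m = f) {t₀ : T ⟶ S} (e : f ≫ F = t₀)
    {φ : T ⟶ T} (hφ : φ ≫ x = x ≫ φP)
    (w : Γ((Scheme.Modules.pullback f).obj (𝒱.sub k.succ : Fl.Modules), (⊤ : T.Opens))) :
    Γ((Scheme.Modules.pullback (φ ≫ t₀)).obj V, (⊤ : T.Opens)) :=
  ap (flagIncl 𝒱 (φ ≫ f) (comp_comp_eq e φ) k.succ)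
    (ap (twHom hx rfl (comp_base_of_comm ex hφ) s) (pullAmb φ rfl _ (ap (pullGr 𝒱 f k) w)))

section
variable (s s' : TwistedHom 𝒱 k φP W) {x : T ⟶ fiberPower t m} (hx : (⊤ : T.Opens) ≤ x ⁻¹ᵁ W)
    {f : T ⟶ Fl} (ex : x ≫ fiberPowerBase t m = f) {t₀ : T ⟶ S} (e : f ≫ F = t₀)
    {φ : T ⟶ T} (hφ : φ ≫ x = x ≫ φP)
    (w : Γ((Scheme.Modules.pullback f).obj (𝒱.sub k.succ : Fl.Modules), (⊤ : T.Opens)))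

theorem valueOn_add : valueOn (s + s') hx ex e hφ w =
    valueOn s hx ex e hφ w + valueOn s' hx ex e hφ w := by
  rw [valueOn, ap_twHom_add, ap_add, valueOn, valueOn]

theorem valueOn_smul (a : Γ(fiberPower t m, W)) : valueOn (a • s) hx ex e hφ w =
    pullFun x ⊤ hx a • valueOn s hx ex e hφ w := by
  rw [valueOn, ap_twHom_smul, ap_smul, valueOn]

/-- The value only depends on the part of `w` which survives in the graded piece. -/
theorem valueOn_of_pullGr (a : Γ(T, (⊤ : T.Opens)))
    (w' : Γ((Scheme.Modules.pullback f).obj (𝒱.sub k.succ : Fl.Modules), (⊤ : T.Opens)))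
    (h : ap (pullGr 𝒱 f k) w' = a • ap (pullGr 𝒱 f k) w) :
    valueOn s hx ex e hφ w' = pullTop φ a • valueOn s hx ex e hφ w := by
  rw [valueOn, h, pullAmb_smul, ap_smul, ap_smul, valueOn]

theorem pullbackHom_base_eq_pointSec (i : Fin m) :
    pullbackHom ex (pullbackHom (fiberPowerProj_comp t m i) σ) = pointSec σ x ex i := by
  have h := pullbackIso_comp_pullbackHom (σ := σ) (fiberPowerProj_comp t m i) x rfl
    (comp_fiberPowerProj_comp ex i) ex
  rw [pointSec, ← cancel_epi (pullbackIso ex _).hom, h, pullbackHom, Iso.hom_inv_id_assoc]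

/-- The value of the twist of the `i`-th tautological section is the twist of its value. -/
theorem valueOn_ofHom (i : Fin m) :
    valueOn (LocalHom.ofHom ((Scheme.Modules.pullback φP).map
      (pullbackHom (fiberPowerProj_comp t m i) σ)) W) hx ex e hφ w =
      pullAmb φ rfl V (ap (flagIncl 𝒱 f e k.succ)
        (ap (pointSec σ x ex i) (ap (pullGr 𝒱 f k) w))) := by
  rw [valueOn, twHom_ofHom, pullbackHom_pullAmb ex φ hφ (comp_base_of_comm ex hφ) rfl,
    pullbackHom_base_eq_pointSec, flagIncl_pullAmb f e φ rfl rfl (comp_comp_eq e φ)]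

/-- The values are compatible with base change along `h : T' ⟶ T`. -/
theorem valueOn_pullback (h : T' ⟶ T) {x' : T' ⟶ fiberPower t m}
    (hx' : (⊤ : T'.Opens) ≤ x' ⁻¹ᵁ W)
    {f' : T' ⟶ Fl} (ex' : x' ≫ fiberPowerBase t m = f') {t' : T' ⟶ S} (e' : f' ≫ F = t')
    {φ' : T' ⟶ T'} (hφ' : φ' ≫ x' = x' ≫ φP) (hxx : h ≫ x = x') (hf : h ≫ f = f')
    (hφφ : φ' ≫ h = h ≫ φ) (ht : h ≫ φ ≫ t₀ = φ' ≫ t') :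
    valueOn s hx' ex' e' hφ' (pullAmb h hf _ w) = pullAmb h ht V (valueOn s hx ex e hφ w) := by
  have hz : h ≫ φ ≫ f = φ' ≫ f' := by rw [← Category.assoc, ← hφφ, Category.assoc, hf]
  have hz' : (φ' ≫ h) ≫ f = φ' ≫ f' := by rw [Category.assoc, hf]
  rw [valueOn, pullGr_pullAmb, pullAmb_pullAmb φ' h rfl hf hz' rfl,
    ← pullAmb_pullAmb h φ hφφ.symm rfl hz' hz,
    twHom_pullAmb hx rfl (comp_base_of_comm ex hφ) s _ h rfl (comp_base_of_comm ex' hφ') hxx hz hx',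
    flagIncl_pullAmb (φ ≫ f) (comp_comp_eq e φ) h hz ht, valueOn]

end

end Values

/-! ### Generators of the general linear group of a local ring -/

section LocalGL
open Matrix
variable {n : ℕ} {B : Type*} [CommRing B]

/-- The elementary matrix `1 + c E_ij`, as an element of the general linear group. -/
def elemGL {i j : Fin n} (h : i ≠ j) (c : B) : GL (Fin n) B where
  val := transvection i j c
  inv := transvection i j (-c)
  val_inv := by rw [transvection_mul_transvection_same _ _ h, add_neg_cancel, transvection_zero]
  inv_val := by rw [transvection_mul_transvection_same _ _ h, neg_add_cancel, transvection_zero]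

theorem coe_elemGL {i j : Fin n} (h : i ≠ j) (c : B) :
    (elemGL h c : Matrix (Fin n) (Fin n) B) = transvection i j c := rfl

/-- An invertible diagonal matrix. -/
def diagGL (t : Fin n → Bˣ) : GL (Fin n) B where
  val := diagonal fun i => (t i : B)
  inv := diagonal fun i => ((t i)⁻¹ : Bˣ)
  val_inv := by simp
  inv_val := by simp

theorem coe_diagGL (t : Fin n → Bˣ) :
    (diagGL t : Matrix (Fin n) (Fin n) B) = diagonal fun i => (t i : B) := rfl

/-- Adding `c_i` times the row `s` to the row `i` for all `i` in a finite set `T` is a product of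
elementary matrices. -/
theorem exists_mem_clear_column (N : Subgroup (GL (Fin n) B))
    (hN : ∀ (i j : Fin n) (h : i ≠ j) (c : B), elemGL h c ∈ N) (s : Fin n) (c : Fin n → B)
    (T : Finset (Fin n)) (hs : s ∉ T) : ∃ g ∈ N, ∀ (M : Matrix (Fin n) (Fin n) B) i j,
      ((g : Matrix (Fin n) (Fin n) B) * M) i j = M i j + if i ∈ T then c i * M s j else 0 := by
  induction T using Finset.induction_on with
  | empty => exact ⟨1, N.one_mem, fun M i j => by simp⟩
  | insert a T ha ih =>
    rw [Finset.mem_insert, not_or] at hs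
    obtain ⟨g, hg, h⟩ := ih hs.2
    refine ⟨elemGL (Ne.symm hs.1) (c a) * g, N.mul_mem (hN _ _ _ _) hg, fun M i j => ?_⟩
    rw [GeneralLinearGroup.coe_mul, Matrix.mul_assoc, coe_elemGL]
    rcases eq_or_ne i a with rfl | hi
    · rw [transvection_mul_apply_same, h, h, if_neg ha, if_neg hs.2,
        if_pos (Finset.mem_insert_self _ _), add_zero, add_zero]
    · rw [transvection_mul_apply_of_ne _ _ _ _ hi, h]
      simp [hi]

/-- If the columns before `s` are standard, the column `s` has a unit entry in a row `≥ s`: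
otherwise the row `s` of the inverse, which vanishes before `s`, would multiply it into the maximal
ideal. -/
theorem exists_isUnit_entry [IsLocalRing B] (g : GL (Fin n) B) (s : Fin n)
    (h : ∀ i j, j < s → (g : Matrix (Fin n) (Fin n) B) i j = (1 : Matrix (Fin n) (Fin n) B) i j) :
    ∃ i, s ≤ i ∧ IsUnit ((g : Matrix (Fin n) (Fin n) B) i s) := by
  by_contra! hc
  have hinv : (↑g⁻¹ : Matrix (Fin n) (Fin n) B) * g = 1 := by
    rw [← GeneralLinearGroup.coe_mul, inv_mul_cancel, GeneralLinearGroup.coe_one]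
  have h0 : ∀ i, i < s → (↑g⁻¹ : Matrix (Fin n) (Fin n) B) s i = 0 := by
    intro i hi
    have := congrFun (congrFun hinv s) i
    rw [mul_apply, one_apply_ne hi.ne'] at this
    simpa [h _ i hi, one_apply] using this
  have h1 := congrFun (congrFun hinv s) s
  rw [mul_apply, one_apply_eq] at h1
  have : (1 : B) ∈ IsLocalRing.maximalIdeal B := by
    rw [← h1]
    refine Ideal.sum_mem _ fun i _ => ?_
    rcases lt_or_ge i s with hi | hi
    · rw [h0 i hi, zero_mul]; exact Ideal.zero_mem _
    · exact Ideal.mul_mem_left _ _ ((IsLocalRing.mem_maximalIdeal _).2 (hc i hi))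
  exact (IsLocalRing.mem_maximalIdeal _).1 this isUnit_one

/-- Over a local ring, the general linear group is generated by the elementary and the diagonal
matrices. -/
theorem mem_of_elemGL_of_diagGL [IsLocalRing B] (N : Subgroup (GL (Fin n) B))
    (hN : ∀ (i j : Fin n) (h : i ≠ j) (c : B), elemGL h c ∈ N) (hD : ∀ t, diagGL t ∈ N)
    (g : GL (Fin n) B) : g ∈ N := by
  -- Induction on the number `e` of columns, from the right, which may differ from the standard ones.
  suffices H : ∀ (e : ℕ) (g : GL (Fin n) B), (∀ i j : Fin n, (j : ℕ) + e < n →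
      (g : Matrix (Fin n) (Fin n) B) i j = (1 : Matrix (Fin n) (Fin n) B) i j) → g ∈ N from
    H n g fun i j hj => by omega
  intro e
  induction e with
  | zero =>
    intro g hg
    have : g = 1 := Units.ext (Matrix.ext fun i j => hg i j j.2)
    exact this ▸ N.one_mem
  | succ e ih =>
    intro g hg
    rcases lt_or_ge e n with hen | hen
    swap
    · exact ih g fun i j hj => by omega
    obtain ⟨s, hs⟩ : ∃ s : Fin n, (s : ℕ) + (e + 1) = n := ⟨⟨n - (e + 1), by omega⟩, by simp; omega⟩
    have hlt : ∀ j : Fin n, (j : ℕ) + (e + 1) < n ↔ j < s := fun j => by rw [Fin.lt_def]; omega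
    simp only [hlt] at hg
    -- the pivot can be made a unit by adding to its row a row below it
    wlog hu : IsUnit ((g : Matrix (Fin n) (Fin n) B) s s) generalizing g
    · obtain ⟨i, hi, hiu⟩ := exists_isUnit_entry g s hg
      have his : s ≠ i := by rintro rfl; exact hu hiu
      refine (N.mul_mem_cancel_left (hN s i his 1)).1 (this _ (fun a j hj => ?_) ?_)
      · rw [GeneralLinearGroup.coe_mul, coe_elemGL]
        rcases eq_or_ne a s with rfl | ha
        · rw [transvection_mul_apply_same, hg _ j hj, hg _ j hj, one_apply_ne (hj.trans_le hi).ne',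
            mul_zero, add_zero]
        · rw [transvection_mul_apply_of_ne _ _ _ _ ha, hg _ j hj]
      · rw [GeneralLinearGroup.coe_mul, coe_elemGL, transvection_mul_apply_same, one_mul]
        by_contra hc
        have := Ideal.sub_mem _ ((IsLocalRing.mem_maximalIdeal _).2 hc)
          ((IsLocalRing.mem_maximalIdeal _).2 hu)
        rw [add_sub_cancel_left] at this
        exact (IsLocalRing.mem_maximalIdeal _).1 this hiu
    obtain ⟨v, hv⟩ := hu
    -- a diagonal matrix makes the pivot equal to `1`
    wlog hv1 : v = 1 generalizing g v
    · refine (N.mul_mem_cancel_left (hD (Function.update 1 s v⁻¹))).1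
        (this _ (fun i j hj => ?_) 1 ?_ rfl)
      · rw [GeneralLinearGroup.coe_mul, coe_diagGL, diagonal_mul, hg i j hj]
        rcases eq_or_ne i j with rfl | hij
        · rw [Function.update_of_ne hj.ne]; simp
        · rw [one_apply_ne hij, mul_zero]
      · rw [GeneralLinearGroup.coe_mul, coe_diagGL, diagonal_mul, Function.update_self, ← hv]
        simp
    -- multiples of the row `s` clear the rest of its column
    obtain ⟨h, hh, hm⟩ := exists_mem_clear_column N hN s (fun i => -(g : Matrix (Fin n) (Fin n) B) i s)
      (Finset.univ.erase s) (Finset.notMem_erase _ _)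
    refine (N.mul_mem_cancel_left hh).1 (ih _ fun i j hj => ?_)
    rw [GeneralLinearGroup.coe_mul, hm]
    rw [hv1, Units.val_one] at hv
    rcases eq_or_lt_of_le (show j ≤ s by rw [Fin.le_def]; omega) with rfl | hjs
    · rw [← hv]
      rcases eq_or_ne i j with rfl | hij
      · simp [← hv]
      · simp [hij]
    · rw [hg i j hjs, hg s j hjs, one_apply_ne hjs.ne']; simp

end LocalGL

/-! ### Exponents on two charts of the projective line -/

section Laurent
open MvPolynomial
variable {σ : Type} {R : Type u} [CommRing R]

variable (σ R) in
/-- The polynomial ring `R[X_s]` with an invertible variable `T` adjoined. -/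
abbrev LaurentRing : Type u := AddMonoidAlgebra R (ℤ × (σ →₀ ℕ))

variable (σ R) in
/-- The powers of `T`. -/
def laurentT (n : ℤ) : LaurentRing σ R := AddMonoidAlgebra.single (n, 0) 1

variable (R) in
/-- The variable `X_s`. -/
def laurentX (s : σ) : LaurentRing σ R := AddMonoidAlgebra.single (0, Finsupp.single s 1) 1

theorem laurentT_add (m n : ℤ) : laurentT σ R (m + n) = laurentT σ R m * laurentT σ R n := by
  simp [laurentT, AddMonoidAlgebra.single_mul_single]

theorem laurentT_zero : laurentT σ R 0 = 1 := rfl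

theorem laurentT_pow (n : ℤ) (q : ℕ) : laurentT σ R n ^ q = laurentT σ R (q * n) := by
  induction q with
  | zero => simp [laurentT_zero]
  | succ q ih => rw [pow_succ, ih, ← laurentT_add]; push_cast; ring_nf

variable [Fintype σ]

/-- The exponent map of the substitution `c ↦ T ^ e`, `X_s ↦ T ^ (w s) * X_s`, where `c` is the
variable `none`. -/
def weightHom (e : ℤ) (w : σ → ℤ) : (Option σ →₀ ℕ) →+ ℤ × (σ →₀ ℕ) where
  toFun m := (e * m none + ∑ s, w s * m (some s), m.some)
  map_zero' := by simp
  map_add' m m' := by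
    ext
    · simp [mul_add, Finset.sum_add_distrib]; ring
    · simp

theorem weightHom_apply (e : ℤ) (w : σ → ℤ) (m : Option σ →₀ ℕ) :
    weightHom e w m = (e * m none + ∑ s, w s * m (some s), m.some) := rfl

/-- The substitution `c ↦ T ^ e`, `X_s ↦ T ^ (w s) * X_s`. -/
def laurentHom (e : ℤ) (w : σ → ℤ) : MvPolynomial (Option σ) R →ₐ[R] LaurentRing σ R :=
  AddMonoidAlgebra.mapDomainAlgHom R R (weightHom e w)

theorem laurentHom_none (e : ℤ) (w : σ → ℤ) :
    laurentHom e w (X none : MvPolynomial (Option σ) R) = laurentT σ R e := by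
  simp [laurentHom, X, monomial, AddMonoidAlgebra.mapDomain_single, weightHom_apply, laurentT]

theorem laurentHom_some (e : ℤ) (w : σ → ℤ) (s : σ) :
    laurentHom e w (X (some s) : MvPolynomial (Option σ) R) =
      laurentT σ R (w s) * laurentX R s := by
  classical
  simp [laurentHom, X, monomial, AddMonoidAlgebra.mapDomain_single, weightHom_apply, laurentT,
    laurentX, Finsupp.single_apply, AddMonoidAlgebra.single_mul_single]

theorem weightHom_injective (w : σ → ℤ) : Function.Injective (weightHom 1 w) := by
  intro m m' h
  simp only [weightHom_apply, Prod.mk.injEq] at h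
  have hs : ∀ s, m (some s) = m' (some s) := fun s => DFunLike.congr_fun h.2 s
  ext (_ | s)
  · simpa [hs] using h.1
  · exact hs s

/-- If a function on the two charts `c` and `c⁻¹` of the projective line is polynomial on both, up
to a twist by `T ^ n`, then the exponents of the variables in it are bounded. -/
theorem weight_le_of_laurentHom_eq {w : σ → ℤ} {n : ℤ} {h h' : MvPolynomial (Option σ) R}
    (hh : laurentHom 1 w h = laurentT σ R n * laurentHom (-1) 0 h') {m : Option σ →₀ ℕ}
    (hm : h.coeff m ≠ 0) : m none + ∑ s, w s * m (some s) ≤ n := by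
  have h1 : (laurentHom 1 w h).coeff (weightHom 1 w m) = h.coeff m := by
    simp only [laurentHom, AddMonoidAlgebra.mapDomainAlgHom_apply,
      AddMonoidAlgebra.coeff_mapDomain]
    exact Finsupp.mapDomain_apply (weightHom_injective w) _ _
  -- The coefficient of `h` at `m` is one of `T ^ n * laurentHom (-1) 0 h'`, where only exponents of
  -- `T` up to `n` occur.
  rw [hh, laurentT] at h1
  by_contra hlt
  rw [not_le] at hlt
  apply hm
  rw [← h1, show weightHom 1 w m = (n, 0) + ((weightHom 1 w m).1 - n, (weightHom 1 w m).2) by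
    ext <;> simp, AddMonoidAlgebra.coeff_single_mul_add, one_mul]
  simp only [laurentHom, AddMonoidAlgebra.mapDomainAlgHom_apply,
      AddMonoidAlgebra.coeff_mapDomain]
  refine Finsupp.mapDomain_of_notMem_range _ _ ?_
  rintro ⟨m', hm'⟩
  have := congrArg Prod.fst hm'
  simp only [weightHom_apply, Pi.zero_apply, zero_mul, Finset.sum_const_zero, add_zero] at this
  have h2 := (m' none).cast_nonneg (α := ℤ)
  simp only [neg_mul, one_mul] at this
  omega

/-- The exponents occurring after the substitution `c ↦ 0`. -/
theorem exists_coeff_of_coeff_aeval {h : MvPolynomial (Option σ) R} {μ : σ →₀ ℕ}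
    (hμ : (aeval (fun o => o.elim 0 X) h : MvPolynomial σ R).coeff μ ≠ 0) :
    ∃ m : Option σ →₀ ℕ, h.coeff m ≠ 0 ∧ m none = 0 ∧ ∀ s, m (some s) = μ s := by
  classical
  rw [aeval_def, eval₂_eq', coeff_sum] at hμ
  obtain ⟨m, hm, hne⟩ := Finset.exists_ne_zero_of_sum_ne_zero hμ
  refine ⟨m, mem_support_iff.1 hm, ?_⟩
  rw [algebraMap_eq, coeff_C_mul, Fintype.prod_option] at hne
  have h0 : m none = 0 := by
    by_contra h0
    simp [h0] at hne
  refine ⟨h0, fun s => ?_⟩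
  have e : ∏ i, (X i : MvPolynomial σ R) ^ m (some i) = monomial m.some 1 := by
    rw [monomial_eq, Finsupp.prod_fintype _ _ (by simp)]; simp
  simp only [h0, Option.elim, pow_zero, one_mul] at hne
  rw [e, coeff_monomial] at hne
  have : m.some = μ := by
    by_contra hc
    simp [hc] at hne
  rw [← this]; rfl

end Laurent

/-! ### Functions of frames and splittings -/

section CoordFunctions
open Matrix

/-- The vector with entries `a_j` at `j < k`, `1` at `k` and `0` beyond. -/
def extendOne {B : Type*} [CommRing B] {D : ℕ} (k : Fin D) (a : Fin k → B) : Fin D → B :=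
  fun j => if h : j < k then a ⟨j, h⟩ else if j = k then 1 else 0

variable {B : Type*} [CommRing B] {D : ℕ} {k : Fin D}

theorem extendOne_castLE (a : Fin k → B) (j : Fin k) :
    extendOne k a (Fin.castLE k.2.le j) = a j :=
  dif_pos (show Fin.castLE k.2.le j < k from j.2)

theorem extendOne_lt (a : Fin k → B) {j : Fin D} (h : j < k) :
    extendOne k a j = a ⟨j, h⟩ := dif_pos h

theorem extendOne_self (a : Fin k → B) : extendOne k a k = 1 := by simp [extendOne]

theorem extendOne_gt (a : Fin k → B) {j : Fin D} (h : k < j) : extendOne k a j = 0 := by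
  simp [extendOne, h.not_gt, h.ne']

/-- A natural function on pairs of an invertible matrix `g` (a frame) and `m` splittings `a`, with
values in the span of the `q`-th powers of the first vectors of the frame, which only depends on
the flag spanned by the frame and on the sections given by `a`. The field `change` compares the
frames `g` and `g * H` for an upper triangular `H`: they span the same flag, and the condition on
`a` and `a'` says that they give the same sections. -/
structure PointFunction (A : Type u) [CommRing A] (q : ℕ) {D : ℕ} (k : Fin D) (m : ℕ) where
  val : ∀ {B : Type u} [CommRing B] [Algebra A B], GL (Fin D) B → (Fin m → Fin k → B) → Fin D → B
  map : ∀ {B B' : Type u} [CommRing B] [Algebra A B] [CommRing B'] [Algebra A B'] (φ : B →ₐ[A] B')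
    (g : GL (Fin D) B) (a : Fin m → Fin k → B) (i : Fin D),
    val (GeneralLinearGroup.map φ.toRingHom g) (fun n j => φ (a n j)) i = φ (val g a i)
  span : ∀ {B : Type u} [CommRing B] [Algebra A B] (g : GL (Fin D) B) (a : Fin m → Fin k → B),
    ∃ F : Fin D → B, (∀ j, k < j → F j = 0) ∧ ∀ i, val g a i = ∑ j, F j * g i j ^ q
  change : ∀ {B : Type u} [CommRing B] [Algebra A B] (g H : GL (Fin D) B)
    (a a' : Fin m → Fin k → B), (∀ i j, j < i → H i j = 0) → (∀ i j, j < i → H⁻¹ i j = 0) →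
    (∀ n, (H : Matrix (Fin D) (Fin D) B) *ᵥ extendOne k (a' n) = H k k • extendOne k (a n)) →
    ∀ i, val (g * H) a' i = H k k ^ q * val g a i

/-- The coordinates of a `PointFunction` with respect to the `q`-th powers of the frame. -/
structure CoordFunction (A : Type u) [CommRing A] (q : ℕ) {D : ℕ} (k : Fin D) (m : ℕ) where
  val : ∀ {B : Type u} [CommRing B] [Algebra A B], GL (Fin D) B → (Fin m → Fin k → B) → Fin D → B
  map : ∀ {B B' : Type u} [CommRing B] [Algebra A B] [CommRing B'] [Algebra A B'] (φ : B →ₐ[A] B')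
    (g : GL (Fin D) B) (a : Fin m → Fin k → B) (i : Fin D),
    val (GeneralLinearGroup.map φ.toRingHom g) (fun n j => φ (a n j)) i = φ (val g a i)
  zero : ∀ {B : Type u} [CommRing B] [Algebra A B] (g : GL (Fin D) B) (a : Fin m → Fin k → B)
    (j : Fin D), k < j → val g a j = 0
  change : ∀ {B : Type u} [CommRing B] [Algebra A B] (g H : GL (Fin D) B)
    (a a' : Fin m → Fin k → B), (∀ i j, j < i → H i j = 0) → (∀ i j, j < i → H⁻¹ i j = 0) →
    (∀ n, (H : Matrix (Fin D) (Fin D) B) *ᵥ extendOne k (a' n) = H k k • extendOne k (a n)) →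
    ∀ i, H k k ^ q * val g a i = ∑ j, H i j ^ q * val (g * H) a' j

/-- The iterated Frobenius of a ring of characteristic `p`. -/
def powHom (p : ℕ) [Fact p.Prime] (r : ℕ) {R : Type*} [CommRing R] (h : (p : R) = 0) : R →+* R where
  toFun x := x ^ p ^ r
  map_one' := one_pow _
  map_mul' x y := mul_pow x y _
  map_zero' := zero_pow (pow_pos (Fact.out : p.Prime).pos r).ne'
  map_add' x y := by
    rcases subsingleton_or_nontrivial R with _ | _
    · exact Subsingleton.elim _ _
    · have : CharP R p := (CharP.charP_iff_prime_eq_zero Fact.out).2 h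
      exact add_pow_char_pow ..

theorem powHom_apply {p : ℕ} [Fact p.Prime] {r : ℕ} {R : Type*} [CommRing R] (h : (p : R) = 0)
    (x : R) : powHom p r h x = x ^ p ^ r := rfl

theorem natCast_eq_zero_of_algebra {A B : Type*} [CommRing A] [CommRing B] [Algebra A B] {p : ℕ}
    (h : (p : A) = 0) : (p : B) = 0 := by
  simpa using congrArg (algebraMap A B) h

theorem eq_of_mulVec_eq (g : GL (Fin D) B) {v w : Fin D → B}
    (h : (g : Matrix (Fin D) (Fin D) B) *ᵥ v = (g : Matrix (Fin D) (Fin D) B) *ᵥ w) : v = w := by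
  have := congrArg ((↑g⁻¹ : Matrix (Fin D) (Fin D) B) *ᵥ ·) h
  simpa only [mulVec_mulVec, ← GeneralLinearGroup.coe_mul, inv_mul_cancel,
    GeneralLinearGroup.coe_one, one_mulVec] using this

namespace PointFunction
variable {A : Type u} [CommRing A] {p : ℕ} [Fact p.Prime] {r m : ℕ} (Φ : PointFunction A (p ^ r) k m)

theorem sum_eq_mulVec {B : Type u} [CommRing B] (hB : (p : B) = 0) (g : GL (Fin D) B)
    (F : Fin D → B) (i : Fin D) : ∑ j, F j * g i j ^ p ^ r =
      ((GeneralLinearGroup.map (powHom p r hB) g : Matrix (Fin D) (Fin D) B) *ᵥ F) i :=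
  Finset.sum_congr rfl fun _ _ => mul_comm _ _

/-- Coordinates with respect to the `q`-th powers of the frame are unique. -/
theorem coord_unique {B : Type u} [CommRing B] (hB : (p : B) = 0) (g : GL (Fin D) B)
    {F F' : Fin D → B} (h : ∀ i, ∑ j, F j * g i j ^ p ^ r = ∑ j, F' j * g i j ^ p ^ r) : F = F' := by
  simp only [sum_eq_mulVec hB] at h
  exact eq_of_mulVec_eq _ (funext h)

theorem choose_eq {B : Type u} [CommRing B] [Algebra A B] (hB : (p : B) = 0) (g : GL (Fin D) B)
    (a : Fin m → Fin k → B) {F : Fin D → B} (h : ∀ i, Φ.val g a i = ∑ j, F j * g i j ^ p ^ r) :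
    (Φ.span g a).choose = F :=
  coord_unique hB g fun i => ((Φ.span g a).choose_spec.2 i).symm.trans (h i)

/-- The coordinates of a `PointFunction`. -/
def coord (hA : (p : A) = 0) : CoordFunction A (p ^ r) k m where
  val g a := (Φ.span g a).choose
  map φ g a i := by
    rw [Φ.choose_eq (natCast_eq_zero_of_algebra hA)
      (F := fun i => φ ((Φ.span g a).choose i)) _ _ fun i => ?_]
    rw [Φ.map, (Φ.span g a).choose_spec.2, map_sum]
    simp
  zero g a := (Φ.span g a).choose_spec.1
  change {B} _ _ g H a a' hu hu' ha i := by
    have hB : (p : B) = 0 := natCast_eq_zero_of_algebra hA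
    refine congrFun (coord_unique (r := r) (F := fun i => H k k ^ p ^ r * (Φ.span g a).choose i)
      (F' := fun i => ∑ j, H i j ^ p ^ r * (Φ.span (g * H) a').choose j) hB g fun i => ?_) i
    have h1 := (Φ.span (g * H) a').choose_spec.2 i
    rw [Φ.change g H a a' hu hu' ha, (Φ.span g a).choose_spec.2, Finset.mul_sum] at h1
    simp only [mul_assoc]
    rw [h1]
    refine (sum_eq_mulVec hB (g * H) _ i).trans (Eq.trans ?_ (sum_eq_mulVec hB g _ i).symm)
    rw [map_mul, GeneralLinearGroup.coe_mul, ← mulVec_mulVec]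
    rfl

theorem val_eq_sum (hA : (p : A) = 0) {B : Type u} [CommRing B] [Algebra A B] (g : GL (Fin D) B)
    (a : Fin m → Fin k → B) (i : Fin D) :
    Φ.val g a i = ∑ j, (Φ.coord hA).val g a j * g i j ^ p ^ r := (Φ.span g a).choose_spec.2 i

end PointFunction

end CoordFunctions

/-! ### Changes of frame between two charts -/

section FlipGL
open Matrix
variable {D : ℕ} {B C : Type*} [CommRing B] [CommRing C]

/-- The permutation matrix of a transposition. -/
def swapGL (B : Type*) [CommRing B] (i j : Fin D) : GL (Fin D) B where
  val := Matrix.swap B i j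
  inv := Matrix.swap B i j
  val_inv := Matrix.swap_mul_self i j
  inv_val := Matrix.swap_mul_self i j

theorem map_elemGL (φ : B →+* C) {i j : Fin D} (h : i ≠ j) (c : B) :
    GeneralLinearGroup.map φ (elemGL h c) = elemGL h (φ c) := by
  refine Units.ext (Matrix.ext fun a b => ?_)
  rw [GeneralLinearGroup.map_apply]
  simp [elemGL, transvection, Matrix.single_apply, Matrix.one_apply, apply_ite φ]

theorem map_swapGL (φ : B →+* C) (i j : Fin D) :
    GeneralLinearGroup.map φ (swapGL B i j) = swapGL C i j :=
  Units.ext (Matrix.map_swap φ i j)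

/-- The upper triangular matrix comparing the frames on the two charts of the projective line on
which the vectors `k` and `l` of the frame are moved. -/
def flipGL {k l : Fin D} (h : l ≠ k) (t t' : B) : GL (Fin D) B :=
  (elemGL h t)⁻¹ * swapGL B k l * elemGL h t'

theorem elemGL_mul_flipGL {k l : Fin D} (h : l ≠ k) (t t' : B) :
    elemGL h t * flipGL h t t' = swapGL B k l * elemGL h t' := by
  rw [flipGL, mul_assoc, mul_inv_cancel_left]

theorem flipGL_inv {k l : Fin D} (h : l ≠ k) (t t' : B) : (flipGL h t t')⁻¹ = flipGL h t' t := by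
  rw [flipGL, flipGL, _root_.mul_inv_rev, _root_.mul_inv_rev, inv_inv, mul_assoc]; rfl

theorem flipGL_apply {k l : Fin D} (h : l ≠ k) {t t' : B} (ht : t * t' = 1) (i j : Fin D) :
    flipGL h t t' i j = if i = j then (if j = k then t' else if j = l then -t else 1)
      else if i = k ∧ j = l then 1 else 0 := by
  have e : (flipGL h t t' : Matrix (Fin D) (Fin D) B) =
    transvection l k (-t) * Matrix.swap B k l * transvection l k t' := rfl
  have hs : ∀ i j, Matrix.swap B k l i j = if Equiv.swap k l i = j then 1 else 0 := fun i j => by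
    simp [Matrix.swap, PEquiv.toMatrix_apply, eq_comm]
  rw [e]
  rcases eq_or_ne j k with rfl | hj
  · rw [mul_transvection_apply_same]
    rcases eq_or_ne i l with rfl | hi
    · rw [transvection_mul_apply_same, transvection_mul_apply_same, hs, hs, hs, hs]
      simp [h, h.symm, mul_comm t', ht]
    · rw [transvection_mul_apply_of_ne _ _ _ _ hi, transvection_mul_apply_of_ne _ _ _ _ hi, hs, hs]
      rcases eq_or_ne i j with rfl | hij
      · simp [h]
      · simp [hi, hij, h.symm, Equiv.swap_apply_of_ne_of_ne hij hi]
  · rw [mul_transvection_apply_of_ne _ _ _ _ hj]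
    rcases eq_or_ne i l with rfl | hi
    · rw [transvection_mul_apply_same, hs, hs]
      rcases eq_or_ne i j with rfl | hij
      · simp [h, h.symm]
      · simp [h, hij, hj.symm]
    · rw [transvection_mul_apply_of_ne _ _ _ _ hi, hs]
      rcases eq_or_ne i k with rfl | hik
      · simp [hj.symm, eq_comm]
      · rw [Equiv.swap_apply_of_ne_of_ne hik hi]
        rcases eq_or_ne i j with rfl | hij
        · simp [hi, hj]
        · simp [hij, hik]

/-- The matrix `flipGL` is upper triangular: it has a single entry off the diagonal, at `(k, l)`. -/
theorem flipGL_upper {k l : Fin D} (hkl : k < l) {t t' : B} (ht : t * t' = 1) (i j : Fin D)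
    (hij : j < i) : flipGL hkl.ne' t t' i j = 0 := by
  rw [flipGL_apply _ ht, if_neg hij.ne', if_neg]
  rintro ⟨rfl, rfl⟩
  exact hij.asymm hkl

/-- An elementary matrix is a commutator of two others. -/
theorem elemGL_mul_elemGL {i j l : Fin D} (hij : i ≠ j) (hil : i ≠ l) (hlj : l ≠ j) (c : B) :
    elemGL hil c * elemGL hlj 1 = elemGL hij c * elemGL hlj 1 * elemGL hil c := by
  refine Units.ext ?_
  simp only [GeneralLinearGroup.coe_mul, coe_elemGL, transvection, Matrix.add_mul, Matrix.mul_add,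
    Matrix.one_mul, Matrix.single_mul_single_same,
    Matrix.single_mul_single_of_ne _ _ _ _ hij.symm, Matrix.single_mul_single_of_ne _ _ _ _ hlj.symm,
    mul_one]
  simp only [add_zero, Matrix.zero_mul]
  abel

end FlipGL

/-! ### Exponents of coordinate functions -/

namespace CoordFunction
open Matrix
variable {A : Type u} [CommRing A] {q D m : ℕ} {k : Fin D} (F : CoordFunction A q k m)
  {R : Type u} [CommRing R] [Algebra A R]

section Change
variable (g H : GL (Fin D) R) (d : Fin D → R)

/-- A change of frame by a matrix which is diagonal on the first vectors. -/
theorem val_change (hq : 0 < q) (hu : ∀ i j, j < i → H i j = 0) (hu' : ∀ i j, j < i → H⁻¹ i j = 0)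
    (hd : ∀ i j, j ≤ k → H i j = if i = j then d j else 0) {a a' : Fin m → Fin k → R}
    (ha : ∀ n j, d (Fin.castLE k.2.le j) * a' n j = d k * a n j) {i : Fin D} (hi : i ≤ k) :
    d k ^ q * F.val g a i = d i ^ q * F.val (g * H) a' i := by
  have hkk : H k k = d k := by rw [hd k k le_rfl, if_pos rfl]
  have h := F.change g H a a' hu hu' (fun n => ?_) i
  · rw [hkk, Finset.sum_eq_single i] at h
    · rw [h, hd i i hi, if_pos rfl]
    · intro j _ hj
      rcases le_or_gt j k with hjk | hjk
      · rw [hd i j hjk, if_neg hj.symm, zero_pow hq.ne', zero_mul]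
      · rw [F.zero _ _ _ hjk, mul_zero]
    · simp
  · ext i
    have h1 : ∀ j, H i j * extendOne k (a' n) j =
        if i = j then d i * extendOne k (a' n) i else 0 := by
      intro j
      rcases le_or_gt j k with hjk | hjk
      · rw [hd i j hjk]
        rcases eq_or_ne i j with rfl | hij <;> simp [*]
      · rw [extendOne_gt _ hjk, mul_zero]
        rcases eq_or_ne i j with rfl | hij
        · simp [extendOne_gt _ hjk]
        · simp [hij]
    rw [mulVec, dotProduct]
    simp only [h1, Finset.sum_ite_eq, Finset.mem_univ, if_true, Pi.smul_apply, smul_eq_mul, hkk]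
    rcases lt_trichotomy i k with hik | rfl | hik
    · rw [extendOne_lt _ hik, extendOne_lt _ hik]
      exact ha n ⟨i, hik⟩
    · rw [extendOne_self, extendOne_self]
    · rw [extendOne_gt _ hik, extendOne_gt _ hik, mul_zero, mul_zero]

end Change

/-- The comparison of the values on the two charts of the projective line obtained by moving the
vectors `k₁` and `l` of the frame. -/
theorem val_flip (hq : 0 < q) {k₁ l : Fin D} (hk : k₁ ≤ k) (hl : k < l) {t t' : R} (ht : t * t' = 1)
    (g : GL (Fin D) R) {a a' : Fin m → Fin k → R}
    (ha : ∀ n j, (if Fin.castLE k.2.le j = k₁ then t' else 1) * a' n j =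
      (if k = k₁ then t' else 1) * a n j) {i : Fin D} (hi : i ≤ k) :
    (if k = k₁ then t' else 1) ^ q * F.val (g * elemGL (hk.trans_lt hl).ne' t) a i =
      (if i = k₁ then t' else 1) ^ q *
        F.val (g * swapGL R k₁ l * elemGL (hk.trans_lt hl).ne' t') a' i := by
  have hkl := hk.trans_lt hl
  rw [mul_assoc g, ← elemGL_mul_flipGL hkl.ne' t t', ← mul_assoc]
  refine F.val_change (g * elemGL hkl.ne' t) (flipGL hkl.ne' t t')
    (fun j => if j = k₁ then t' else 1) hq (flipGL_upper hkl ht)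
    (fun i j => ?_) (fun i j hj => ?_) ha hi
  · rw [flipGL_inv]; exact flipGL_upper hkl ((mul_comm _ _).trans ht) i j
  · rw [flipGL_apply _ ht]
    have : j ≠ l := (hj.trans_lt hl).ne
    simp [this]

section Universal
open MvPolynomial

theorem val_map {P Q : Type u} [CommRing P] [CommRing Q] [Algebra A P] [Algebra A Q] [Algebra R P]
    [Algebra R Q] [IsScalarTower A R P] [IsScalarTower A R Q] (φ : P →ₐ[R] Q)
    (g : GL (Fin D) R) (h : GL (Fin D) P) (y : Fin m → Fin k → P) (i : Fin D) :
    φ (F.val (GeneralLinearGroup.map (algebraMap R P) g * h) y i) =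
      F.val (GeneralLinearGroup.map (algebraMap R Q) g * GeneralLinearGroup.map φ.toRingHom h)
        (fun n j => φ (y n j)) i := by
  refine (F.map (φ.restrictScalars A) (GeneralLinearGroup.map (algebraMap R P) g * h) y i).symm.trans
    ?_
  rw [map_mul, ← GeneralLinearGroup.map_comp_apply]
  have e : (φ.restrictScalars A).toRingHom.comp (algebraMap R P) = algebraMap R Q :=
    φ.comp_algebraMap
  change F.val (((GeneralLinearGroup.map (φ.restrictScalars A).toRingHom).comp
    (GeneralLinearGroup.map (algebraMap R P))) g * _) _ i = _
  rw [← GeneralLinearGroup.map_comp, e]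
  rfl

theorem val_map_elemGL {P Q : Type u} [CommRing P] [CommRing Q] [Algebra A P] [Algebra A Q]
    [Algebra R P] [Algebra R Q] [IsScalarTower A R P] [IsScalarTower A R Q] (φ : P →ₐ[R] Q)
    (g : GL (Fin D) R) {k₁ l : Fin D} (h : l ≠ k₁) (c : P) (y : Fin m → Fin k → P) (i : Fin D) :
    φ (F.val (GeneralLinearGroup.map (algebraMap R P) g * elemGL h c) y i) =
      F.val (GeneralLinearGroup.map (algebraMap R Q) g * elemGL h (φ c)) (fun n j => φ (y n j)) i := by
  rw [F.val_map, map_elemGL]; rfl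

theorem map_algebraMap_self (g : GL (Fin D) R) :
    GeneralLinearGroup.map (algebraMap R R) g = g := by
  rw [Algebra.algebraMap_self, GeneralLinearGroup.map_id]; rfl

theorem elemGL_zero {l k₁ : Fin D} (h : l ≠ k₁) : elemGL h (0 : R) = 1 :=
  Units.ext (transvection_zero _ _)

/-- The value at the frame `g` on the universal splittings, a polynomial in their coordinates. -/
def universal (g : GL (Fin D) R) (i : Fin D) : MvPolynomial (Fin m × Fin k) R :=
  F.val (GeneralLinearGroup.map (algebraMap R _) g) (fun n j => X (n, j)) i

/-- The value on the universal splittings after adding an indeterminate multiple of the vector `l`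
of the frame `g` to the vector `k₁`. -/
def universalElem (g : GL (Fin D) R) {k₁ l : Fin D} (h : l ≠ k₁) (i : Fin D) :
    MvPolynomial (Option (Fin m × Fin k)) R :=
  F.val (GeneralLinearGroup.map (algebraMap R _) g * elemGL h (X none))
    (fun n j => X (some (n, j))) i

theorem aeval_universal (g : GL (Fin D) R) (i : Fin D) (a : Fin m → Fin k → R) :
    aeval (fun s => a s.1 s.2) (F.universal g i) = F.val g a i := by
  have := F.val_map (aeval fun s : Fin m × Fin k => a s.1 s.2) g 1 (fun n j => X (n, j)) i
  rw [map_one, mul_one, mul_one, map_algebraMap_self] at this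
  simpa only [universal, aeval_X] using this

theorem aeval_universalElem (g : GL (Fin D) R) {k₁ l : Fin D} (h : l ≠ k₁) (i : Fin D) :
    aeval (fun o => o.elim 0 X) (F.universalElem g h i) = F.universal g i := by
  have := F.val_map_elemGL (aeval fun o => o.elim 0 X :
    MvPolynomial (Option (Fin m × Fin k)) R →ₐ[R] MvPolynomial (Fin m × Fin k) R) g h (X none)
    (fun n j => X (some (n, j))) i
  simpa only [universalElem, universal, aeval_X, Option.elim, elemGL_zero, mul_one] using this

variable {k₁ l : Fin D}

/-- On the overlap of the two charts of the projective line on which the vectors `k₁` and `l` are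
moved, the universal values agree up to powers of `T`: the change of frame is upper triangular with
entry `T⁻¹` at `k₁`. -/
theorem laurentHom_universalElem (hq : 0 < q) (hk : k₁ ≤ k) (hl : k < l) (g : GL (Fin D) R) {i : Fin D} (hi : i ≤ k) :
    laurentHom 1 (fun s => (if Fin.castLE k.2.le s.2 = k₁ then -1 else 0) - if k = k₁ then -1 else 0)
        (F.universalElem g (hk.trans_lt hl).ne' i) =
      laurentT _ R (q * ((if i = k₁ then -1 else 0) - if k = k₁ then -1 else 0)) *
        laurentHom (-1) 0 (F.universalElem (g * swapGL R k₁ l) (hk.trans_lt hl).ne' i) := by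
  have hpow : ∀ (P : Prop) [Decidable P], (if P then laurentT (Fin m × Fin k) R (-1) else 1) =
      laurentT _ R (if P then -1 else 0) := by
    intro P _; split_ifs <;> rfl
  rw [universalElem, universalElem, F.val_map_elemGL, F.val_map_elemGL, laurentHom_none, laurentHom_none, map_mul,
    map_swapGL]
  have h := F.val_flip hq hk hl (t := laurentT (Fin m × Fin k) R 1) (t' := laurentT _ R (-1))
    (by rw [← laurentT_add]; rfl) (GeneralLinearGroup.map (algebraMap R _) g)
    (a := fun n j => laurentHom 1 (fun s => (if Fin.castLE k.2.le s.2 = k₁ then -1 else 0) -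
      if k = k₁ then -1 else 0) (X (some (n, j))))
    (a' := fun n j => laurentHom (-1) 0 (X (some (n, j)))) (fun n j => ?_) hi
  · simp only [hpow, laurentT_pow] at h
    rw [mul_sub, sub_eq_add_neg, add_comm, laurentT_add, mul_assoc, ← h, ← mul_assoc,
      ← laurentT_add, neg_add_cancel, laurentT_zero, one_mul]
  · simp only [hpow, laurentHom_some]
    rw [← mul_assoc, ← mul_assoc, ← laurentT_add, ← laurentT_add]
    simp

/-- The bounds on the exponents of the universal values. For `k₁ = k` they bound the total degree
from above, for `k₁ < k` the degree in the coordinates of the splittings with index `k₁` from below.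
-/
theorem weight_universal_le (hq : 0 < q) (hk : k₁ ≤ k) (hl : k < l) (g : GL (Fin D) R) {i : Fin D} (hi : i ≤ k) {μ : Fin m × Fin k →₀ ℕ}
    (hμ : (F.universal g i).coeff μ ≠ 0) :
    ∑ s, ((if Fin.castLE k.2.le s.2 = k₁ then -1 else 0) - if k = k₁ then -1 else 0) * (μ s : ℤ) ≤
      q * ((if i = k₁ then -1 else 0) - if k = k₁ then -1 else 0) := by
  rw [← F.aeval_universalElem g (hk.trans_lt hl).ne'] at hμ
  obtain ⟨m', hm, h0, hs⟩ := exists_coeff_of_coeff_aeval hμ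
  have := weight_le_of_laurentHom_eq (F.laurentHom_universalElem hq hk hl g hi) hm
  simpa [h0, hs] using this

end Universal

end CoordFunction

/-! ### Independence of the frame -/

namespace CoordFunction
open Matrix MvPolynomial
variable {A : Type u} [CommRing A] {q D m : ℕ} {k : Fin D} (F : CoordFunction A q k m)
  {R : Type u} [CommRing R] [Algebra A R]

theorem aeval_eq_mul_aeval {τ : Type} [Fintype τ] {f : MvPolynomial τ R} {x x' : τ → R} {y : R}
    (h : ∀ μ, f.coeff μ ≠ 0 → ∏ s, x s ^ μ s = y * ∏ s, x' s ^ μ s) :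
    aeval x f = y * aeval x' f := by
  rw [aeval_def, aeval_def, eval₂_eq', eval₂_eq', Finset.mul_sum]
  refine Finset.sum_congr rfl fun μ hμ => ?_
  rw [h μ (mem_support_iff.1 hμ), mul_left_comm]

/-- The coordinate with index `k` does not depend on the splittings: it has total degree `0`. -/
theorem val_self (hq : 0 < q) {l : Fin D} (hl : k < l) (g : GL (Fin D) R)
    (a a' : Fin m → Fin k → R) : F.val g a k = F.val g a' k := by
  rw [← F.aeval_universal, ← F.aeval_universal, aeval_eq_mul_aeval (y := 1), one_mul]
  intro μ hμ
  have h := F.weight_universal_le hq le_rfl hl g le_rfl hμ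
  have h0 : ∀ s : Fin m × Fin k, Fin.castLE k.2.le s.2 ≠ k := fun s => ne_of_lt s.2.2
  simp only [h0, if_false, if_true, zero_add, one_mul, sub_neg_eq_add, neg_add_cancel,
    mul_zero] at h
  have h1 : ∑ s, μ s = 0 := by exact_mod_cast h.antisymm (Finset.sum_nonneg fun _ _ => by simp)
  simp only [Finset.sum_eq_zero_iff, Finset.mem_univ, forall_true_left] at h1
  simp [h1]

/-- In the coordinate with index `j`, the total degree is at most `q` and the degree in the `j`-th
coordinates of the splittings is at least `q`; so both are `q`. -/
theorem coeff_universal (hq : 0 < q) {l : Fin D} (hl : k < l) (g : GL (Fin D) R) (j : Fin k)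
    {μ : Fin m × Fin k →₀ ℕ} (hμ : (F.universal g (Fin.castLE k.2.le j)).coeff μ ≠ 0) :
    (∀ s, s.2 ≠ j → μ s = 0) ∧ ∑ s, (if s.2 = j then μ s else 0) = q := by
  have hj : Fin.castLE k.2.le j < k := j.2
  have h := F.weight_universal_le hq le_rfl hl g hj.le hμ
  have h' := F.weight_universal_le hq hj.le hl g hj.le hμ
  have h0 : ∀ s : Fin m × Fin k, Fin.castLE k.2.le s.2 ≠ k := fun s => ne_of_lt s.2.2
  have h1 : ∀ s : Fin m × Fin k, Fin.castLE k.2.le s.2 = Fin.castLE k.2.le j ↔ s.2 = j :=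
    fun s => Fin.castLE_inj
  simp only [h0, hj.ne, if_false, if_true, zero_sub, neg_neg, one_mul, mul_one] at h
  simp only [h1, hj.ne', if_false, if_true, sub_zero, ite_mul, neg_mul, one_mul, zero_mul,
    mul_neg, mul_one] at h'
  have h2 : ∑ s, μ s ≤ q := by exact_mod_cast h
  have h3 : q ≤ ∑ s, (if s.2 = j then μ s else 0) := by
    have : ∑ s, (if s.2 = j then -(μ s : ℤ) else 0) =
        -((∑ s, (if s.2 = j then μ s else 0) : ℕ) : ℤ) := by
      rw [Nat.cast_sum, ← Finset.sum_neg_distrib]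
      exact Finset.sum_congr rfl fun s _ => by split_ifs <;> simp
    rw [this] at h'
    omega
  have h4 : ∑ s, μ s = ∑ s, (if s.2 = j then μ s else 0) + ∑ s, (if s.2 = j then 0 else μ s) := by
    rw [← Finset.sum_add_distrib]
    exact Finset.sum_congr rfl fun s _ => by split_ifs <;> simp
  have h5 : ∑ s, (if s.2 = j then 0 else μ s) = 0 := by omega
  refine ⟨fun s hs => ?_, by omega⟩
  have := (Finset.sum_eq_zero_iff.1 h5) s (Finset.mem_univ _)
  rwa [if_neg hs] at this

/-- The coordinate with index `j` is homogeneous of degree `q` in the `j`-th coordinates of the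
splittings, and does not depend on the other ones. -/
theorem val_homogeneous (hq : 0 < q) {l : Fin D} (hl : k < l) (g : GL (Fin D) R) (j : Fin k)
    {a a' : Fin m → Fin k → R} (y : R) (h : ∀ n, a' n j = y * a n j) :
    F.val g a' (Fin.castLE k.2.le j) = y ^ q * F.val g a (Fin.castLE k.2.le j) := by
  rw [← F.aeval_universal, ← F.aeval_universal]
  refine aeval_eq_mul_aeval fun μ hμ => ?_
  obtain ⟨h0, h1⟩ := F.coeff_universal hq hl g j hμ
  rw [← h1, ← Finset.prod_pow_eq_pow_sum, ← Finset.prod_mul_distrib]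
  refine Finset.prod_congr rfl fun s _ => ?_
  split_ifs with hs
  · rw [← mul_pow, hs, h]
  · rw [h0 s hs, pow_zero, pow_zero, pow_zero, mul_one]

theorem val_congr (hq : 0 < q) {l : Fin D} (hl : k < l) (g : GL (Fin D) R) (j : Fin k)
    {a a' : Fin m → Fin k → R} (h : ∀ n, a' n j = a n j) :
    F.val g a' (Fin.castLE k.2.le j) = F.val g a (Fin.castLE k.2.le j) := by
  rw [F.val_homogeneous hq hl g j 1 (fun n => by rw [h, one_mul]), one_pow, one_mul]

/-- The coordinates do not change under a change of frame which is diagonal on the first vectors: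
the twist is compensated by the homogeneity. -/
theorem val_change_eq (hq : 0 < q) {l : Fin D} (hl : k < l) (g H : GL (Fin D) R)
    (hu : ∀ i j, j < i → H i j = 0) (hu' : ∀ i j, j < i → H⁻¹ i j = 0) (d : Fin D → Rˣ)
    (hd : ∀ i j, j ≤ k → H i j = if i = j then (d j : R) else 0) (a : Fin m → Fin k → R)
    (i : Fin D) : F.val (g * H) a i = F.val g a i := by
  rcases lt_or_ge k i with hi | hi
  · rw [F.zero _ _ _ hi, F.zero _ _ _ hi]
  have h := F.val_change g H (fun j => d j) hq hu hu' hd (a := a)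
    (a' := fun n j => (((d (Fin.castLE k.2.le j))⁻¹ : Rˣ) : R) * (d k * a n j))
    (fun n j => by rw [← mul_assoc, Units.mul_inv, one_mul]) hi
  rcases eq_or_lt_of_le hi with rfl | hi
  · rw [F.val_self hq hl (g * H) _ a] at h
    exact (((d i).isUnit.pow q).mul_left_cancel h).symm
  · obtain ⟨j, rfl⟩ : ∃ j : Fin k, Fin.castLE k.2.le j = i := ⟨⟨i, hi⟩, rfl⟩
    rw [F.val_homogeneous hq hl (g * H) j (((d (Fin.castLE k.2.le j))⁻¹ : Rˣ) * d k)
      (a := a) (a' := fun n j => (((d (Fin.castLE k.2.le j))⁻¹ : Rˣ) : R) * (d k * a n j))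
      (fun n => by rw [mul_assoc]), ← mul_assoc, ← mul_pow, ← mul_assoc, Units.mul_inv,
      one_mul] at h
    exact (((d k).isUnit.pow q).mul_left_cancel h).symm

/-- By homogeneity the coordinates on the two charts of the projective line agree without a twist.
-/
theorem val_mul_flip (hq : 0 < q) {k₁ l : Fin D} (hk : k₁ ≤ k) (hl : k < l) {t t' : R}
    (ht : t * t' = 1) (g : GL (Fin D) R) (a : Fin m → Fin k → R) (i : Fin D) :
    F.val (g * swapGL R k₁ l * elemGL (hk.trans_lt hl).ne' t') a i =
      F.val (g * elemGL (hk.trans_lt hl).ne' t) a i := by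
  have hkl := hk.trans_lt hl
  rw [mul_assoc g, ← elemGL_mul_flipGL hkl.ne' t t', ← mul_assoc]
  refine F.val_change_eq hq hl _ _ (flipGL_upper hkl ht) (fun i j => ?_)
    (fun j => if j = k₁ then ⟨t', t, (mul_comm _ _).trans ht, ht⟩ else 1) (fun i j hj => ?_) a i
  · rw [flipGL_inv]; exact flipGL_upper hkl ((mul_comm _ _).trans ht) i j
  · rw [flipGL_apply _ ht]
    have : j ≠ l := (hj.trans_lt hl).ne
    by_cases hj : j = k₁ <;> simp [this, hj, hkl.ne]

/-- The coordinates do not change when multiples of the later vectors of the frame are added to the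
first ones, since they would give a global function on a projective line. -/
theorem val_mul_elemGL (hq : 0 < q) {k₁ l : Fin D} (hk : k₁ ≤ k) (hl : k < l) (g : GL (Fin D) R)
    (c : R) (a : Fin m → Fin k → R) (i : Fin D) :
    F.val (g * elemGL (hk.trans_lt hl).ne' c) a i = F.val g a i := by
  have hkl := (hk.trans_lt hl).ne'
  -- `f g` is the coordinate on one chart and `f (g * swapGL R k₁ l)` the one on the other chart; they
  -- agree on the overlap, so that `f g` does not involve the variable `none`.
  let f : GL (Fin D) R → MvPolynomial (Option (Fin m × Fin k)) R := fun g =>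
    F.val (GeneralLinearGroup.map (algebraMap R _) g * elemGL hkl (X none)) (fun n j => C (a n j)) i
  have hf : laurentHom 1 0 (f g) = laurentT _ R 0 * laurentHom (-1) 0 (f (g * swapGL R k₁ l)) := by
    rw [F.val_map_elemGL, F.val_map_elemGL, laurentHom_none, laurentHom_none, map_mul, map_swapGL,
      laurentT_zero, one_mul]
    simp only [← MvPolynomial.algebraMap_eq, AlgHom.commutes]
    exact (F.val_mul_flip hq hk hl (by rw [← laurentT_add]; rfl) _ _ i).symm
  have he : ∀ y : R, aeval (fun o : Option (Fin m × Fin k) => o.elim y 0) (f g) =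
      F.val (g * elemGL hkl y) a i := by
    intro y
    rw [F.val_map_elemGL, map_algebraMap_self]
    simp only [aeval_X, aeval_C, Option.elim, Algebra.algebraMap_self, RingHom.id_apply]
  have h0 : F.val g a i = F.val (g * elemGL hkl 0) a i := by rw [elemGL_zero, mul_one]
  rw [h0, ← he, ← he, aeval_eq_mul_aeval (y := 1), one_mul]
  intro μ hμ
  have := weight_le_of_laurentHom_eq hf hμ
  have h1 : μ none = 0 := by simpa using this
  rw [Fintype.prod_option, Fintype.prod_option]
  simp [h1]

/-- The subgroup of the changes of frame under which the coordinates are invariant. -/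
def stabilizer (R : Type u) [CommRing R] [Algebra A R] : Subgroup (GL (Fin D) R) where
  carrier := {h | ∀ (g : GL (Fin D) R) a i, F.val (g * h) a i = F.val g a i}
  mul_mem' h h' g a i := by rw [← mul_assoc, h', h]
  one_mem' g a i := by rw [mul_one]
  inv_mem' {h} hh g a i := by rw [← hh, inv_mul_cancel_right]

/-- The elementary matrices stabilize the coordinates: those which add a vector beyond `k` to one of
the first vectors by `val_mul_elemGL`, the upper triangular ones which move a vector beyond `k`
because they do not change the flag or the sections, and the other ones as commutators of these.
Here a vector beyond `k` is needed. -/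
theorem elemGL_mem_stabilizer (hq : 0 < q) {l : Fin D} (hl : k < l) {i j : Fin D} (hij : i ≠ j)
    (c : R) : elemGL hij c ∈ F.stabilizer R := by
  have h1 : ∀ {i j : Fin D} (hij : i ≠ j) (c : R), k < i → j ≤ k → elemGL hij c ∈ F.stabilizer R :=
    fun hij c hi hj g a n => F.val_mul_elemGL hq hj hi g c a n
  have h2 : ∀ {i j : Fin D} (hij : i ≠ j) (c : R), k < j → i < j →
      elemGL hij c ∈ F.stabilizer R := by
    intro i j hij c hj hi g a n
    have hu : ∀ (c : R) (i' j' : Fin D), j' < i' → elemGL hij c i' j' = 0 := by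
      intro c i' j' h
      rw [coe_elemGL, transvection, Matrix.add_apply, Matrix.one_apply_ne h.ne',
        Matrix.single_apply_of_ne, add_zero]
      rintro ⟨rfl, rfl⟩
      exact h.asymm hi
    refine F.val_change_eq hq hl g _ (hu c) (hu (-c)) 1 (fun i' j' h => ?_) a n
    rw [coe_elemGL, transvection, Matrix.add_apply, Matrix.single_apply_of_ne, add_zero,
      Matrix.one_apply]
    · simp
    · rintro ⟨rfl, rfl⟩
      exact h.not_gt hj
  have h3 : ∀ {i j n : Fin D} (hij : i ≠ j) (hin : i ≠ n) (hnj : n ≠ j) (c : R),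
      (∀ c, elemGL hin c ∈ F.stabilizer R) → (∀ c, elemGL hnj c ∈ F.stabilizer R) →
      elemGL hij c ∈ F.stabilizer R := by
    intro i j n hij hin hnj c h h'
    have : elemGL hij c = elemGL hin c * elemGL hnj 1 * (elemGL hin c)⁻¹ * (elemGL hnj 1)⁻¹ := by
      rw [elemGL_mul_elemGL hij hin hnj, mul_inv_cancel_right, mul_inv_cancel_right]
    rw [this]
    exact mul_mem (mul_mem (mul_mem (h _) (h' _)) (inv_mem (h _))) (inv_mem (h' _))
  rcases le_or_gt i k with hi | hi <;> rcases le_or_gt j k with hj | hj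
  · exact h3 hij (hi.trans_lt hl).ne (hj.trans_lt hl).ne' c (fun c => h2 _ c hl (hi.trans_lt hl))
      fun c => h1 _ c hl hj
  · exact h2 hij c hj (hi.trans_lt hj)
  · exact h1 hij c hi hj
  · exact h3 hij hi.ne' hj.ne c (fun c => h1 _ c hi le_rfl) fun c => h2 _ c hj hj

theorem diagGL_mem_stabilizer (hq : 0 < q) {l : Fin D} (hl : k < l) (t : Fin D → Rˣ) :
    diagGL t ∈ F.stabilizer R := fun g a i =>
  F.val_change_eq hq hl g _ (fun _ _ h => Matrix.diagonal_apply_ne _ h.ne')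
    (fun _ _ h => Matrix.diagonal_apply_ne (fun i => (((t i)⁻¹ : Rˣ) : R)) h.ne') t (fun i j _ => by
      rw [coe_diagGL, Matrix.diagonal_apply]
      rcases eq_or_ne i j with rfl | h
      · rfl
      · rw [if_neg h, if_neg h]) a i

/-- Over a local ring, the coordinates do not depend on the frame. -/
theorem val_eq_val_one [IsLocalRing R] (hq : 0 < q) {l : Fin D} (hl : k < l) (g : GL (Fin D) R)
    (a : Fin m → Fin k → R) (i : Fin D) : F.val g a i = F.val 1 a i := by
  have := mem_of_elemGL_of_diagGL (F.stabilizer R)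
    (fun i j h c => F.elemGL_mem_stabilizer hq hl h c) (F.diagGL_mem_stabilizer hq hl) g
  simpa using this 1 a i

end CoordFunction

/-! ### Additivity of the coordinates -/

namespace CoordFunction
open Matrix MvPolynomial
variable {A : Type u} [CommRing A] {q D m : ℕ} {k : Fin D} (F : CoordFunction A q k m)
  {R : Type u} [CommRing R] [Algebra A R]

/-- Adding `c` times the vector `i` of the frame to a later vector `j` does not change the flag. -/
theorem val_eq_add (hq : 0 < q) {l : Fin D} (hl : k < l) {i j : Fin D} (hij : i < j) (hj : j ≤ k)
    (g : GL (Fin D) R) (c : R) {a a' : Fin m → Fin k → R}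
    (h : ∀ n x, extendOne k (a n) x =
      extendOne k (a' n) x + if x = i then c * extendOne k (a' n) j else 0) :
    F.val g a i = F.val g a' i + c ^ q * F.val g a' j := by
  have he : ∀ (c : R) x y, elemGL hij.ne c x y =
      (1 : Matrix (Fin D) (Fin D) R) x y + if i = x ∧ j = y then c else 0 := fun c x y => by
    rw [coe_elemGL, transvection, Matrix.add_apply, Matrix.single_apply]
  have hu : ∀ (c : R) (x y : Fin D), y < x → elemGL hij.ne c x y = 0 := by
    intro c x y hxy
    rw [he, one_apply_ne hxy.ne', if_neg, add_zero]
    rintro ⟨rfl, rfl⟩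
    exact hxy.asymm hij
  have hkk : elemGL hij.ne c k k = 1 := by
    rw [he, one_apply_eq, if_neg, add_zero]
    rintro ⟨rfl, rfl⟩
    exact hij.false
  have := F.change g (elemGL hij.ne c) a a' (hu c) (hu (-c)) (fun n => ?_) i
  · rw [hkk, one_pow, one_mul] at this
    simp only [F.elemGL_mem_stabilizer hq hl hij.ne c g] at this
    rw [this, Finset.sum_eq_add_of_mem i j (Finset.mem_univ _) (Finset.mem_univ _) hij.ne]
    · rw [he, he, one_apply_eq, one_apply_ne hij.ne, if_neg (fun h => hij.ne' h.2), if_pos ⟨rfl, rfl⟩,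
        add_zero, zero_add, one_pow, one_mul]
    · rintro x - ⟨hx, hx'⟩
      rw [he, one_apply_ne hx.symm, if_neg (fun h => hx' h.2.symm), add_zero, zero_pow hq.ne',
        zero_mul]
  · rw [hkk, one_smul]
    ext x
    rw [h, mulVec, dotProduct]
    simp only [he, add_mul, Finset.sum_add_distrib, one_apply, ite_mul, one_mul, zero_mul,
      Finset.sum_ite_eq, Finset.mem_univ, if_true]
    congr 1
    rcases eq_or_ne x i with rfl | hx
    · simp
    · simp [hx, hx.symm]

/-- The coordinate with index `j` at the standard frame, as a function of the `j`-th coordinates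
of the splittings. -/
def column (j : Fin k) (x : Fin m → R) : R := F.val 1 (fun n _ => x n) (Fin.castLE k.2.le j)

section Column
variable (hq : 0 < q) {l : Fin D} (hl : k < l)
include hq hl

theorem val_one_eq_column (j : Fin k) (a : Fin m → Fin k → R) :
    F.val 1 a (Fin.castLE k.2.le j) = F.column j fun n => a n j :=
  F.val_congr hq hl 1 j fun _ => rfl

theorem column_smul (j : Fin k) (y : R) (x : Fin m → R) :
    F.column j (y • x) = y ^ q * F.column j x :=
  F.val_homogeneous hq hl 1 j y fun _ => rfl

theorem column_zero (j : Fin k) : F.column j (0 : Fin m → R) = 0 := by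
  have := F.column_smul hq hl j (0 : R) 0
  rwa [zero_smul, zero_pow hq.ne', zero_mul] at this

/-- Adding `c` times the vector `j` to the vector `k` of the frame translates the `j`-th coordinates
of all splittings by `c`. -/
theorem column_add_const (j : Fin k) (x : Fin m → R) (c : R) :
    F.column j (fun n => x n + c) = F.column j x + c ^ q * F.val 1 0 k := by
  have hj : Fin.castLE k.2.le j < k := j.2
  have h := F.val_eq_add hq hl hj le_rfl (1 : GL (Fin D) R) c
    (a := fun n j' => if j' = j then x n + c else x n) (a' := fun n _ => x n) fun n y => ?_
  · rw [F.val_self hq hl 1 _ 0] at h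
    rw [column, column, ← h]
    exact F.val_congr hq hl 1 j fun n => by simp
  · rw [extendOne_self, mul_one]
    rcases lt_trichotomy y k with hy | rfl | hy
    · rw [extendOne_lt _ hy, extendOne_lt _ hy]
      have : (⟨y, hy⟩ : Fin k) = j ↔ y = Fin.castLE k.2.le j := by simp [Fin.ext_iff]
      simp only [this]
      split_ifs <;> simp
    · rw [extendOne_self, extendOne_self, if_neg hj.ne', add_zero]
    · rw [extendOne_gt _ hy, extendOne_gt _ hy, if_neg (hj.trans hy).ne', add_zero]

/-- The identity comes from adding the vector `i` of the frame to the vector `j`. -/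
theorem column_add {i j : Fin k} (hij : i < j) (x y : Fin m → R) :
    F.column i (x + y) = F.column i x + F.column j y := by
  have hi : Fin.castLE k.2.le i < Fin.castLE k.2.le j := hij
  have hj : Fin.castLE k.2.le j < k := j.2
  have h := F.val_eq_add hq hl hi hj.le (1 : GL (Fin D) R) 1
    (a := fun n j' => if j' = i then x n + y n else y n)
    (a' := fun n j' => if j' = i then x n else y n) fun n z => ?_
  · rw [F.val_one_eq_column hq hl, F.val_one_eq_column hq hl, F.val_one_eq_column hq hl, one_pow,
      one_mul] at h
    simp only [if_pos, if_neg hij.ne'] at h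
    exact h
  · rw [extendOne_castLE, one_mul, if_neg hij.ne']
    rcases lt_trichotomy z k with hz | rfl | hz
    · rw [extendOne_lt _ hz, extendOne_lt _ hz]
      have : (⟨z, hz⟩ : Fin k) = i ↔ z = Fin.castLE k.2.le i := by simp [Fin.ext_iff]
      simp only [this]
      split_ifs <;> simp
    · rw [extendOne_self, extendOne_self, if_neg (hi.trans hj).ne', add_zero]
    · rw [extendOne_gt _ hz, extendOne_gt _ hz, if_neg (hi.trans (hj.trans hz)).ne', add_zero]

theorem column_eq {i j : Fin k} (hij : i < j) (x : Fin m → R) : F.column i x = F.column j x := by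
  have := F.column_add hq hl hij 0 x
  rwa [zero_add, F.column_zero hq hl, zero_add] at this

/-- All columns are the same function by `column_eq`, so that `column_add` is additivity as soon as
there are two of them. -/
theorem column_additive (hk : 2 ≤ (k : ℕ)) (x y : Fin m → R) :
    F.column ⟨0, by omega⟩ (x + y) = F.column ⟨0, by omega⟩ x + F.column ⟨0, by omega⟩ y := by
  have h01 : (⟨0, by omega⟩ : Fin k) < ⟨1, by omega⟩ := by simp [Fin.lt_def]
  rw [F.column_add hq hl h01, F.column_eq hq hl h01 y]

/-- Without Frobenius twist, the coordinates are linear because they are homogeneous of degree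
one. -/
theorem column_additive_of_one (hq1 : q = 1) (j : Fin k) (x y : Fin m → R) :
    F.column j (x + y) = F.column j x + F.column j y := by
  have key : ∀ μ : Fin m × Fin k →₀ ℕ,
      (F.universal (1 : GL (Fin D) R) (Fin.castLE k.2.le j)).coeff μ ≠ 0 →
      ∃ n : Fin m, ∀ z : Fin m → R, ∏ s : Fin m × Fin k, z s.1 ^ μ s = z n := by
    intro μ hμ
    obtain ⟨h0, h1⟩ := F.coeff_universal hq hl 1 j hμ
    obtain ⟨s, -, hs⟩ := Finset.exists_ne_zero_of_sum_ne_zero (h1.trans_ne hq.ne')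
    have hsj : s.2 = j := by by_contra hc; exact hs (if_neg hc)
    rw [if_pos hsj] at hs
    rw [← Finset.add_sum_erase _ _ (Finset.mem_univ s), if_pos hsj, hq1] at h1
    have hs1 : μ s = 1 := by omega
    have h2 : ∀ t ≠ s, μ t = 0 := by
      intro t ht
      by_cases htj : t.2 = j
      · have h3 := Finset.sum_eq_zero_iff.1 (show ∑ x ∈ Finset.univ.erase s,
          (if x.2 = j then μ x else 0) = 0 by omega) t
          (Finset.mem_erase.2 ⟨ht, Finset.mem_univ t⟩)
        rwa [if_pos htj] at h3
      · exact h0 t htj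
    refine ⟨s.1, fun z => ?_⟩
    rw [Finset.prod_eq_single s (fun t _ ht => by rw [h2 t ht, pow_zero]) (by simp), hs1, pow_one]
  have h : ∀ z : Fin m → R, F.column j z =
      ∑ μ ∈ (F.universal (1 : GL (Fin D) R) (Fin.castLE k.2.le j)).support,
        (F.universal (1 : GL (Fin D) R) (Fin.castLE k.2.le j)).coeff μ *
          ∏ s : Fin m × Fin k, z s.1 ^ μ s := by
    intro z
    rw [column, ← F.aeval_universal, aeval_def, eval₂_eq']
    rfl
  rw [h, h, h, ← Finset.sum_add_distrib]
  refine Finset.sum_congr rfl fun μ hμ => ?_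
  obtain ⟨n, hn⟩ := key μ (mem_support_iff.1 hμ)
  rw [hn, hn, hn, ← mul_add]; rfl

/-- An additive function which is homogeneous of degree `q` is a combination of `q`-th powers. -/
theorem column_eq_sum (j : Fin k)
    (hadd : ∀ x y : Fin m → R, F.column j (x + y) = F.column j x + F.column j y) (x : Fin m → R) :
    F.column j x = ∑ n, F.column j (Pi.single n 1) * x n ^ q := by
  let f : (Fin m → R) →+ R := ⟨⟨F.column j, F.column_zero hq hl j⟩, hadd⟩
  have h : f x = ∑ n, f (x n • Pi.single n 1) := by
    rw [← map_sum]
    congr 1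
    ext n
    simp [Finset.sum_apply, Pi.single_apply]
  refine h.trans (Finset.sum_congr rfl fun n _ => ?_)
  exact (F.column_smul hq hl j _ _).trans (mul_comm _ _)

end Column

theorem column_map (j : Fin k) (x : Fin m → A) :
    algebraMap A R (F.column j x) = F.column j fun n => algebraMap A R (x n) := by
  have := F.map (Algebra.ofId A R) 1 (fun n _ => x n) (Fin.castLE k.2.le j)
  rw [map_one] at this
  exact this.symm

theorem val_one_map : algebraMap A R (F.val 1 0 k) = F.val 1 0 k := by
  have := F.map (Algebra.ofId A R) 1 0 k
  rw [map_one] at this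
  refine this.symm.trans ?_
  congr 1
  ext n j
  exact map_zero _

theorem column_single_map (j : Fin k) (n : Fin m) :
    algebraMap A R (F.column j (Pi.single n 1)) = F.column j (Pi.single n 1) := by
  rw [column_map]
  congr 1
  ext n'
  rcases eq_or_ne n' n with rfl | h
  · simp
  · simp [h]

/-- The coordinates at the standard frame are additive polynomials: combinations of the `q`-th
powers of the coordinates of the splittings. -/
theorem exists_column_eq (hq : 0 < q) {l : Fin D} (hl : k < l) (hk : 0 < (k : ℕ)) (hm : 1 ≤ m)
    (hkm : 2 ≤ (k : ℕ) ∨ m ≤ 2 ∨ q = 1)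
    (hpow : ∀ (R : Type u) [CommRing R] [Algebra A R] (x y : R), (x + y) ^ q = x ^ q + y ^ q) :
    ∃ α : Fin m → A, ∀ (R : Type u) [CommRing R] [Algebra A R] (x : Fin m → R),
      F.column ⟨0, hk⟩ x = ∑ n, algebraMap A R (α n) * x n ^ q := by
  have hsum : (∀ (R : Type u) [CommRing R] [Algebra A R] (x y : Fin m → R),
      F.column ⟨0, hk⟩ (x + y) = F.column ⟨0, hk⟩ x + F.column ⟨0, hk⟩ y) →
      ∃ α : Fin m → A, ∀ (R : Type u) [CommRing R] [Algebra A R] (x : Fin m → R),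
      F.column ⟨0, hk⟩ x = ∑ n, algebraMap A R (α n) * x n ^ q := by
    intro hadd
    refine ⟨fun n => F.column ⟨0, hk⟩ (Pi.single n 1), fun R _ _ x => ?_⟩
    simp only [F.column_single_map]
    exact F.column_eq_sum hq hl _ (hadd R) x
  rcases hkm with h | h | h
  · exact hsum fun R _ _ x y => F.column_additive hq hl h x y
  · rcases (show m = 1 ∨ m = 2 by omega) with rfl | rfl
    · -- a single splitting: homogeneity suffices
      refine ⟨fun n => F.column ⟨0, hk⟩ (Pi.single n 1), fun R _ _ x => ?_⟩
      rw [Fin.sum_univ_one, F.column_single_map, mul_comm, ← F.column_smul hq hl]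
      congr 1
      ext n
      rw [Subsingleton.elim n 0]
      simp
    · -- translate the second splitting to the origin
      refine ⟨![F.column ⟨0, hk⟩ (Pi.single 0 1),
        F.val 1 0 k - F.column ⟨0, hk⟩ (Pi.single 0 1)], fun R _ _ x => ?_⟩
      rw [Fin.sum_univ_two]
      simp only [Matrix.cons_val_zero, Matrix.cons_val_one, map_sub, F.column_single_map,
        F.val_one_map]
      have h1 := F.column_add_const hq hl ⟨0, hk⟩ ((x 0 - x 1) • Pi.single 0 1) (x 1)
      have h2 : (fun n => ((x 0 - x 1) • Pi.single (M := fun _ => R) (0 : Fin 2) (1 : R)) n + x 1) =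
          x := by
        ext n
        fin_cases n <;> simp
      rw [h2, F.column_smul hq hl] at h1
      have h3 := hpow R (x 0 - x 1) (x 1)
      rw [sub_add_cancel] at h3
      rw [h1, h3]
      ring
  · exact hsum fun R _ _ x y => F.column_additive_of_one hq hl h _ x y

/-- The coordinates over local rings are combinations of the `q`-th powers of the coordinates of the
splittings, with the same coefficients for all indices and all local rings. -/
theorem exists_val_eq (hq : 0 < q) {l : Fin D} (hl : k < l) (hk : 0 < (k : ℕ)) (hm : 1 ≤ m)
    (hkm : 2 ≤ (k : ℕ) ∨ m ≤ 2 ∨ q = 1)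
    (hpow : ∀ (R : Type u) [CommRing R] [Algebra A R] (x y : R), (x + y) ^ q = x ^ q + y ^ q) :
    ∃ α : Fin m → A, ∀ (R : Type u) [CommRing R] [Algebra A R] [IsLocalRing R] (g : GL (Fin D) R)
      (a : Fin m → Fin k → R) (i : Fin D),
      F.val g a i = ∑ n, algebraMap A R (α n) * extendOne k (a n) i ^ q := by
  obtain ⟨α, h⟩ := F.exists_column_eq hq hl hk hm hkm hpow
  refine ⟨α, fun R _ _ _ g a i => ?_⟩
  rw [F.val_eq_val_one hq hl]
  rcases lt_trichotomy i k with hi | rfl | hi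
  · simp only [extendOne_lt _ hi]
    obtain ⟨j, rfl⟩ : ∃ j : Fin k, Fin.castLE k.2.le j = i := ⟨⟨i, hi⟩, rfl⟩
    rw [F.val_one_eq_column hq hl]
    have hj : F.column ⟨0, hk⟩ (fun n => a n j) = F.column j fun n => a n j := by
      rcases eq_or_lt_of_le (show (⟨0, hk⟩ : Fin k) ≤ j from Nat.zero_le _) with rfl | h0
      · rfl
      · exact F.column_eq hq hl h0 _
    rw [← hj, h]
    rfl
  · -- translating the zero splittings by `1` shows that the coordinate with index `k` is `∑ n, α n`
    have h1 := F.column_add_const hq hl ⟨0, hk⟩ (0 : Fin m → R) 1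
    rw [F.column_zero hq hl, one_pow, one_mul, zero_add, h] at h1
    rw [F.val_self hq hl _ a 0, ← h1]
    simp [extendOne_self]
  · rw [F.zero _ _ _ hi]
    simp [extendOne_gt _ hi, hq.ne']

end CoordFunction

/-- A function of frames and splittings which is compatible with base change and only depends on
the flag and the sections is, over local rings, a fixed combination of the `q`-th powers of the
sections. -/
theorem PointFunction.exists_val_eq {A : Type u} [CommRing A] {p : ℕ} [Fact p.Prime] {r D m : ℕ}
    {k : Fin D} (Φ : PointFunction A (p ^ r) k m) (hA : (p : A) = 0) {l : Fin D} (hl : k < l)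
    (hk : 0 < (k : ℕ)) (hm : 1 ≤ m) (hkm : 2 ≤ (k : ℕ) ∨ m ≤ 2 ∨ r = 0) :
    ∃ α : Fin m → A, ∀ (R : Type u) [CommRing R] [Algebra A R] [IsLocalRing R] (g : GL (Fin D) R)
      (a : Fin m → Fin k → R) (i : Fin D), Φ.val g a i =
        ∑ n, algebraMap A R (α n) * (∑ j, g i j * extendOne k (a n) j) ^ p ^ r := by
  obtain ⟨α, h⟩ := (Φ.coord hA).exists_val_eq (pow_pos (Fact.out : p.Prime).pos r) hl hk hm
    (hkm.imp_right (Or.imp_right fun h => by rw [h, pow_zero])) fun R _ _ x y =>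
      map_add (powHom p r (natCast_eq_zero_of_algebra (B := R) hA)) x y
  refine ⟨α, fun R _ _ _ g a i => ?_⟩
  have hR : (p : R) = 0 := natCast_eq_zero_of_algebra hA
  simp only [Φ.val_eq_sum hA, h, ← powHom_apply hR, map_sum, map_mul, Finset.sum_mul,
    Finset.mul_sum]
  rw [Finset.sum_comm]
  exact Finset.sum_congr rfl fun _ _ => Finset.sum_congr rfl fun _ _ => by ring

/-! ### Coordinates in a frame -/

section FrameCoordinates
variable {X : Scheme.{u}} {ι : Type} [Fintype ι] {M : X.Modules} {U : X.Opens} {e : ι → Γ(M, U)}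

theorem IsFrame.exists_eq_sum (he : IsFrame M e) (z : Γ(M, U)) :
    ∃ c : ι → Γ(X, U), z = ∑ i, c i • e i := by
  obtain ⟨c, hc⟩ := (he U le_rfl).2 z
  exact ⟨c, hc.symm.trans (Finset.sum_congr rfl fun i _ => by rw [res_self])⟩

theorem IsFrame.eq_of_sum_eq (he : IsFrame M e) {c c' : ι → Γ(X, U)}
    (h : ∑ i, c i • e i = ∑ i, c' i • e i) : c = c' := by
  refine (he U le_rfl).1 ?_
  simpa only [res_self] using h

end FrameCoordinates

/-! ### Values at the point given by a frame -/

section PointValues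
variable {T T' S Fl Sd : Scheme.{u}} {V : S.Modules} {D : ℕ} {F : Fl ⟶ S}
  {𝒱 : CompleteFlag ((Scheme.Modules.pullback F).obj V) D} {k : Fin D} {t : Sd ⟶ Fl}
  {σ : (Scheme.Modules.pullback t).obj (𝒱.gr k) ⟶
    (Scheme.Modules.pullback t).obj (𝒱.sub k.succ : Fl.Modules)} {m : ℕ}
  {φP : fiberPower t m ⟶ fiberPower t m} {W : (fiberPower t m).Opens}

variable (σ) in
/-- The section `v` of the twist of `t₀^* V` is the value of `s`, on the twist of the class of
`b_k`, at the point given by the frame `b` and the splittings `a`. -/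
def IsValue (s : TwistedHom 𝒱 k φP W) (t₀ : T ⟶ S) (φ : T ⟶ T)
    (b : Fin D → Γ((Scheme.Modules.pullback t₀).obj V, (⊤ : T.Opens)))
    (a : Fin m → Fin k → Γ(T, (⊤ : T.Opens)))
    (v : Γ((Scheme.Modules.pullback (φ ≫ t₀)).obj V, (⊤ : T.Opens))) : Prop :=
  ∃ (x : T ⟶ fiberPower t m) (hx : (⊤ : T.Opens) ≤ x ⁻¹ᵁ W) (f : T ⟶ Fl)
    (ex : x ≫ fiberPowerBase t m = f) (e : f ≫ F = t₀) (hφ : φ ≫ x = x ≫ φP)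
    (hp : IsPoint σ x ex e b a), v = valueOn s hx ex e hφ (hp.adapted.topSec k)

variable {s s' : TwistedHom 𝒱 k φP W} {t₀ : T ⟶ S} {φ : T ⟶ T}
  {b b' : Fin D → Γ((Scheme.Modules.pullback t₀).obj V, (⊤ : T.Opens))}
  {a a' : Fin m → Fin k → Γ(T, (⊤ : T.Opens))}
  {v v' : Γ((Scheme.Modules.pullback (φ ≫ t₀)).obj V, (⊤ : T.Opens))}

/-- Every frame and all splittings have a value of `s`, the value at the point which they determine.
-/
theorem exists_isValue (hF : IsFlagScheme V D F 𝒱) (hσ : IsSplittingScheme (𝒱.toGr k) t σ)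
    (s : TwistedHom 𝒱 k φP W) (hφ : ∀ x : T ⟶ fiberPower t m, φ ≫ x = x ≫ φP)
    (hW : ∀ x : T ⟶ fiberPower t m, (x ≫ fiberPowerBase t m) ≫ F = t₀ → (⊤ : T.Opens) ≤ x ⁻¹ᵁ W)
    (hb : IsFrame _ b) (a : Fin m → Fin k → Γ(T, (⊤ : T.Opens))) :
    ∃ v, IsValue σ s t₀ φ b a v := by
  obtain ⟨x, f, ex, e, hp⟩ := exists_isPoint hF hσ hb a
  exact ⟨_, x, hW x (by rw [ex, e]), f, ex, e, hφ x, hp, rfl⟩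

theorem IsValue.unique (hF : IsFlagScheme V D F 𝒱) (hσ : IsSplittingScheme (𝒱.toGr k) t σ)
    (h : IsValue σ s t₀ φ b a v) (h' : IsValue σ s t₀ φ b a v') : v = v' := by
  obtain ⟨x, hx, f, ex, e, hφ, hp, rfl⟩ := h
  obtain ⟨x', hx', f', ex', e', hφ', hp', rfl⟩ := h'
  obtain rfl := hp.unique hF hσ hp'
  obtain rfl := ex.symm.trans ex'
  rfl

theorem IsValue.add (hF : IsFlagScheme V D F 𝒱) (hσ : IsSplittingScheme (𝒱.toGr k) t σ)
    (h : IsValue σ s t₀ φ b a v) (h' : IsValue σ s' t₀ φ b a v') :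
    IsValue σ (s + s') t₀ φ b a (v + v') := by
  obtain ⟨x, hx, f, ex, e, hφ, hp, rfl⟩ := h
  obtain ⟨x', hx', f', ex', e', hφ', hp', rfl⟩ := h'
  obtain rfl := hp.unique hF hσ hp'
  obtain rfl := ex.symm.trans ex'
  exact ⟨x, hx, f, ex, e, hφ, hp, (valueOn_add s s' hx ex e hφ _).symm⟩

theorem Adapted.pullGr_topSec_change {f : T ⟶ Fl} {e : f ≫ F = t₀} (hb : Adapted 𝒱 f e b)
    (hb' : Adapted 𝒱 f e b') (H : Matrix (Fin D) (Fin D) Γ(T, (⊤ : T.Opens)))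
    (hu : ∀ i j, j < i → H i j = 0) (hH : ∀ j, b' j = ∑ i, H i j • b i) :
    ap (pullGr 𝒱 f k) (hb'.topSec k) = H k k • ap (pullGr 𝒱 f k) (hb.topSec k) := by
  obtain ⟨w, -, hk, hwb, -, h0⟩ := hb.exists_frame_gr k
  have hw : hb'.topSec k = H k k • w (Fin.last k) +
      ∑ j : Fin k, H (Fin.castLE k.2.le j) k • w j.castSucc := by
    apply hb.ap_injective k.succ
    rw [hb'.flagIncl_topSec, hH, ap_add, ap_smul, ap_sum_smul,
      sum_castLE (Nat.succ_le_of_lt k.2) _ fun l hl => by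
        rw [hu l k (Fin.lt_def.2 hl), zero_smul], Fin.sum_univ_castSucc, add_comm, hk]
    simp only [hwb, castLE_castSucc, castLE_last]
  rw [hw, ap_add, ap_smul, ap_sum_smul, hb.eq_topSec hk]
  simp only [h0, smul_zero, Finset.sum_const_zero, add_zero]

/-- The value only depends on the flag spanned by the frame and on the sections, up to the twist of
the factor by which the class of `b_k` changes. -/
theorem IsValue.change (h : IsValue σ s t₀ φ b a v)
    (H H' : Matrix (Fin D) (Fin D) Γ(T, (⊤ : T.Opens))) (hH : H * H' = 1)
    (hu : ∀ i j, j < i → H i j = 0) (hu' : ∀ i j, j < i → H' i j = 0)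
    (hb' : ∀ j, b' j = ∑ i, H i j • b i)
    (ha' : ∀ i, shifted k b' (a' i) = H k k • shifted k b (a i)) :
    IsValue σ s t₀ φ b' a' (pullTop φ (H k k) • v) := by
  obtain ⟨x, hx, f, ex, e, hφ, hp, rfl⟩ := h
  have hp' := hp.change H H' hH hu hu' hb' ha'
  exact ⟨x, hx, f, ex, e, hφ, hp', (valueOn_of_pullGr s hx ex e hφ _ _ _
    (hp.adapted.pullGr_topSec_change hp'.adapted H hu hb')).symm⟩

theorem IsValue.pullback (h : IsValue σ s t₀ φ b a v) (y : T' ⟶ T) {t' : T' ⟶ S}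
    (ht : y ≫ t₀ = t') {φ' : T' ⟶ T'} (hφ' : ∀ x : T' ⟶ fiberPower t m, φ' ≫ x = x ≫ φP)
    (hφφ : φ' ≫ y = y ≫ φ) (hy : y ≫ φ ≫ t₀ = φ' ≫ t')
    {b'' : Fin D → Γ((Scheme.Modules.pullback t').obj V, (⊤ : T'.Opens))}
    (hb'' : ∀ j, b'' j = pullAmb y ht V (b j)) :
    IsValue σ s t' φ' b'' (fun i j => pullTop y (a i j)) (pullAmb y hy V v) := by
  obtain ⟨x, hx, f, ex, e, hφ, hp, rfl⟩ := h
  have ex' : (y ≫ x) ≫ fiberPowerBase t m = y ≫ f := by rw [Category.assoc, ex]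
  have e' : (y ≫ f) ≫ F = t' := by rw [Category.assoc, e, ht]
  have hx' : (⊤ : T'.Opens) ≤ (y ≫ x) ⁻¹ᵁ W := fun z _ => hx (x := y z) trivial
  have hp' := hp.pullback y ex' e' rfl rfl ht hb''
  refine ⟨y ≫ x, hx', y ≫ f, ex', e', hφ' _, hp', ?_⟩
  rw [← valueOn_pullback s hx ex e hφ _ y hx' ex' e' (hφ' _) rfl rfl hφφ hy]
  congr 1
  refine hp'.adapted.eq_topSec ?_
  rw [hb'', flagIncl_pullAmb f e y rfl ht e', hp.adapted.flagIncl_topSec]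

/-- The value lies in the twist of `𝒱_{k+1}`, the span of the twists of the first `k + 1` members of
the frame. -/
theorem IsValue.exists_sum (h : IsValue σ s t₀ φ b a v) :
    ∃ c : Fin (k + 1) → Γ(T, (⊤ : T.Opens)),
      v = ∑ j, c j • pullAmb φ rfl V (b (Fin.castLE (Nat.succ_le_of_lt k.2) j)) := by
  obtain ⟨x, hx, f, ex, e, hφ, hp, rfl⟩ := h
  have had := hp.adapted.pullback φ rfl rfl (comp_comp_eq e φ) (fun _ => rfl)
  obtain ⟨w, hw, hwb⟩ := had.exists_frame k.succ
  rw [valueOn]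
  generalize ap (twHom hx rfl (comp_base_of_comm ex hφ) s) _ = z
  obtain ⟨c, rfl⟩ := hw.exists_eq_sum z
  refine ⟨c, ?_⟩
  rw [ap_sum_smul]
  exact Finset.sum_congr rfl fun j _ => congrArg (c j • ·) (hwb j)

/-- The value of the twist of the `i`-th tautological section is the twist of `b_k + ∑_{j < k} a_ij
b_j`. -/
theorem isValue_ofHom {i : Fin m} (h : IsValue σ (LocalHom.ofHom ((Scheme.Modules.pullback φP).map
      (pullbackHom (fiberPowerProj_comp t m i) σ)) W) t₀ φ b a v) :
    v = pullAmb φ rfl V (shifted k b (a i)) := by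
  obtain ⟨x, hx, f, ex, e, hφ, hp, rfl⟩ := h
  rw [valueOn_ofHom, hp.sec _ _ (hp.adapted.flagIncl_topSec k)]

end PointValues

/-! ### Sums of values -/

section ValueSums
variable {T T' S Fl Sd : Scheme.{u}} {V : S.Modules} {D : ℕ} {F : Fl ⟶ S}
  {𝒱 : CompleteFlag ((Scheme.Modules.pullback F).obj V) D} {k : Fin D} {t : Sd ⟶ Fl}
  {σ : (Scheme.Modules.pullback t).obj (𝒱.gr k) ⟶
    (Scheme.Modules.pullback t).obj (𝒱.sub k.succ : Fl.Modules)} {m : ℕ}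
  {φP : fiberPower t m ⟶ fiberPower t m} {W : (fiberPower t m).Opens}
  {t₀ : T ⟶ S} {φ : T ⟶ T}
  {b : Fin D → Γ((Scheme.Modules.pullback t₀).obj V, (⊤ : T.Opens))}
  {a : Fin m → Fin k → Γ(T, (⊤ : T.Opens))}
  {v : Γ((Scheme.Modules.pullback (φ ≫ t₀)).obj V, (⊤ : T.Opens))}

theorem IsValue.smul {s : TwistedHom 𝒱 k φP W} (h : IsValue σ s t₀ φ b a v)
    {c : Γ(fiberPower t m, W)} {c₀ : Γ(T, (⊤ : T.Opens))}
    (hc : ∀ (x : T ⟶ fiberPower t m) (hx : (⊤ : T.Opens) ≤ x ⁻¹ᵁ W),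
      (x ≫ fiberPowerBase t m) ≫ F = t₀ → pullFun x ⊤ hx c = c₀) :
    IsValue σ (c • s) t₀ φ b a (c₀ • v) := by
  obtain ⟨x, hx, f, ex, e, hφ, hp, rfl⟩ := h
  refine ⟨x, hx, f, ex, e, hφ, hp, ?_⟩
  rw [valueOn_smul, hc x hx (by rw [ex, e])]

theorem IsValue.add_sum (hF : IsFlagScheme V D F 𝒱) (hσ : IsSplittingScheme (𝒱.toGr k) t σ)
    {s : TwistedHom 𝒱 k φP W} (h : IsValue σ s t₀ φ b a v) {ι : Type} (J : Finset ι)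
    {s' : ι → TwistedHom 𝒱 k φP W}
    {v' : ι → Γ((Scheme.Modules.pullback (φ ≫ t₀)).obj V, (⊤ : T.Opens))}
    (h' : ∀ i, IsValue σ (s' i) t₀ φ b a (v' i)) :
    IsValue σ (s + ∑ i ∈ J, s' i) t₀ φ b a (v + ∑ i ∈ J, v' i) := by
  classical
  induction J using Finset.induction_on with
  | empty => simpa using h
  | insert i J hi ih =>
    rw [Finset.sum_insert hi, Finset.sum_insert hi, add_left_comm s, add_left_comm v]
    exact (h' i).add hF hσ ih

end ValueSums

/-! ### Frames given by matrices -/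

section MatrixFrames
open Matrix
variable {T T' S : Scheme.{u}} {M : T.Modules} {D : ℕ}

/-- The vectors with coordinates the columns of `G` with respect to `e`. -/
def frameOf (e : Fin D → Γ(M, (⊤ : T.Opens))) (G : Matrix (Fin D) (Fin D) Γ(T, (⊤ : T.Opens)))
    (j : Fin D) : Γ(M, (⊤ : T.Opens)) := ∑ i, G i j • e i

theorem isFrame_frameOf {e : Fin D → Γ(M, (⊤ : T.Opens))} (he : IsFrame M e)
    (G G' : Matrix (Fin D) (Fin D) Γ(T, (⊤ : T.Opens))) (h : G * G' = 1) :
    IsFrame M (frameOf e G) := he.matrix G G' h fun _ => rfl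

theorem sum_smul_frameOf (e : Fin D → Γ(M, (⊤ : T.Opens)))
    (G : Matrix (Fin D) (Fin D) Γ(T, (⊤ : T.Opens))) (c : Fin D → Γ(T, (⊤ : T.Opens))) :
    ∑ j, c j • frameOf e G j = ∑ i, (G *ᵥ c) i • e i := by
  simp only [frameOf, Finset.smul_sum, mulVec, dotProduct, Finset.sum_smul]
  rw [Finset.sum_comm]
  exact Finset.sum_congr rfl fun i _ => Finset.sum_congr rfl fun j _ => by
    rw [smul_smul, mul_comm]

theorem frameOf_mul (e : Fin D → Γ(M, (⊤ : T.Opens)))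
    (G H : Matrix (Fin D) (Fin D) Γ(T, (⊤ : T.Opens))) (j : Fin D) :
    frameOf e (G * H) j = ∑ i, H i j • frameOf e G i :=
  (sum_smul_frameOf e G fun i => H i j).symm

theorem shifted_eq_sum (k : Fin D) (b : Fin D → Γ(M, (⊤ : T.Opens)))
    (a : Fin k → Γ(T, (⊤ : T.Opens))) : shifted k b a = ∑ j, extendOne k a j • b j := by
  rw [sum_castLE (Nat.succ_le_of_lt k.2) _ fun l hl => by
    rw [extendOne_gt _ (Fin.lt_def.2 hl), zero_smul], Fin.sum_univ_castSucc, add_comm, shifted,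
    castLE_last, extendOne_self, one_smul]
  simp only [castLE_castSucc, extendOne_castLE]

theorem shifted_frameOf (k : Fin D) (e : Fin D → Γ(M, (⊤ : T.Opens)))
    (G : Matrix (Fin D) (Fin D) Γ(T, (⊤ : T.Opens))) (a : Fin k → Γ(T, (⊤ : T.Opens))) :
    shifted k (frameOf e G) a = ∑ i, (G *ᵥ extendOne k a) i • e i := by
  rw [shifted_eq_sum, sum_smul_frameOf]

theorem pullAmb_frameOf {V : S.Modules} (h : T' ⟶ T) {t : T ⟶ S} {t' : T' ⟶ S} (ht : h ≫ t = t')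
    (e : Fin D → Γ((Scheme.Modules.pullback t).obj V, (⊤ : T.Opens)))
    (G : Matrix (Fin D) (Fin D) Γ(T, (⊤ : T.Opens)))
    {e' : Fin D → Γ((Scheme.Modules.pullback t').obj V, (⊤ : T'.Opens))}
    (he' : ∀ i, e' i = pullAmb h ht V (e i)) (j : Fin D) :
    pullAmb h ht V (frameOf e G j) = frameOf e' (G.map (pullTop h)) j := by
  rw [frameOf, frameOf, pullAmb_sum_smul]
  simp only [he', Matrix.map_apply]

end MatrixFrames

/-! ### Coordinates of values -/

section ValueCoordinates
open Matrix
variable {T T' S Fl Sd : Scheme.{u}} {V : S.Modules} {D : ℕ} {F : Fl ⟶ S}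
  {𝒱 : CompleteFlag ((Scheme.Modules.pullback F).obj V) D} {k : Fin D} {t : Sd ⟶ Fl}
  {σ : (Scheme.Modules.pullback t).obj (𝒱.gr k) ⟶
    (Scheme.Modules.pullback t).obj (𝒱.sub k.succ : Fl.Modules)} {m : ℕ}
  {φP : fiberPower t m ⟶ fiberPower t m} {W : (fiberPower t m).Opens}

variable (σ) in
/-- The coordinates of the value of `s`, with respect to a frame `ê`, at the point given by the
frame with coordinates `G` with respect to `e` and the splittings `a`. -/
def IsCoord (s : TwistedHom 𝒱 k φP W) (t₀ : T ⟶ S) (φ : T ⟶ T)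
    (e : Fin D → Γ((Scheme.Modules.pullback t₀).obj V, (⊤ : T.Opens)))
    (ê : Fin D → Γ((Scheme.Modules.pullback (φ ≫ t₀)).obj V, (⊤ : T.Opens)))
    (G : Matrix (Fin D) (Fin D) Γ(T, (⊤ : T.Opens))) (a : Fin m → Fin k → Γ(T, (⊤ : T.Opens)))
    (c : Fin D → Γ(T, (⊤ : T.Opens))) : Prop :=
  IsValue σ s t₀ φ (frameOf e G) a (∑ i, c i • ê i)

variable {s : TwistedHom 𝒱 k φP W} {t₀ : T ⟶ S} {φ : T ⟶ T}
  {e : Fin D → Γ((Scheme.Modules.pullback t₀).obj V, (⊤ : T.Opens))}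
  {ê : Fin D → Γ((Scheme.Modules.pullback (φ ≫ t₀)).obj V, (⊤ : T.Opens))}
  {G : Matrix (Fin D) (Fin D) Γ(T, (⊤ : T.Opens))} {a : Fin m → Fin k → Γ(T, (⊤ : T.Opens))}
  {c c' : Fin D → Γ(T, (⊤ : T.Opens))}

theorem exists_isCoord (hF : IsFlagScheme V D F 𝒱) (hσ : IsSplittingScheme (𝒱.toGr k) t σ)
    (s : TwistedHom 𝒱 k φP W) (hφ : ∀ x : T ⟶ fiberPower t m, φ ≫ x = x ≫ φP)
    (hW : ∀ x : T ⟶ fiberPower t m, (x ≫ fiberPowerBase t m) ≫ F = t₀ → (⊤ : T.Opens) ≤ x ⁻¹ᵁ W)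
    (he : IsFrame _ e) (hê : IsFrame _ ê) (G G' : Matrix (Fin D) (Fin D) Γ(T, (⊤ : T.Opens)))
    (h : G * G' = 1) (a : Fin m → Fin k → Γ(T, (⊤ : T.Opens))) :
    ∃ c, IsCoord σ s t₀ φ e ê G a c := by
  obtain ⟨v, hv⟩ := exists_isValue hF hσ s hφ hW (isFrame_frameOf he G G' h) a
  obtain ⟨c, rfl⟩ := hê.exists_eq_sum v
  exact ⟨c, hv⟩

theorem IsCoord.unique (hF : IsFlagScheme V D F 𝒱) (hσ : IsSplittingScheme (𝒱.toGr k) t σ)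
    (hê : IsFrame _ ê) (h : IsCoord σ s t₀ φ e ê G a c) (h' : IsCoord σ s t₀ φ e ê G a c') :
    c = c' := hê.eq_of_sum_eq (IsValue.unique hF hσ h h')

theorem IsCoord.change (h : IsCoord σ s t₀ φ e ê G a c)
    (H H' : Matrix (Fin D) (Fin D) Γ(T, (⊤ : T.Opens))) (hH : H * H' = 1)
    (hu : ∀ i j, j < i → H i j = 0) (hu' : ∀ i j, j < i → H' i j = 0)
    {a' : Fin m → Fin k → Γ(T, (⊤ : T.Opens))}
    (ha' : ∀ n, H *ᵥ extendOne k (a' n) = H k k • extendOne k (a n)) :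
    IsCoord σ s t₀ φ e ê (G * H) a' (pullTop φ (H k k) • c) := by
  have := IsValue.change h H H' hH hu hu' (frameOf_mul e G H) (a' := a') fun n => by
    rw [shifted_frameOf, shifted_frameOf, ← mulVec_mulVec, ha', mulVec_smul, Finset.smul_sum]
    simp only [Pi.smul_apply, smul_smul, smul_eq_mul]
  rw [Finset.smul_sum] at this
  simpa only [IsCoord, Pi.smul_apply, smul_eq_mul, smul_smul] using this

theorem IsCoord.pullback (h : IsCoord σ s t₀ φ e ê G a c) (hê : ∀ i, ê i = pullAmb φ rfl V (e i))
    (y : T' ⟶ T) {t' : T' ⟶ S} (ht : y ≫ t₀ = t') {φ' : T' ⟶ T'}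
    (hφ' : ∀ x : T' ⟶ fiberPower t m, φ' ≫ x = x ≫ φP) (hφφ : φ' ≫ y = y ≫ φ)
    {e' : Fin D → Γ((Scheme.Modules.pullback t').obj V, (⊤ : T'.Opens))}
    (he' : ∀ i, e' i = pullAmb y ht V (e i))
    {ê' : Fin D → Γ((Scheme.Modules.pullback (φ' ≫ t')).obj V, (⊤ : T'.Opens))}
    (hê' : ∀ i, ê' i = pullAmb φ' rfl V (e' i)) :
    IsCoord σ s t' φ' e' ê' (G.map (pullTop y)) (fun i j => pullTop y (a i j))
      (fun i => pullTop y (c i)) := by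
  have hy : y ≫ φ ≫ t₀ = φ' ≫ t' := by rw [← Category.assoc, ← hφφ, Category.assoc, ht]
  have hz : (φ' ≫ y) ≫ t₀ = φ' ≫ t' := by rw [Category.assoc, ht]
  have := IsValue.pullback h y ht hφ' hφφ hy (b'' := frameOf e' (G.map (pullTop y)))
    fun j => (pullAmb_frameOf y ht e G he' j).symm
  rw [pullAmb_sum_smul] at this
  have hi : ∀ i, pullAmb y hy V (ê i) = ê' i := by
    intro i
    rw [hê, hê', he', pullAmb_pullAmb φ' y rfl ht hz rfl, pullAmb_pullAmb y φ hφφ.symm rfl hz hy]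
  simpa only [IsCoord, hi] using this

theorem IsCoord.exists_sum (h : IsCoord σ s t₀ φ e ê G a c)
    (hê : ∀ i, ê i = pullAmb φ rfl V (e i)) (hêf : IsFrame _ ê) :
    ∃ f : Fin D → Γ(T, (⊤ : T.Opens)), (∀ j, k < j → f j = 0) ∧
      ∀ i, c i = ∑ j, f j * pullTop φ (G i j) := by
  obtain ⟨f, hf⟩ := IsValue.exists_sum h
  let f' : Fin D → Γ(T, (⊤ : T.Opens)) := fun j =>
    if hj : (j : ℕ) < k + 1 then f ⟨j, hj⟩ else 0
  have h0 : ∀ j : Fin D, k < j → f' j = 0 := fun j hj =>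
    dif_neg (by rw [Fin.lt_def] at hj; omega)
  have h1 : ∑ i, c i • ê i = ∑ j, f' j • frameOf ê (G.map (pullTop φ)) j := by
    rw [hf, sum_castLE (Nat.succ_le_of_lt k.2) _ fun l hl => by
      rw [h0 l (Fin.lt_def.2 hl), zero_smul]]
    refine Finset.sum_congr rfl fun j _ => ?_
    rw [pullAmb_frameOf φ rfl e G hê]
    rw [show f' (Fin.castLE (Nat.succ_le_of_lt k.2) j) = f j from
      dif_pos (show ((Fin.castLE (Nat.succ_le_of_lt k.2) j : Fin D) : ℕ) < k + 1 from j.2)]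
  rw [sum_smul_frameOf] at h1
  refine ⟨f', h0, fun i => ?_⟩
  rw [hêf.eq_of_sum_eq h1]
  simp only [mulVec, dotProduct, Matrix.map_apply, mul_comm]

theorem isCoord_ofHom {n : Fin m} (hê : ∀ i, ê i = pullAmb φ rfl V (e i)) (hêf : IsFrame _ ê)
    (h : IsCoord σ (LocalHom.ofHom ((Scheme.Modules.pullback φP).map
      (pullbackHom (fiberPowerProj_comp t m n) σ)) W) t₀ φ e ê G a c) (i : Fin D) :
    c i = pullTop φ ((G *ᵥ extendOne k (a n)) i) := by
  have := isValue_ofHom h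
  rw [shifted_frameOf, pullAmb_sum_smul] at this
  simp only [← hê] at this
  exact congrFun (hêf.eq_of_sum_eq this) i

end ValueCoordinates

/-! ### Points with values in algebras -/

section AffinePoints
variable {S : Scheme.{u}} {U : S.Opens}

theorem pullAmb_pullSec {T T' : Scheme.{u}} (h : T' ⟶ T) {t : T ⟶ S} {t' : T' ⟶ S}
    (ht : h ≫ t = t') (V : S.Modules) (hU : (⊤ : T.Opens) ≤ t ⁻¹ᵁ U)
    (hU' : (⊤ : T'.Opens) ≤ t' ⁻¹ᵁ U) (z : Γ(V, U)) :
    pullAmb h ht V (pullSec t V ⊤ hU z) = pullSec t' V ⊤ hU' z := by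
  rw [pullAmb_eq, ap_eq, pullbackIso_pullSec ht V hU (le_preimage_top h ⊤) hU']

/-- The point of `S` with values in an algebra over the functions on an affine open subset. -/
def specTo (hU : IsAffineOpen U) (B : Type u) [CommRing B] [Algebra Γ(S, U) B] :
    Spec (.of B) ⟶ S :=
  Spec.map (CommRingCat.ofHom (algebraMap Γ(S, U) B)) ≫ hU.fromSpec

theorem le_specTo (hU : IsAffineOpen U) (B : Type u) [CommRing B] [Algebra Γ(S, U) B] :
    (⊤ : (Spec (.of B)).Opens) ≤ specTo hU B ⁻¹ᵁ U := by
  rw [specTo, Scheme.Hom.comp_preimage, hU.fromSpec_preimage_self]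
  exact le_rfl

/-- The global functions on an affine scheme. -/
def glob (B : Type u) [CommRing B] : B ≃+* Γ(Spec (.of B), (⊤ : (Spec (.of B)).Opens)) :=
  (Scheme.ΓSpecIso (.of B)).symm.commRingCatIsoToRingEquiv

theorem pullTop_glob {B C : Type u} [CommRing B] [CommRing C] (f : B →+* C) (b : B) :
    pullTop (Spec.map (CommRingCat.ofHom f)) (glob B b) = glob C (f b) := by
  rw [pullFun_eq]
  have h := congrArg (fun g => g.hom b) (Scheme.ΓSpecIso_inv_naturality (CommRingCat.ofHom f))
  exact (resFun_self _ _).trans h.symm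

theorem specMap_specTo (hU : IsAffineOpen U) {B C : Type u} [CommRing B] [CommRing C]
    [Algebra Γ(S, U) B] [Algebra Γ(S, U) C] (f : B →ₐ[Γ(S, U)] C) :
    Spec.map (CommRingCat.ofHom f.toRingHom) ≫ specTo hU B = specTo hU C := by
  rw [specTo, specTo, ← Category.assoc, ← Spec.map_comp, ← CommRingCat.ofHom_comp]
  congr 4
  exact f.comp_algebraMap

/-- Every morphism from an affine scheme to the affine open `U` comes from an algebra. -/
theorem specTo_eq (hU : IsAffineOpen U) {B : Type u} [CommRing B] (x : Spec (.of B) ⟶ S)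
    (hx : (⊤ : (Spec (.of B)).Opens) ≤ x ⁻¹ᵁ U) [Algebra Γ(S, U) B]
    (h : ∀ a, glob B (algebraMap Γ(S, U) B a) = pullFun x ⊤ hx a) : specTo hU B = x := by
  have h1 := IsAffineOpen.SpecMap_appLE_fromSpec x hU (isAffineOpen_top _) hx
  have h2 : CommRingCat.ofHom (algebraMap Γ(S, U) B) ≫ (Scheme.ΓSpecIso (.of B)).inv =
      x.appLE U ⊤ hx := by
    ext a
    exact h a
  rw [← h2, IsAffineOpen.fromSpec_top, Spec.map_comp, Category.assoc] at h1
  rw [Scheme.isoSpec_Spec_inv] at h1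
  exact (cancel_epi _).1 h1

theorem pullFun_specTo (hU : IsAffineOpen U) (B : Type u) [CommRing B] [Algebra Γ(S, U) B]
    (a : Γ(S, U)) : pullFun (specTo hU B) ⊤ (le_specTo hU B) a = glob B (algebraMap Γ(S, U) B a) := by
  have h : pullFun hU.fromSpec ⊤ hU.fromSpec_preimage_self.ge a = glob Γ(S, U) a := by
    rw [pullFun_eq, hU.fromSpec_app_self]
    simp only [resFun]
    rw [← ConcreteCategory.comp_apply, Category.assoc, ← Functor.map_comp]
    rw [show (eqToHom hU.fromSpec_preimage_self).op ≫ (homOfLE hU.fromSpec_preimage_self.ge).op =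
      𝟙 _ from Subsingleton.elim _ _, CategoryTheory.Functor.map_id, Category.comp_id]
    rfl
  rw [← pullTop_glob, ← h]
  simp only [pullFun]
  rw [← ConcreteCategory.comp_apply, Scheme.Hom.appLE_comp_appLE]
  rfl

end AffinePoints

/-! ### The point function of a section -/

section SectionPointFunction
open Matrix
variable {S Fl Sd : Scheme.{u}} {V : S.Modules} {D : ℕ} {F : Fl ⟶ S}
  {𝒱 : CompleteFlag ((Scheme.Modules.pullback F).obj V) D} {k : Fin D} {t : Sd ⟶ Fl}
  {σ : (Scheme.Modules.pullback t).obj (𝒱.gr k) ⟶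
    (Scheme.Modules.pullback t).obj (𝒱.sub k.succ : Fl.Modules)} {m : ℕ}
  {p : ℕ} [Fact p.Prime] {U : S.Opens} (hU : IsAffineOpen U) (hS : (p : Γ(S, ⊤)) = 0) (r : ℕ)

/-- The iterated Frobenius of an affine scheme over an affine open subset of `S`. -/
def specFrob (B : Type u) [CommRing B] [Algebra Γ(S, U) B] : Spec (.of B) ⟶ Spec (.of B) :=
  frobeniusIter p (Spec (.of B)) (natCast_eq_zero_of_hom (specTo hU B) hS) r

theorem pullTop_specFrob (B : Type u) [CommRing B] [Algebra Γ(S, U) B]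
    (a : Γ(Spec (.of B), (⊤ : (Spec (.of B)).Opens))) :
    pullTop (specFrob hU hS r B) a = a ^ p ^ r :=
  pullTop_frobeniusIter _ _ _ _

theorem specFrob_comp {B C : Type u} [CommRing B] [CommRing C] [Algebra Γ(S, U) B]
    [Algebra Γ(S, U) C] (y : Spec (.of C) ⟶ Spec (.of B)) :
    specFrob hU hS r C ≫ y = y ≫ specFrob hU hS r B :=
  frobeniusIter_naturality _ _ _ _ _

theorem specFrob_comp_eq {B : Type u} [CommRing B] [Algebra Γ(S, U) B] {X : Scheme.{u}}
    (hX : (p : Γ(X, ⊤)) = 0) (x : Spec (.of B) ⟶ X) :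
    specFrob hU hS r B ≫ x = x ≫ frobeniusIter p X hX r :=
  frobeniusIter_naturality _ _ _ _ _

variable (𝒱 k) in
/-- The twisted homomorphisms on the preimage of `U` in the fibered power. -/
abbrev SectionOver (t : Sd ⟶ Fl) (m : ℕ) (r : ℕ) (U : S.Opens) :=
  TwistedHom 𝒱 k (frobeniusIter p (fiberPower t m)
    (natCast_eq_zero_of_hom (fiberPowerBase t m ≫ F) hS) r) ((fiberPowerBase t m ≫ F) ⁻¹ᵁ U)

variable (E : Fin D → Γ(V, U))

/-- The frame of the pullback of `V` to an affine scheme given by the frame `E` over `U`. -/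
def specFrame (B : Type u) [CommRing B] [Algebra Γ(S, U) B] (i : Fin D) :
    Γ((Scheme.Modules.pullback (specTo hU B)).obj V, (⊤ : (Spec (.of B)).Opens)) :=
  pullSec (specTo hU B) V ⊤ (le_specTo hU B) (E i)

/-- The frame of the Frobenius twist given by `specFrame`. -/
def specFrameTwist (B : Type u) [CommRing B] [Algebra Γ(S, U) B] (i : Fin D) :
    Γ((Scheme.Modules.pullback (specFrob hU hS r B ≫ specTo hU B)).obj V,
      (⊤ : (Spec (.of B)).Opens)) :=
  pullAmb (specFrob hU hS r B) rfl V (specFrame hU E B i)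

theorem specFrameTwist_eq (B : Type u) [CommRing B] [Algebra Γ(S, U) B] (i : Fin D) :
    specFrameTwist hU hS r E B i = pullAmb (specFrob hU hS r B) rfl V (specFrame hU E B i) := rfl

theorem specFrame_map {B C : Type u} [CommRing B] [CommRing C] [Algebra Γ(S, U) B]
    [Algebra Γ(S, U) C] (f : B →ₐ[Γ(S, U)] C) (i : Fin D) :
    specFrame hU E C i = pullAmb (Spec.map (CommRingCat.ofHom f.toRingHom)) (specMap_specTo hU f) V
      (specFrame hU E B i) :=
  (pullAmb_pullSec _ (specMap_specTo hU f) V (le_specTo hU B) (le_specTo hU C) (E i)).symm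

variable {E}

theorem isFrame_specFrame (hE : IsFrame V E) (B : Type u) [CommRing B] [Algebra Γ(S, U) B] :
    IsFrame _ (specFrame hU E B) :=
  hE.pullSec (specTo hU B) (le_specTo hU B)

theorem isFrame_specFrameTwist (hE : IsFrame V E) (B : Type u) [CommRing B] [Algebra Γ(S, U) B] :
    IsFrame _ (specFrameTwist hU hS r E B) :=
  (isFrame_specFrame hU hE B).pullAmb _ rfl fun _ => rfl

variable (σ E) in
/-- The coordinates of the value of the section `s` over the algebra `B`, at the frame `g` and the
splittings `a`. -/
def HasCoord (s : SectionOver 𝒱 k hS t m r U) {B : Type u} [CommRing B] [Algebra Γ(S, U) B]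
    (g : Matrix (Fin D) (Fin D) B) (a : Fin m → Fin k → B) (c : Fin D → B) : Prop :=
  IsCoord σ s (specTo hU B) (specFrob hU hS r B) (specFrame hU E B) (specFrameTwist hU hS r E B)
    (g.map (glob B)) (fun n j => glob B (a n j)) (fun i => glob B (c i))

end SectionPointFunction

section SectionPointFunction
open Matrix
variable {S Fl Sd : Scheme.{u}} {V : S.Modules} {D : ℕ} {F : Fl ⟶ S}
  {𝒱 : CompleteFlag ((Scheme.Modules.pullback F).obj V) D} {k : Fin D} {t : Sd ⟶ Fl}
  {σ : (Scheme.Modules.pullback t).obj (𝒱.gr k) ⟶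
    (Scheme.Modules.pullback t).obj (𝒱.sub k.succ : Fl.Modules)} {m : ℕ}
  {p : ℕ} [Fact p.Prime] {U : S.Opens} {hU : IsAffineOpen U} {hS : (p : Γ(S, ⊤)) = 0} {r : ℕ}
  {E : Fin D → Γ(V, U)} {s : SectionOver 𝒱 k hS t m r U}
  {B C : Type u} [CommRing B] [Algebra Γ(S, U) B] [CommRing C] [Algebra Γ(S, U) C]
  {a : Fin m → Fin k → B} {c c' : Fin D → B}

theorem map_glob_mul {g g' : Matrix (Fin D) (Fin D) B} (h : g * g' = 1) :
    g.map (glob B) * g'.map (glob B) = 1 := by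
  rw [← Matrix.map_mul, h]
  exact Matrix.map_one _ (map_zero _) (map_one _)

theorem extendOne_map {B C : Type*} [CommRing B] [CommRing C] (f : B →+* C) (k : Fin D)
    (a : Fin k → B) (j : Fin D) : extendOne k (fun i => f (a i)) j = f (extendOne k a j) := by
  rw [extendOne, extendOne]
  split_ifs <;> simp

theorem map_mulVec_extendOne {B C : Type*} [CommRing B] [CommRing C] (f : B →+* C) (k : Fin D)
    (g : Matrix (Fin D) (Fin D) B) (a : Fin k → B) (i : Fin D) :
    (g.map f *ᵥ extendOne k fun j => f (a j)) i = f ((g *ᵥ extendOne k a) i) := by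
  simp only [mulVec, dotProduct, extendOne_map, Matrix.map_apply, map_sum, map_mul]

theorem exists_hasCoord (hF : IsFlagScheme V D F 𝒱) (hσ : IsSplittingScheme (𝒱.toGr k) t σ)
    (hE : IsFrame V E) (s : SectionOver 𝒱 k hS t m r U) (g : GL (Fin D) B)
    (a : Fin m → Fin k → B) : ∃ c, HasCoord σ hU hS r E s g a c := by
  obtain ⟨c, hc⟩ := exists_isCoord hF hσ s
    (fun x => specFrob_comp_eq hU hS r _ x)
    (fun x hx z _ => by
      have := le_specTo hU B (x := z) trivial
      rw [← hx] at this
      exact this)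
    (isFrame_specFrame hU hE B) (isFrame_specFrameTwist hU hS r hE B) (g.val.map (glob B))
    (g.inv.map (glob B)) (map_glob_mul g.val_inv) fun n j => glob B (a n j)
  refine ⟨fun i => (glob B).symm (c i), ?_⟩
  simpa only [HasCoord, RingEquiv.apply_symm_apply] using hc

theorem HasCoord.unique (hF : IsFlagScheme V D F 𝒱) (hσ : IsSplittingScheme (𝒱.toGr k) t σ)
    (hE : IsFrame V E) {g : Matrix (Fin D) (Fin D) B} (h : HasCoord σ hU hS r E s g a c)
    (h' : HasCoord σ hU hS r E s g a c') : c = c' :=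
  funext fun i => (glob B).injective
    (congrFun (IsCoord.unique hF hσ (isFrame_specFrameTwist hU hS r hE B) h h') i)

theorem HasCoord.change {g : Matrix (Fin D) (Fin D) B} (h : HasCoord σ hU hS r E s g a c)
    (H H' : Matrix (Fin D) (Fin D) B) (hH : H * H' = 1)
    (hu : ∀ i j, j < i → H i j = 0) (hu' : ∀ i j, j < i → H' i j = 0) {a' : Fin m → Fin k → B}
    (ha' : ∀ n, H *ᵥ extendOne k (a' n) = H k k • extendOne k (a n)) :
    HasCoord σ hU hS r E s (g * H) a' (H k k ^ p ^ r • c) := by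
  have := IsCoord.change h (H.map (glob B)) (H'.map (glob B)) (map_glob_mul hH)
    (fun i j hij => by rw [Matrix.map_apply, hu i j hij, map_zero])
    (fun i j hij => by rw [Matrix.map_apply, hu' i j hij, map_zero])
    (a' := fun n j => glob B (a' n j)) fun n => by
      ext i
      rw [show (H.map (glob B)) = H.map (glob B : B →+* _) from rfl,
        show (fun j => glob B (a' n j)) = fun j => (glob B : B →+* _) (a' n j) from rfl,
        map_mulVec_extendOne, ha']
      exact (map_mul (glob B) _ _).trans
        (congrArg (glob B (H k k) * ·)
          (extendOne_map (glob B : B →+* Γ(Spec (.of B), ⊤)) k (a n) i).symm)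
  rw [← Matrix.map_mul, pullTop_specFrob] at this
  refine (congrArg (IsCoord σ s _ _ _ _ _ _) (funext fun i => ?_)).mp this
  simp

theorem HasCoord.map {g : Matrix (Fin D) (Fin D) B} (h : HasCoord σ hU hS r E s g a c)
    (f : B →ₐ[Γ(S, U)] C) :
    HasCoord σ hU hS r E s (g.map f) (fun n j => f (a n j)) (fun i => f (c i)) := by
  have := IsCoord.pullback h (specFrameTwist_eq hU hS r E B)
    (Spec.map (CommRingCat.ofHom f.toRingHom)) (specMap_specTo hU f)
    (fun x => specFrob_comp_eq hU hS r _ x) (specFrob_comp hU hS r _)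
    (specFrame_map hU E f) (specFrameTwist_eq hU hS r E C)
  simp only [pullTop_glob, Matrix.map_map, Function.comp_def] at this
  simp only [HasCoord, Matrix.map_map, Function.comp_def]
  exact this

theorem HasCoord.exists_sum (hE : IsFrame V E) {g : Matrix (Fin D) (Fin D) B}
    (h : HasCoord σ hU hS r E s g a c) : ∃ f : Fin D → B, (∀ j, k < j → f j = 0) ∧
      ∀ i, c i = ∑ j, f j * g i j ^ p ^ r := by
  obtain ⟨f, h0, hf⟩ := IsCoord.exists_sum h (specFrameTwist_eq hU hS r E B)
    (isFrame_specFrameTwist hU hS r hE B)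
  refine ⟨fun j => (glob B).symm (f j), fun j hj => by simp only [h0 j hj, map_zero], fun i => ?_⟩
  apply (glob B).injective
  rw [hf, map_sum]
  simp only [pullTop_specFrob, Matrix.map_apply, map_mul, map_pow, RingEquiv.apply_symm_apply]

variable (𝒱 σ U hS r) in
/-- The twist of the pullback of `σ` along the `n`-th projection, over the preimage of `U`. -/
def twistedSection (n : Fin m) : SectionOver 𝒱 k hS t m r U :=
  LocalHom.ofHom ((Scheme.Modules.pullback (frobeniusIter p (fiberPower t m)
    (natCast_eq_zero_of_hom (fiberPowerBase t m ≫ F) hS) r)).map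
      (pullbackHom (fiberPowerProj_comp t m n) σ)) ((fiberPowerBase t m ≫ F) ⁻¹ᵁ U)

/-- The coordinates of the value of a twisted tautological section are the `q`-th powers of those of
the vector `v_k + ∑ a_nj v_j`. -/
theorem hasCoord_twistedSection (hE : IsFrame V E) {n : Fin m} {g : Matrix (Fin D) (Fin D) B}
    (h : HasCoord σ hU hS r E (twistedSection 𝒱 σ U hS r n) g a c) (i : Fin D) :
    c i = (∑ j, g i j * extendOne k (a n) j) ^ p ^ r := by
  rw [HasCoord, twistedSection] at h
  have := isCoord_ofHom (specFrameTwist_eq hU hS r E B) (isFrame_specFrameTwist hU hS r hE B) h i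
  apply (glob B).injective
  rw [this, pullTop_specFrob, map_pow]
  exact congrArg (· ^ p ^ r) (map_mulVec_extendOne (glob B : B →+* Γ(Spec (.of B), ⊤)) k g (a n) i)

/-- The coordinates of the value of a section at a point. -/
def sectionVal (hU : IsAffineOpen U) (hF : IsFlagScheme V D F 𝒱)
    (hσ : IsSplittingScheme (𝒱.toGr k) t σ) (hE : IsFrame V E) (s : SectionOver 𝒱 k hS t m r U)
    (g : GL (Fin D) B) (a : Fin m → Fin k → B) : Fin D → B :=
  (exists_hasCoord (hU := hU) hF hσ hE s g a).choose

theorem hasCoord_sectionVal (hF : IsFlagScheme V D F 𝒱)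
    (hσ : IsSplittingScheme (𝒱.toGr k) t σ) (hE : IsFrame V E) (s : SectionOver 𝒱 k hS t m r U)
    (g : GL (Fin D) B) (a : Fin m → Fin k → B) :
    HasCoord σ hU hS r E s g a (sectionVal hU hF hσ hE s g a) :=
  (exists_hasCoord (hU := hU) hF hσ hE s g a).choose_spec

theorem HasCoord.eq_sectionVal (hF : IsFlagScheme V D F 𝒱)
    (hσ : IsSplittingScheme (𝒱.toGr k) t σ) (hE : IsFrame V E) {g : GL (Fin D) B}
    {g' : Matrix (Fin D) (Fin D) B} (hg : g' = g) (h : HasCoord σ hU hS r E s g' a c) :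
    sectionVal hU hF hσ hE s g a = c :=
  (hasCoord_sectionVal hF hσ hE s g a).unique hF hσ hE (hg ▸ h)

/-- The values of a section of the sheaf of twisted homomorphisms at the points of the fibered power
with values in algebras. -/
def pointFunction (hU : IsAffineOpen U) (hF : IsFlagScheme V D F 𝒱)
    (hσ : IsSplittingScheme (𝒱.toGr k) t σ) (hE : IsFrame V E) (s : SectionOver 𝒱 k hS t m r U) :
    PointFunction Γ(S, U) (p ^ r) k m where
  val g a := sectionVal hU hF hσ hE s g a
  map f g a i := congrFun (((hasCoord_sectionVal hF hσ hE s g a).map f).eq_sectionVal hF hσ hE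
    (g := GeneralLinearGroup.map f.toRingHom g) rfl) i
  span g a := (hasCoord_sectionVal hF hσ hE s g a).exists_sum hE
  change g H a _ hu hu' ha i := congrFun (((hasCoord_sectionVal hF hσ hE s g a).change H.val H.inv
    H.val_inv hu hu' ha).eq_sectionVal hF hσ hE (g := g * H) rfl) i

end SectionPointFunction

/-! ### Direct summands over a local ring -/

section LocalRing

/-- Over a local ring, a free module of rank `k + 1` with a free direct summand `L` of rank `k` is
generated by `L` and one more element. -/
theorem exists_generator_of_retract {R L N : Type*} [CommRing R] [IsLocalRing R] [AddCommGroup L]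
    [Module R L] [AddCommGroup N] [Module R N] {k : ℕ} (bL : Module.Basis (Fin k) R L)
    (bN : Module.Basis (Fin (k + 1)) R N) (φ : L →ₗ[R] N) (ψ : N →ₗ[R] L) (h : ψ ∘ₗ φ = .id) :
    ∃ v : N, ∀ y : N, ∃ (x : L) (c : R), y = φ x + c • v := by
  have hL := Module.Free.of_basis bL
  have hN := Module.Free.of_basis bN
  have hfL := Module.Finite.of_basis bL
  have hfN := Module.Finite.of_basis bN
  have hψφ (x : L) : ψ (φ x) = x := LinearMap.congr_fun h x
  -- `N` is the direct sum of `L` and `ker ψ`, which is projective, hence free, of rank one.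
  let P : N →ₗ[R] LinearMap.ker ψ :=
    (LinearMap.id - φ ∘ₗ ψ).codRestrict _ fun y => by simp [hψφ]
  have hP (y : LinearMap.ker ψ) : P y = y := Subtype.ext (by simp [P])
  have hsurj : Function.Surjective P := fun y => ⟨y, hP y⟩
  have hfin : Module.Finite R (LinearMap.ker ψ) := Module.Finite.of_surjective P hsurj
  have hproj : Module.Projective R (LinearMap.ker ψ) :=
    Module.Projective.of_split (LinearMap.ker ψ).subtype P (LinearMap.ext hP)
  have hfree : Module.Free R (LinearMap.ker ψ) := Module.free_of_flat_of_isLocalRing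
  let e : N ≃ₗ[R] LinearMap.ker ψ × L :=
    { P.prod ψ with
      invFun := fun x => (x.1 : N) + φ x.2
      left_inv := fun y => by simp [P]
      right_inv := fun x => by
        refine Prod.ext (Subtype.ext ?_) ?_ <;> simp [P, hψφ] }
  have hrank : Module.finrank R (LinearMap.ker ψ) = 1 := by
    have h1 := e.finrank_eq
    rw [Module.finrank_prod, Module.finrank_eq_card_basis bL, Module.finrank_eq_card_basis bN,
      Fintype.card_fin, Fintype.card_fin] at h1
    omega
  obtain ⟨v, -, hv⟩ := (finrank_eq_one_iff' (K := R) (V := LinearMap.ker ψ)).1 hrank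
  refine ⟨v, fun y => ?_⟩
  obtain ⟨c, hc⟩ := hv (P y)
  refine ⟨ψ y, c, ?_⟩
  have h2 : c • (v : N) = y - φ (ψ y) := congrArg Subtype.val hc
  rw [h2]; abel

end LocalRing

/-! ### Sections over local schemes -/

section LocalSchemes
variable {X T S Fl Sd : Scheme.{u}}

/-- The sections over `U` have a frame over `U` as a basis. -/
def IsFrame.basis {ι : Type} [Fintype ι] {M : X.Modules} {U : X.Opens} {e : ι → Γ(M, U)}
    (he : IsFrame M e) : Module.Basis ι Γ(X, U) Γ(M, U) :=
  Module.Basis.ofEquivFun (LinearEquiv.ofBijective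
    (Fintype.linearCombination Γ(X, U) e) (by
      have := he U le_rfl
      simp only [res_self] at this
      exact this)).symm

theorem IsFrame.basis_apply {ι : Type} [Fintype ι] {M : X.Modules} {U : X.Opens} {e : ι → Γ(M, U)}
    (he : IsFrame M e) (i : ι) : he.basis i = e i := by
  classical
  rw [IsFrame.basis, Module.Basis.coe_ofEquivFun, LinearEquiv.symm_symm]
  exact (Fintype.linearCombination_apply_single Γ(X, U) e i 1).trans (one_smul _ _)

/-- As many spanning sections as the rank come from a frame by an invertible matrix. -/
theorem IsFrame.exists_matrix {n : ℕ} {M : X.Modules} {U : X.Opens} {e e' : Fin n → Γ(M, U)}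
    (he : IsFrame M e) (h : ∀ y : Γ(M, U), ∃ a : Fin n → Γ(X, U), y = ∑ i, a i • e' i) :
    ∃ H H' : Matrix (Fin n) (Fin n) Γ(X, U), H * H' = 1 ∧ ∀ j, e' j = ∑ i, H i j • e i := by
  choose H hH using fun j => he.exists_eq_sum (e' j)
  choose G hG using fun j => h (e j)
  refine ⟨(Matrix.of H).transpose, (Matrix.of G).transpose, ?_, hH⟩
  ext i j
  have h1 : ∑ i, ((Matrix.of H).transpose * (Matrix.of G).transpose) i j • e i =
      ∑ i, (1 : Matrix (Fin n) (Fin n) Γ(X, U)) i j • e i := by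
    simp only [Matrix.one_apply, ite_smul, one_smul, zero_smul, Finset.sum_ite_eq',
      Finset.mem_univ, if_true, Matrix.mul_apply, Matrix.transpose_apply, Matrix.of_apply,
      Finset.sum_smul]
    rw [Finset.sum_comm]
    conv_rhs => rw [hG j]
    refine Finset.sum_congr rfl fun l _ => ?_
    rw [hH l, Finset.smul_sum]
    exact Finset.sum_congr rfl fun i _ => by rw [smul_smul, mul_comm]
  exact congrFun (he.eq_of_sum_eq h1) i

/-- As many spanning sections as the rank form a frame. -/
theorem IsFrame.of_span {n : ℕ} {M : X.Modules} {U : X.Opens} {e e' : Fin n → Γ(M, U)}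
    (he : IsFrame M e) (h : ∀ y : Γ(M, U), ∃ a : Fin n → Γ(X, U), y = ∑ i, a i • e' i) :
    IsFrame M e' := by
  obtain ⟨H, H', hH, he'⟩ := he.exists_matrix h
  exact he.matrix H H' hH he'

/-- Epimorphisms are surjective on global sections if some point has no proper open neighbourhood.
-/
theorem exists_preimage_of_epi {M N : T.Modules} (q : M ⟶ N) [Epi q] (x : T)
    (hx : ∀ U : T.Opens, x ∈ U → U = ⊤) (y : Γ(N, (⊤ : T.Opens))) :
    ∃ z : Γ(M, (⊤ : T.Opens)), ap q z = y := by
  obtain ⟨U, hU, hxU, z, hz⟩ := exists_local_preimage q y (Opens.mem_top x)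
  obtain rfl := hx U hxU
  exact ⟨z, hz.trans (res_self _ _ _)⟩

/-- Taking global sections is exact if some point has no proper open neighbourhood. -/
theorem exists_preimage_of_cokernel {M N : T.Modules} (i : M ⟶ N) (x : T)
    (hx : ∀ U : T.Opens, x ∈ U → U = ⊤) (y : Γ(N, (⊤ : T.Opens)))
    (hy : ap (cokernel.π i) y = 0) : ∃ z : Γ(M, (⊤ : T.Opens)), ap i z = y := by
  let φ : freeModule T 1 ⟶ N := frameHom N fun _ => y
  have hφ : φ ≫ cokernel.π i = 0 := freeModule_hom_ext fun j => by
    rw [comp_app_apply, frameHom_freeSec]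
    exact hy
  have hex : (ShortComplex.mk i (cokernel.π i) (cokernel.condition i)).Exact :=
    ShortComplex.exact_cokernel i
  obtain ⟨A, π, _, α, hα⟩ := hex.exact_up_to_refinements φ hφ
  obtain ⟨z, hz⟩ := exists_preimage_of_epi π x hx (freeSec T 1 0)
  refine ⟨ap α z, ?_⟩
  have h1 : ap (π ≫ φ) z = ap (α ≫ i) z := by rw [hα]
  rw [ap_comp, ap_comp, hz, ap_eq φ, frameHom_freeSec] at h1
  exact h1.symm

end LocalSchemes

/-! ### Flags over local schemes -/

section AdaptedLocal
variable {X T S Fl : Scheme.{u}}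

/-- A morphism of modules on global sections, as a linear map. -/
def apLinear {M N : T.Modules} (φ : M ⟶ N) :
    Γ(M, (⊤ : T.Opens)) →ₗ[Γ(T, (⊤ : T.Opens))] Γ(N, (⊤ : T.Opens)) where
  toFun := ap φ
  map_add' := ap_add φ
  map_smul' := ap_smul φ

/-- If `Z ⟶ N ⟶ Q` is exact on global sections, a frame of `Z` and lifts of a frame of `Q` form a
frame of `N`, provided that the ranks fit. -/
theorem exists_frame_extending {Z N Q : T.Modules} (i : Z ⟶ N) (q : N ⟶ Q)
    (hq : ∀ y, ∃ n, ap q n = y) (hi : ∀ y, ap q y = 0 → ∃ z, ap i z = y) {k l D : ℕ}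
    (hD : k + l = D) (hk : k ≤ D) {z : Fin k → Γ(Z, (⊤ : T.Opens))} (hz : IsFrame Z z)
    {c : Fin l → Γ(Q, (⊤ : T.Opens))} (hc : IsFrame Q c) {e : Fin D → Γ(N, (⊤ : T.Opens))}
    (he : IsFrame N e) :
    ∃ b : Fin D → Γ(N, (⊤ : T.Opens)), IsFrame N b ∧ ∀ j, ap i (z j) = b (Fin.castLE hk j) := by
  subst hD
  choose c' hc' using fun j => hq (c j)
  refine ⟨Fin.append (fun j => ap i (z j)) c', he.of_span fun y => ?_, fun j => ?_⟩
  · obtain ⟨a, ha⟩ := hc.exists_eq_sum (ap q y)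
    obtain ⟨z₀, hz₀⟩ := hi (y - ∑ j, a j • c' j) (by
      have h1 : ap q (∑ j, a j • c' j) = ap q y := by
        rw [ap_sum_smul, ha]
        simp only [hc']
      have h2 := ap_add q (y - ∑ j, a j • c' j) (∑ j, a j • c' j)
      rw [sub_add_cancel, h1] at h2
      exact right_eq_add.1 h2)
    obtain ⟨d, rfl⟩ := hz.exists_eq_sum z₀
    refine ⟨Fin.append d a, ?_⟩
    rw [Fin.sum_univ_add]
    simp only [Fin.append_left, Fin.append_right]
    rw [← ap_sum_smul, hz₀, sub_add_cancel]
  · exact (Fin.append_left (fun j => ap i (z j)) c' j).symm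

theorem HasLocalFrames.exists_frame_top {M : T.Modules} {n : ℕ} (h : HasLocalFrames M n) (x : T)
    (hx : ∀ U : T.Opens, x ∈ U → U = ⊤) : ∃ e : Fin n → Γ(M, (⊤ : T.Opens)), IsFrame M e := by
  obtain ⟨U, hxU, e, he⟩ := h x
  obtain rfl := hx U hxU
  exact ⟨e, he⟩

variable {V : S.Modules} {D : ℕ} {F : Fl ⟶ S}
  {𝒱 : CompleteFlag ((Scheme.Modules.pullback F).obj V) D} {t : T ⟶ S}

/-- Over a local scheme, each single member of the flag has a frame which extends to a frame of the
pullback of `V`. -/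
theorem exists_frame_extending_flagIncl (hV : IsVectorBundle V D) (x : T)
    (hx : ∀ U : T.Opens, x ∈ U → U = ⊤) (f : T ⟶ Fl) (e : f ≫ F = t) (k : Fin (D + 1)) :
    ∃ (z : Fin k → Γ((Scheme.Modules.pullback f).obj (𝒱.sub k : Fl.Modules), (⊤ : T.Opens)))
      (b : Fin D → Γ((Scheme.Modules.pullback t).obj V, (⊤ : T.Opens))), IsFrame _ z ∧
      IsFrame _ b ∧ ∀ j, ap (flagIncl 𝒱 f e k) (z j) = b (Fin.castLE (Nat.lt_succ_iff.1 k.2) j) := by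
  have hk := Nat.lt_succ_iff.1 k.2
  obtain ⟨z, hz⟩ := ((𝒱.hasLocalFrames_sub k).pullback f).exists_frame_top x hx
  have hV' : HasLocalFrames V D := fun x => hV.exists_frame x
  obtain ⟨v, hv⟩ := (hV'.pullback t).exists_frame_top x hx
  have hQ : HasLocalFrames (cokernel (𝒱.sub k).arrow) (D - k) :=
    fun x => (𝒱.rank_quot k).exists_frame x
  obtain ⟨c, hc⟩ := (hQ.pullback f).exists_frame_top x hx
  obtain ⟨φ, hφ⟩ := comp_pullback_cokernel_π f (𝒱.sub k).arrow
  have he := hv.map_iso (pullbackIso e V).inv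
  have hepi : Epi ((Scheme.Modules.pullback f).map (cokernel.π (𝒱.sub k).arrow)) := by
    rw [← hφ]
    infer_instance
  obtain ⟨b, hb, hzb⟩ := exists_frame_extending ((Scheme.Modules.pullback f).map (𝒱.sub k).arrow)
    ((Scheme.Modules.pullback f).map (cokernel.π (𝒱.sub k).arrow))
    (exists_preimage_of_epi _ x hx) (fun y hy => exists_preimage_of_cokernel _ x hx y (by
      have h1 : ap φ.inv (ap φ.hom (ap (cokernel.π ((Scheme.Modules.pullback f).map
          (𝒱.sub k).arrow)) y)) = ap φ.inv 0 := by rw [← hy, ← hφ, ap_comp]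
      rw [ap_eq φ.inv, ap_eq φ.hom, iso_hom_inv_app] at h1
      exact h1.trans (map_zero (φ.inv.app ⊤).hom))) (Nat.add_sub_cancel' hk) hk hz hc he
  refine ⟨z, fun j => ap (pullbackIso e V).hom (b j), hz,
    hb.map_iso_of_eq (pullbackIso e V).hom (fun j => ap_eq _ _), fun j => ?_⟩
  rw [flagIncl, ap_comp, hzb]

/-- Over a local scheme, `𝒱_{k+1}` is generated by `𝒱_k` and one more section: the extension of a
frame of `𝒱_k` to the pullback of `V` makes `𝒱_k` a direct summand of `𝒱_{k+1}`. -/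
theorem exists_generator_sub [IsLocalRing Γ(T, (⊤ : T.Opens))] (hV : IsVectorBundle V D) (x : T)
    (hx : ∀ U : T.Opens, x ∈ U → U = ⊤) (f : T ⟶ Fl) (e : f ≫ F = t) (k : Fin D) :
    ∃ v : Γ((Scheme.Modules.pullback f).obj (𝒱.sub k.succ : Fl.Modules), (⊤ : T.Opens)), ∀ y,
      ∃ (y' : Γ((Scheme.Modules.pullback f).obj (𝒱.sub k.castSucc : Fl.Modules), (⊤ : T.Opens)))
        (c : Γ(T, (⊤ : T.Opens))),
        y = ap ((Scheme.Modules.pullback f).map (𝒱.incl k)) y' + c • v := by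
  obtain ⟨z, b, hz, hb, hzb⟩ := exists_frame_extending_flagIncl hV x hx f e k.castSucc (𝒱 := 𝒱)
  obtain ⟨w, hw⟩ := ((𝒱.hasLocalFrames_sub k.succ).pullback f).exists_frame_top x hx
  have hbz (j : Fin k) : hb.basis (Fin.castLE k.2.le j) = ap (flagIncl 𝒱 f e k.castSucc) (z j) :=
    (hb.basis_apply _).trans (hzb j).symm
  let ψ := (hb.basis.constr Γ(T, (⊤ : T.Opens)) (fun j : Fin D =>
    if h : (j : ℕ) < k then z ⟨j, h⟩ else 0)) ∘ₗ apLinear (flagIncl 𝒱 f e k.succ)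
  refine exists_generator_of_retract hz.basis hw.basis
    (apLinear ((Scheme.Modules.pullback f).map (𝒱.incl k))) ψ ?_
  refine hz.basis.ext fun j => ?_
  rw [hz.basis_apply]
  change hb.basis.constr Γ(T, (⊤ : T.Opens)) (fun j : Fin D =>
    if h : (j : ℕ) < k then z ⟨j, h⟩ else 0) (ap (flagIncl 𝒱 f e k.succ)
    (ap ((Scheme.Modules.pullback f).map (𝒱.incl k)) (z j))) = z j
  rw [← ap_comp, map_incl_flagIncl]
  have := hbz j
  rw [← this, Module.Basis.constr_basis]
  exact dif_pos j.2

/-- Over a local scheme, every flag is spanned by a frame. -/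
theorem exists_frame_adapted [IsLocalRing Γ(T, (⊤ : T.Opens))] (hV : IsVectorBundle V D) (x : T)
    (hx : ∀ U : T.Opens, x ∈ U → U = ⊤) (f : T ⟶ Fl) (e : f ≫ F = t) :
    ∃ b : Fin D → Γ((Scheme.Modules.pullback t).obj V, (⊤ : T.Opens)), Adapted 𝒱 f e b := by
  choose v hv using fun k => exists_generator_sub hV x hx f e k (𝒱 := 𝒱)
  let b : Fin D → Γ((Scheme.Modules.pullback t).obj V, (⊤ : T.Opens)) :=
    fun k => ap (flagIncl 𝒱 f e k.succ) (v k)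
  have key (k : Fin (D + 1)) : ∃ w : Fin k → Γ((Scheme.Modules.pullback f).obj
      (𝒱.sub k : Fl.Modules), (⊤ : T.Opens)), (∀ y, ∃ a : Fin k → Γ(T, (⊤ : T.Opens)),
        y = ∑ j, a j • w j) ∧
        ∀ j, ap (flagIncl 𝒱 f e k) (w j) = b (Fin.castLE (Nat.lt_succ_iff.1 k.2) j) := by
    induction k using Fin.induction with
    | zero =>
      obtain ⟨w, hw⟩ := ((𝒱.hasLocalFrames_sub 0).pullback f).exists_frame_top x hx
      exact ⟨w, hw.exists_eq_sum, fun j => j.elim0⟩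
    | succ k ih =>
      obtain ⟨w, hw, hwb⟩ := ih
      let w' : Fin (k + 1) → Γ((Scheme.Modules.pullback f).obj
          (𝒱.sub k.succ : Fl.Modules), (⊤ : T.Opens)) :=
        Fin.snoc (fun j : Fin k => ap ((Scheme.Modules.pullback f).map (𝒱.incl k)) (w j)) (v k)
      have hw'1 (j : Fin k) : w' j.castSucc =
        ap ((Scheme.Modules.pullback f).map (𝒱.incl k)) (w j) := Fin.snoc_castSucc ..
      have hw'2 : w' (Fin.last k) = v k := Fin.snoc_last ..
      refine ⟨w', fun y => ?_, fun j => ?_⟩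
      · obtain ⟨y', c, rfl⟩ := hv k y
        obtain ⟨a, rfl⟩ := hw y'
        let a' : Fin (k + 1) → Γ(T, (⊤ : T.Opens)) := Fin.snoc (fun j : Fin k => a j) c
        have ha1 (j : Fin k) : a' j.castSucc = a j := Fin.snoc_castSucc ..
        have ha2 : a' (Fin.last k) = c := Fin.snoc_last ..
        refine ⟨a', ?_⟩
        refine Eq.trans ?_ (Fin.sum_univ_castSucc (n := k) _).symm
        simp only [ha1, ha2, hw'1, hw'2]
        rw [ap_sum_smul]
        rfl
      · refine Fin.lastCases (n := k) ?_ (fun j => ?_) j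
        · rw [hw'2]
          rfl
        · rw [hw'1, ← ap_comp, map_incl_flagIncl]
          exact hwb j
  have hV' : HasLocalFrames V D := fun x => hV.exists_frame x
  obtain ⟨e₀, he₀⟩ := (hV'.pullback t).exists_frame_top x hx
  refine ⟨b, .mk (he₀.of_span fun y => ?_) fun k => ?_⟩
  · obtain ⟨w, hw, hwb⟩ := key (Fin.last D)
    obtain ⟨z, c, hz, hc, hzc⟩ := exists_frame_extending_flagIncl hV x hx f e (Fin.last D) (𝒱 := 𝒱)
    obtain ⟨a, rfl⟩ := hc.exists_eq_sum y
    obtain ⟨a', ha'⟩ := hw (∑ j, a j • z j)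
    refine ⟨a', ?_⟩
    have h1 := congrArg (ap (flagIncl 𝒱 f e (Fin.last D))) ha'
    rw [ap_sum_smul, ap_sum_smul] at h1
    simp only [hwb, hzc] at h1
    exact h1
  · obtain ⟨w, hw, hwb⟩ := key k
    obtain ⟨z, hz⟩ := ((𝒱.hasLocalFrames_sub k).pullback f).exists_frame_top x hx
    exact .intro (hz.of_span hw) hwb

end AdaptedLocal

/-! ### Vanishing of a section from its values -/

section Vanishing
variable {T S Fl Sd P : Scheme.{u}}

theorem ap_zero {M N : T.Modules} (φ : M ⟶ N) : ap φ 0 = 0 := map_zero _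

theorem resFun_eq_zero_of_germ {X : Scheme.{u}} {U : X.Opens} {y : X} (hy : y ∈ U) (c : Γ(X, U))
    (h : X.presheaf.germ U y hy c = 0) :
    ∃ (O : X.Opens) (hO : O ≤ U), y ∈ O ∧ resFun O hO c = 0 := by
  obtain ⟨O, hyO, i, j, hij⟩ := X.presheaf.germ_eq y hy hy c 0 (h.trans (map_zero _).symm)
  exact ⟨O, i.le, hyO, hij.trans (map_zero (X.presheaf.map j.op).hom)⟩

theorem germ_eq_zero_of_pullFun {X : Scheme.{u}} {U : X.Opens} {y : X} (hy : y ∈ U)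
    (h : ⊤ ≤ X.fromSpecStalk y ⁻¹ᵁ U) (c : Γ(X, U))
    (hc : pullFun (X.fromSpecStalk y) ⊤ h c = 0) : X.presheaf.germ U y hy c = 0 := by
  rw [pullFun_eq, Scheme.fromSpecStalk_app hy] at hc
  have h1 : (Scheme.ΓSpecIso (X.presheaf.stalk y)).inv (X.presheaf.germ U y hy c) = 0 := by
    refine Eq.trans ?_ hc
    refine Eq.trans (resFun_self (X := Spec (X.presheaf.stalk y)) le_rfl _).symm ?_
    exact (resFun_resFun (X := Spec (X.presheaf.stalk y)) le_top h _).symm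
  have h2 := congrArg (Scheme.ΓSpecIso (X.presheaf.stalk y)).hom.hom h1
  rw [map_zero] at h2
  refine Eq.trans ?_ h2
  exact (ConcreteCategory.congr_hom (Scheme.ΓSpecIso (X.presheaf.stalk y)).inv_hom_id _).symm

theorem le_preimage_fromSpecStalk {X : Scheme.{u}} {U : X.Opens} {y : X} (hy : y ∈ U) :
    ⊤ ≤ X.fromSpecStalk y ⁻¹ᵁ U := by
  have h : IsLocalRing.closedPoint (X.presheaf.stalk y) ∈ X.fromSpecStalk y ⁻¹ᵁ U := by
    change X.fromSpecStalk y _ ∈ U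
    rwa [Scheme.fromSpecStalk_closedPoint]
  exact ((IsLocalRing.closedPoint_mem_iff _).1 h).ge

/-- A section of a locally free module whose pullback to the local scheme at `y` vanishes is zero
near `y`. -/
theorem exists_res_eq_zero {N : P.Modules} {n : ℕ} (hN : HasLocalFrames N n) {O : P.Opens}
    {y : P} (hy : y ∈ O) (z : Γ(N, O))
    (hz : pullSec (P.fromSpecStalk y) N ⊤ (le_preimage_fromSpecStalk hy) z = 0) :
    ∃ (O' : P.Opens) (hO : O' ≤ O), y ∈ O' ∧ res N O' hO z = 0 := by
  obtain ⟨O₁, hy₁, e, he⟩ := hN y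
  let O₂ := O ⊓ O₁
  have hy₂ : y ∈ O₂ := ⟨hy, hy₁⟩
  have he₂ := he.res (inf_le_right : O₂ ≤ O₁)
  obtain ⟨c, hc⟩ := he₂.exists_eq_sum (res N O₂ inf_le_left z)
  have h2 := le_preimage_fromSpecStalk hy₂
  have h3 : pullSec (P.fromSpecStalk y) N ⊤ h2 (res N O₂ inf_le_left z) = 0 := by
    rw [pullSec_res, hz]
  rw [hc, pullSec_sum_smul] at h3
  have h4 := (he₂.pullSec (P.fromSpecStalk y) h2).eq_of_sum_eq (c' := fun _ => 0)
    (h3.trans (by simp))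
  choose O' hO' hyO' hcO' using fun i => resFun_eq_zero_of_germ hy₂ (c i)
    (germ_eq_zero_of_pullFun hy₂ h2 (c i) (congrFun h4 i))
  obtain ⟨Q, hyQ, hQ⟩ := exists_open_le_finite y O' hyO'
  refine ⟨Q ⊓ O₂, inf_le_right.trans inf_le_left, ⟨hyQ, hy₂⟩, ?_⟩
  rw [← res_res N inf_le_left inf_le_right z, hc, map_sum]
  refine Finset.sum_eq_zero fun i _ => ?_
  rw [res_smul, ← resFun_resFun (hO' i) (inf_le_left.trans (hQ i)) (c i), hcO', map_zero, zero_smul]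

/-- Homomorphisms into a locally free module are tested on the local schemes of all points. -/
theorem LocalHom.eq_zero_of_pullLocal {M N : P.Modules} {W : P.Opens} {n : ℕ}
    (hN : HasLocalFrames N n) (s : LocalHom M N W)
    (h : ∀ (y : P) (hy : y ∈ W), pullLocal (P.fromSpecStalk y) (le_preimage_fromSpecStalk hy) s = 0) :
    s = 0 := by
  refine LocalHom.ext ?_
  funext O hO
  refine LinearMap.ext fun z => ?_
  refine section_ext fun y hy => ?_
  obtain ⟨O', hO', hyO', h0⟩ := exists_res_eq_zero hN hy (s.app O hO z) (by
    rw [← pullLocal_pullSec (P.fromSpecStalk y) (le_preimage_fromSpecStalk (hO hy)) s hO, h y (hO hy)]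
    rfl)
  exact ⟨O', hO', hyO', h0.trans (map_zero (res N O' hO')).symm⟩

variable {V : S.Modules} {D : ℕ} {F : Fl ⟶ S}
  {𝒱 : CompleteFlag ((Scheme.Modules.pullback F).obj V) D} {k : Fin D} {t : Sd ⟶ Fl}
  {σ : (Scheme.Modules.pullback t).obj (𝒱.gr k) ⟶
    (Scheme.Modules.pullback t).obj (𝒱.sub k.succ : Fl.Modules)} {m : ℕ}
  {φP : fiberPower t m ⟶ fiberPower t m} {W : (fiberPower t m).Opens}

/-- Every point of the fibered power over a flag with an adapted frame is given by splittings: a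
section maps the class of `b_k` to a combination of `b_0, …, b_k` in which `b_k` has the coefficient
`1`. -/
theorem exists_isPoint_of_adapted (hσ : σ ≫ (Scheme.Modules.pullback t).map (𝒱.toGr k) = 𝟙 _)
    {x : T ⟶ fiberPower t m} {f : T ⟶ Fl} (ex : x ≫ fiberPowerBase t m = f) {t₀ : T ⟶ S}
    {e : f ≫ F = t₀} {b : Fin D → Γ((Scheme.Modules.pullback t₀).obj V, (⊤ : T.Opens))}
    (hb : Adapted 𝒱 f e b) : ∃ a, IsPoint σ x ex e b a := by
  obtain ⟨w, hw, hk, hwb, hl, h0⟩ := hb.exists_frame_gr k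
  have key (i : Fin m) : ∃ c : Fin k → Γ(T, (⊤ : T.Opens)),
      ap (flagIncl 𝒱 f e k.succ) (ap (pointSec σ x ex i) (ap (pullGr 𝒱 f k) (w (Fin.last k)))) =
        shifted k b c := by
    obtain ⟨c, hc⟩ := hw.exists_eq_sum (ap (pointSec σ x ex i) (ap (pullGr 𝒱 f k) (w (Fin.last k))))
    rw [Fin.sum_univ_castSucc] at hc
    have h1 : ap (pullGr 𝒱 f k) (ap (pointSec σ x ex i) (ap (pullGr 𝒱 f k) (w (Fin.last k)))) =
        ap (pullGr 𝒱 f k) (w (Fin.last k)) := by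
      rw [← ap_comp (pointSec σ x ex i), pointSec, pullGr,
        pullbackHom_comp (comp_fiberPowerProj_comp ex i) hσ, ap_id]
    have hlast : c (Fin.last k) = 1 := by
      have hl' := hl (fun _ => ap (pullGr 𝒱 f k) (w (Fin.last k))) rfl
      have h2 := hl'.eq_of_sum_eq (c := fun _ => c (Fin.last k)) (c' := fun _ => 1) (by
        rw [Fin.sum_univ_one, Fin.sum_univ_one, one_smul]
        refine Eq.trans ?_ h1
        rw [hc, ap_add, ap_sum_smul, ap_smul]
        simp only [h0, smul_zero, Finset.sum_const_zero, zero_add])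
      exact congrFun h2 0
    refine ⟨fun j => c j.castSucc, ?_⟩
    rw [hc, ap_add, ap_sum_smul, ap_smul, hlast, one_smul, hk, shifted, add_comm]
    simp only [hwb]
  choose a ha using key
  refine ⟨a, .mk hb fun i w' hw' => ?_⟩
  have := hb.ap_injective k.succ (hw'.trans hk.symm)
  rw [this]
  exact ha i

/-- A twisted homomorphism whose value on the class of `b_k` is zero vanishes at the point, since
this class is a frame of the line bundle. -/
theorem twHom_eq_zero {s : TwistedHom 𝒱 k φP W} {x : T ⟶ fiberPower t m}
    (hx : (⊤ : T.Opens) ≤ x ⁻¹ᵁ W) {f : T ⟶ Fl} (ex : x ≫ fiberPowerBase t m = f) {t₀ : T ⟶ S}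
    (e : f ≫ F = t₀) {φ : T ⟶ T} (hφ : φ ≫ x = x ≫ φP)
    {b : Fin D → Γ((Scheme.Modules.pullback t₀).obj V, (⊤ : T.Opens))} (hb : Adapted 𝒱 f e b)
    (h : valueOn s hx ex e hφ (hb.topSec k) = 0) :
    twHom hx rfl (comp_base_of_comm ex hφ) s = 0 := by
  have hb' := hb.pullback φ rfl rfl (comp_comp_eq e φ) (b' := fun j => pullAmb φ rfl V (b j))
    fun _ => rfl
  obtain ⟨w, hw, hk, hwb, hl, h0⟩ := hb.exists_frame_gr k
  rw [← hb.eq_topSec hk, valueOn] at h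
  have h1 := hb'.ap_injective k.succ (h.trans (ap_zero (flagIncl 𝒱 (φ ≫ f)
    (comp_comp_eq e φ) k.succ)).symm)
  refine section_eq (fun l hl0 => ?_) (h1.trans (ap_zero_hom _).symm)
  exact (hl (fun _ => ap (pullGr 𝒱 f k) (w (Fin.last k))) rfl).pullAmb φ
    (rfl : φ ≫ f = φ ≫ f) (b' := l) fun j => by rw [Subsingleton.elim j 0, hl0]

theorem pullLocal_eq_zero {s : TwistedHom 𝒱 k φP W} {x : T ⟶ fiberPower t m}
    (hx : (⊤ : T.Opens) ≤ x ⁻¹ᵁ W) {f : T ⟶ Fl} (ex : x ≫ fiberPowerBase t m = f)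
    {φ : T ⟶ T} (hφ : φ ≫ x = x ≫ φP)
    (h : twHom hx rfl (comp_base_of_comm ex hφ) s = 0) : pullLocal x hx s = 0 := by
  rw [twHom] at h
  have h1 := congrArg (fun ψ => (twIso rfl (comp_base_of_comm ex hφ) _).hom ≫ ψ ≫
    (twIso rfl (comp_base_of_comm ex hφ) _).inv) h
  simpa using h1

/-- A section of the sheaf of twisted homomorphisms whose values at the local schemes of the fibered
power vanish is zero. -/
theorem eq_zero_of_isValue (hV : IsVectorBundle V D)
    (hσ : σ ≫ (Scheme.Modules.pullback t).map (𝒱.toGr k) = 𝟙 _) (s : TwistedHom 𝒱 k φP W)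
    (φ : ∀ y : fiberPower t m, Spec ((fiberPower t m).presheaf.stalk y) ⟶
      Spec ((fiberPower t m).presheaf.stalk y))
    (hφ : ∀ y, φ y ≫ (fiberPower t m).fromSpecStalk y = (fiberPower t m).fromSpecStalk y ≫ φP)
    (h : ∀ y ∈ W, ∀ b a v, IsFrame _ b → IsValue σ s
      (((fiberPower t m).fromSpecStalk y ≫ fiberPowerBase t m) ≫ F) (φ y) b a v → v = 0) :
    s = 0 := by
  refine LocalHom.eq_zero_of_pullLocal
    (((𝒱.hasLocalFrames_sub k.succ).pullback (fiberPowerBase t m)).pullback φP) s fun y hy => ?_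
  have hloc : IsLocalRing Γ(Spec ((fiberPower t m).presheaf.stalk y), ⊤) :=
    (glob ((fiberPower t m).presheaf.stalk y)).isLocalRing
  obtain ⟨b, hb⟩ := exists_frame_adapted (𝒱 := 𝒱) hV
    (IsLocalRing.closedPoint ((fiberPower t m).presheaf.stalk y))
    (fun U hU => (IsLocalRing.closedPoint_mem_iff U).1 hU)
    ((fiberPower t m).fromSpecStalk y ≫ fiberPowerBase t m) rfl
  obtain ⟨a, ha⟩ := exists_isPoint_of_adapted hσ (x := (fiberPower t m).fromSpecStalk y) rfl hb
  have hy' := le_preimage_fromSpecStalk hy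
  refine pullLocal_eq_zero hy' rfl (hφ y) (twHom_eq_zero hy' rfl rfl (hφ y) hb ?_)
  exact h y hy b a _ hb.isFrame ⟨_, hy', _, rfl, rfl, hφ y, ha, rfl⟩

end Vanishing

/-! ### Sections over affine open subsets -/

section SectionsOverAffine
open Matrix
variable {S Fl Sd : Scheme.{u}} {V : S.Modules} {D : ℕ} {F : Fl ⟶ S}
  {𝒱 : CompleteFlag ((Scheme.Modules.pullback F).obj V) D} {k : Fin D} {t : Sd ⟶ Fl}
  {σ : (Scheme.Modules.pullback t).obj (𝒱.gr k) ⟶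
    (Scheme.Modules.pullback t).obj (𝒱.sub k.succ : Fl.Modules)} {m : ℕ}
  {p : ℕ} [Fact p.Prime] {U : S.Opens} {hU : IsAffineOpen U} {hS : (p : Γ(S, ⊤)) = 0} {r : ℕ}
  {E : Fin D → Γ(V, U)}
  {B : Type u} [CommRing B] [Algebra Γ(S, U) B]

theorem pullFun_pullFun {X Y T : Scheme.{u}} (x : T ⟶ Y) (f : Y ⟶ X) {U : X.Opens} {W : Y.Opens}
    {O : T.Opens} (hW : W ≤ f ⁻¹ᵁ U) (hO : O ≤ x ⁻¹ᵁ W) (a : Γ(X, U)) :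
    pullFun x O hO (pullFun f W hW a) = pullFun (x ≫ f) O (hO.trans (x.preimage_mono hW)) a := by
  simp only [pullFun]
  rw [← ConcreteCategory.comp_apply, Scheme.Hom.appLE_comp_appLE]

variable (F t m) in
/-- Functions on `U`, as functions on the preimage of `U` in the fibered power. -/
def baseFun (U : S.Opens) : Γ(S, U) →+* Γ(fiberPower t m, (fiberPowerBase t m ≫ F) ⁻¹ᵁ U) :=
  pullFun (fiberPowerBase t m ≫ F) _ le_rfl

theorem pullFun_baseFun (c : Γ(S, U)) (x : Spec (.of B) ⟶ fiberPower t m)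
    (hx : ⊤ ≤ x ⁻¹ᵁ (fiberPowerBase t m ≫ F) ⁻¹ᵁ U)
    (h : (x ≫ fiberPowerBase t m) ≫ F = specTo hU B) :
    pullFun x ⊤ hx (baseFun F t m U c) = glob B (algebraMap Γ(S, U) B c) := by
  rw [← pullFun_specTo hU B c, baseFun, pullFun_pullFun]
  have key : ∀ {f g : Spec (.of B) ⟶ S} (_ : f = g) (hf : ⊤ ≤ f ⁻¹ᵁ U) (hg : ⊤ ≤ g ⁻¹ᵁ U),
      pullFun f ⊤ hf c = pullFun g ⊤ hg c := by
    rintro f _ rfl _ _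
    rfl
  exact key (by rw [← h, Category.assoc]) _ _

theorem valueOn_zero {T : Scheme.{u}} {φP : fiberPower t m ⟶ fiberPower t m}
    {W : (fiberPower t m).Opens} {x : T ⟶ fiberPower t m} (hx : (⊤ : T.Opens) ≤ x ⁻¹ᵁ W)
    {f : T ⟶ Fl} (ex : x ≫ fiberPowerBase t m = f) {t₀ : T ⟶ S} (e : f ≫ F = t₀)
    {φ : T ⟶ T} (hφ : φ ≫ x = x ≫ φP)
    (w : Γ((Scheme.Modules.pullback f).obj (𝒱.sub k.succ : Fl.Modules), (⊤ : T.Opens))) :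
    valueOn (0 : TwistedHom 𝒱 k φP W) hx ex e hφ w = 0 := by
  have := valueOn_add (0 : TwistedHom 𝒱 k φP W) 0 hx ex e hφ w
  rw [add_zero] at this
  exact left_eq_add.1 this

theorem hasCoord_zero (hF : IsFlagScheme V D F 𝒱) (hσ : IsSplittingScheme (𝒱.toGr k) t σ)
    (hE : IsFrame V E) (g : GL (Fin D) B) (a : Fin m → Fin k → B) :
    HasCoord σ hU hS r E (0 : SectionOver 𝒱 k hS t m r U) g a 0 := by
  obtain ⟨c, hc⟩ := exists_hasCoord (hU := hU) hF hσ hE (0 : SectionOver 𝒱 k hS t m r U) g a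
  obtain ⟨x, hx, f, ex, e, hφ, hp, hv⟩ := hc
  refine ⟨x, hx, f, ex, e, hφ, hp, ?_⟩
  rw [valueOn_zero]
  exact Finset.sum_eq_zero fun i _ => by simp only [Pi.zero_apply, map_zero, zero_smul]

theorem HasCoord.add_sum_twistedSection (hF : IsFlagScheme V D F 𝒱)
    (hσ : IsSplittingScheme (𝒱.toGr k) t σ) (hE : IsFrame V E) {s : SectionOver 𝒱 k hS t m r U}
    {g : GL (Fin D) B} {a : Fin m → Fin k → B} {c : Fin D → B}
    (h : HasCoord σ hU hS r E s g a c) (α : Fin m → Γ(S, U)) :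
    HasCoord σ hU hS r E (s + ∑ n, baseFun F t m U (α n) • twistedSection 𝒱 σ U hS r n) g a
      (fun i => c i + ∑ n, algebraMap Γ(S, U) B (α n) *
        (∑ j, (g : Matrix (Fin D) (Fin D) B) i j * extendOne k (a n) j) ^ p ^ r) := by
  have key := IsValue.add_sum hF hσ h Finset.univ
    (s' := fun n => baseFun F t m U (α n) • twistedSection 𝒱 σ U hS r n)
    (v' := fun n => glob B (algebraMap Γ(S, U) B (α n)) •
      ∑ i, glob B ((∑ j, (g : Matrix (Fin D) (Fin D) B) i j * extendOne k (a n) j) ^ p ^ r) •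
        specFrameTwist hU hS r E B i) fun n => by
    obtain ⟨c', hc'⟩ := exists_hasCoord (hU := hU) hF hσ hE (twistedSection 𝒱 σ U hS r n) g a
    obtain rfl := funext (hasCoord_twistedSection hE hc')
    exact IsValue.smul hc' fun x hx hxx => pullFun_baseFun (α n) x hx hxx
  have hsum : ∑ i, glob B (c i) • specFrameTwist hU hS r E B i +
      ∑ n, glob B (algebraMap Γ(S, U) B (α n)) •
      ∑ i, glob B ((∑ j, (g : Matrix (Fin D) (Fin D) B) i j * extendOne k (a n) j) ^ p ^ r) •
        specFrameTwist hU hS r E B i =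
      ∑ i, glob B (c i + ∑ n, algebraMap Γ(S, U) B (α n) *
        (∑ j, (g : Matrix (Fin D) (Fin D) B) i j * extendOne k (a n) j) ^ p ^ r) •
          specFrameTwist hU hS r E B i := by
    simp only [Finset.smul_sum, smul_smul, ← map_mul]
    rw [Finset.sum_comm, ← Finset.sum_add_distrib]
    refine Finset.sum_congr rfl fun i _ => ?_
    rw [← Finset.sum_smul, ← add_smul, map_add, map_sum]
  rw [hsum] at key
  exact key

/-- The twisted tautological sections are linearly independent: their values at the identity matrix
and generic splittings are. -/
theorem eq_zero_of_sum_twistedSection (hU : IsAffineOpen U) (hF : IsFlagScheme V D F 𝒱)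
    (hσ : IsSplittingScheme (𝒱.toGr k) t σ) (hE : IsFrame V E) (hk : 0 < (k : ℕ))
    (α : Fin m → Γ(S, U))
    (h : ∑ n, baseFun F t m U (α n) • twistedSection 𝒱 σ U hS r n = 0) : α = 0 := by
  classical
  funext n₀
  let a : Fin m → Fin k → MvPolynomial (Fin m × Fin k) Γ(S, U) := fun n j => MvPolynomial.X (n, j)
  have h0 := hasCoord_zero (hU := hU) (hS := hS) (r := r) hF hσ hE 1 a
  have h1 := h0.add_sum_twistedSection hF hσ hE α
  rw [h, add_zero] at h1
  have h2 := congrFun (h0.unique hF hσ hE h1) (Fin.castLE k.2.le ⟨0, hk⟩)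
  simp only [Units.val_one, Matrix.one_apply, ite_mul, one_mul, zero_mul, Finset.sum_ite_eq,
    Finset.mem_univ, if_true, extendOne_castLE, Pi.zero_apply, zero_add, a,
    MvPolynomial.algebraMap_eq] at h2
  have h3 := congrArg (MvPolynomial.coeff (Finsupp.single (n₀, ⟨0, hk⟩) (p ^ r))) h2
  rw [MvPolynomial.coeff_sum] at h3
  simp only [MvPolynomial.coeff_C_mul, MvPolynomial.coeff_X_pow, MvPolynomial.coeff_zero] at h3
  rw [Finset.sum_eq_single n₀ (fun n _ hn => ?_) (by simp)] at h3
  · rw [if_pos rfl, mul_one] at h3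
    exact h3.symm
  · rw [if_neg, mul_zero]
    intro he
    have := (Finsupp.single_left_inj (pow_ne_zero r (Fact.out : p.Prime).ne_zero)).1 he
    exact hn (congrArg Prod.fst this)

/-- Values at arbitrary frames are values at invertible matrices. -/
theorem eq_zero_of_isValue_specTo [IsLocalRing B] (hF : IsFlagScheme V D F 𝒱)
    (hσ : IsSplittingScheme (𝒱.toGr k) t σ) (hE : IsFrame V E) {s : SectionOver 𝒱 k hS t m r U}
    (h : ∀ (g : GL (Fin D) B) (a : Fin m → Fin k → B), HasCoord σ hU hS r E s g a 0)
    {b : Fin D → Γ((Scheme.Modules.pullback (specTo hU B)).obj V, ⊤)} (hb : IsFrame _ b)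
    {a : Fin m → Fin k → Γ(Spec (.of B), ⊤)}
    {v : Γ((Scheme.Modules.pullback (specFrob hU hS r B ≫ specTo hU B)).obj V, ⊤)}
    (hv : IsValue σ s (specTo hU B) (specFrob hU hS r B) b a v) : v = 0 := by
  obtain ⟨G, G', hG, hbG⟩ := (isFrame_specFrame hU hE B).exists_matrix hb.exists_eq_sum
  have hmap {H H' : Matrix (Fin D) (Fin D) Γ(Spec (.of B), ⊤)} (hH : H * H' = 1) :
      H.map (glob B).symm * H'.map (glob B).symm = 1 := by
    rw [← Matrix.map_mul, hH]
    exact Matrix.map_one _ (map_zero _) (map_one _)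
  let g : GL (Fin D) B := ⟨G.map (glob B).symm, G'.map (glob B).symm, hmap hG,
    hmap (mul_eq_one_comm.1 hG)⟩
  have h1 := h g fun n j => (glob B).symm (a n j)
  have hg : (g : Matrix (Fin D) (Fin D) B).map (glob B) = G := by
    ext i j
    exact (glob B).apply_symm_apply _
  have hb' : b = frameOf (specFrame hU E B) G := funext hbG
  rw [HasCoord, IsCoord, hg, ← hb'] at h1
  simp only [RingEquiv.apply_symm_apply] at h1
  rw [hv.unique hF hσ h1]
  exact Finset.sum_eq_zero fun i _ => by simp only [Pi.zero_apply, map_zero, zero_smul]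

/-- A section is zero if its coordinates vanish at all frames and splittings over local rings: the
local schemes of the fibered power are the spectra of such rings. -/
theorem eq_zero_of_hasCoord (hV : IsVectorBundle V D) (hU : IsAffineOpen U)
    (hF : IsFlagScheme V D F 𝒱) (hσ : IsSplittingScheme (𝒱.toGr k) t σ) (hE : IsFrame V E)
    (s : SectionOver 𝒱 k hS t m r U)
    (h : ∀ (B : Type u) [CommRing B] [Algebra Γ(S, U) B] [IsLocalRing B] (g : GL (Fin D) B)
      (a : Fin m → Fin k → B), HasCoord σ hU hS r E s g a 0) : s = 0 := by
  have hP := natCast_eq_zero_of_hom (fiberPowerBase t m ≫ F) hS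
  refine eq_zero_of_isValue hV hσ.section_comp s
    (fun y => frobeniusIter p (Spec ((fiberPower t m).presheaf.stalk y))
      (natCast_eq_zero_of_hom ((fiberPower t m).fromSpecStalk y) hP) r)
    (fun y => frobeniusIter_naturality _ _ _ _ _) fun y hy b a v hb hv => ?_
  have key (R : Type u) [CommRing R] [IsLocalRing R] (x : Spec (.of R) ⟶ S)
      (hx : ⊤ ≤ x ⁻¹ᵁ U) (hR : (p : Γ(Spec (.of R), ⊤)) = 0)
      (b : Fin D → Γ((Scheme.Modules.pullback x).obj V, ⊤)) (hb : IsFrame _ b)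
      (a : Fin m → Fin k → Γ(Spec (.of R), ⊤))
      (v : Γ((Scheme.Modules.pullback (frobeniusIter p (Spec (.of R)) hR r ≫ x)).obj V, ⊤))
      (hv : IsValue σ s x (frobeniusIter p (Spec (.of R)) hR r) b a v) : v = 0 := by
    obtain ⟨f, hf⟩ : ∃ f : Γ(S, U) →+* R, ∀ a, glob R (f a) = pullFun x ⊤ hx a :=
      ⟨(glob R).symm.toRingHom.comp (pullFun x ⊤ hx), fun a => (glob R).apply_symm_apply _⟩
    let _ : Algebra Γ(S, U) R := f.toAlgebra
    obtain rfl := specTo_eq hU x hx hf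
    exact eq_zero_of_isValue_specTo hF hσ hE (h R) hb hv
  have hloc : IsLocalRing ((fiberPower t m).presheaf.stalk y) := inferInstance
  refine @key ((fiberPower t m).presheaf.stalk y) _ hloc
    (((fiberPower t m).fromSpecStalk y ≫ fiberPowerBase t m) ≫ F) ?_ _ b hb a v hv
  rw [Category.assoc]
  exact le_preimage_fromSpecStalk hy

/-- Over an affine open subset over which `V` is free, every section of the sheaf of twisted
homomorphisms is a combination of the twisted tautological sections. -/
theorem exists_eq_sum_twistedSection (hV : IsVectorBundle V D) (hU : IsAffineOpen U)
    (hF : IsFlagScheme V D F 𝒱) (hσ : IsSplittingScheme (𝒱.toGr k) t σ) (hE : IsFrame V E)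
    {l : Fin D} (hl : k < l) (hk : 0 < (k : ℕ)) (hm : 1 ≤ m)
    (hkm : 2 ≤ (k : ℕ) ∨ m ≤ 2 ∨ r = 0) (s : SectionOver 𝒱 k hS t m r U) :
    ∃ α : Fin m → Γ(S, U), s = ∑ n, baseFun F t m U (α n) • twistedSection 𝒱 σ U hS r n := by
  obtain ⟨α, hα⟩ := (pointFunction hU hF hσ hE s).exists_val_eq (natCast_eq_zero hS U) hl hk hm hkm
  refine ⟨α, ?_⟩
  have h0 : s + ∑ n, baseFun F t m U (-α n) • twistedSection 𝒱 σ U hS r n = 0 := by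
    refine eq_zero_of_hasCoord hV hU hF hσ hE _ fun B _ _ _ g a => ?_
    have h1 := (hasCoord_sectionVal (hU := hU) hF hσ hE s g a).add_sum_twistedSection hF hσ hE
      fun n => -α n
    refine (congrArg (HasCoord σ hU hS r E _ _ _) (funext fun i => ?_)).mp h1
    have h2 : sectionVal hU hF hσ hE s g a i = _ := hα B g a i
    rw [h2]
    simp only [map_neg, neg_mul, Finset.sum_neg_distrib, add_neg_cancel, Pi.zero_apply]
  simp only [map_neg, neg_smul, Finset.sum_neg_distrib] at h0
  exact add_neg_eq_zero.1 h0

end SectionsOverAffine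

/-! ### The tautological map -/

section TautologicalMap
variable {S Fl Sd : Scheme.{u}} {V : S.Modules} {D : ℕ} {F : Fl ⟶ S}
  {𝒱 : CompleteFlag ((Scheme.Modules.pullback F).obj V) D} {k : Fin D} {t : Sd ⟶ Fl}
  {σ : (Scheme.Modules.pullback t).obj (𝒱.gr k) ⟶
    (Scheme.Modules.pullback t).obj (𝒱.sub k.succ : Fl.Modules)} {m : ℕ}
  {p : ℕ} [Fact p.Prime] {hS : (p : Γ(S, ⊤)) = 0} {r : ℕ}

/-- Scalars on a pushforward act through the pullback of functions. -/
theorem pushforward_ihom_smul {X : Scheme.{u}} (h : X ⟶ S) {M N : X.Modules} {U : S.Opens}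
    (a : Γ(S, U)) (s : LocalHom M N (h ⁻¹ᵁ U)) :
    (a • (show Γ((Scheme.Modules.pushforward h).obj (ihom M N), U) from s) :
      Γ((Scheme.Modules.pushforward h).obj (ihom M N), U)) =
      (pullFun h (h ⁻¹ᵁ U) le_rfl a • s : LocalHom M N (h ⁻¹ᵁ U)) := by
  rw [pullFun_eq, resFun_self]
  rfl

theorem tautologicalMap_res_freeSec (U : S.Opens) (n : Fin m) :
    (tautologicalMap p hS F t σ r m).app U (res _ U le_top (freeSec S m n)) =
      twistedSection 𝒱 σ U hS r n := by
  rw [app_res]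
  have h := freeHomEquiv_symm_app_freeSec ((Scheme.Modules.pushforward (fiberPowerBase t m ≫ F)).obj
      (ihom ((Scheme.Modules.pullback (frobeniusIter p (fiberPower t m)
          (natCast_eq_zero_of_hom (fiberPowerBase t m ≫ F) hS) r)).obj
            ((Scheme.Modules.pullback (fiberPowerBase t m)).obj (𝒱.gr k)))
        ((Scheme.Modules.pullback (frobeniusIter p (fiberPower t m)
          (natCast_eq_zero_of_hom (fiberPowerBase t m ≫ F) hS) r)).obj
            ((Scheme.Modules.pullback (fiberPowerBase t m)).obj (𝒱.sub k.succ : Fl.Modules)))))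
    (fun i => ihomSection (fiberPowerBase t m ≫ F) ((Scheme.Modules.pullback _).map
      (pullbackHom (fiberPowerProj_comp t m i.down) σ))) n
  exact congrArg (res _ U le_top) h

theorem tautologicalMap_app (U : S.Opens) (α : Fin m → Γ(S, U)) :
    (tautologicalMap p hS F t σ r m).app U (∑ n, α n • res _ U le_top (freeSec S m n)) =
      ∑ n, baseFun F t m U (α n) • twistedSection 𝒱 σ U hS r n := by
  rw [app_sum_smul]
  refine Finset.sum_congr rfl fun n _ => ?_
  rw [tautologicalMap_res_freeSec]
  exact pushforward_ihom_smul _ _ _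

theorem IsVectorBundle.exists_affine_frame {X : Scheme.{u}} {M : X.Modules} {n : ℕ}
    (h : IsVectorBundle M n) {O : X.Opens} {x : X} (hx : x ∈ O) :
    ∃ U : X.Opens, U ≤ O ∧ x ∈ U ∧ IsAffineOpen U ∧ ∃ e : Fin n → Γ(M, U), IsFrame M e := by
  obtain ⟨O', hx', e, he⟩ := h.exists_frame x
  obtain ⟨_, ⟨U, hU, rfl⟩, hxU, hUO⟩ := X.isBasis_affineOpens.exists_subset_of_mem_open
    (show x ∈ O ⊓ O' from ⟨hx, hx'⟩) (O ⊓ O').isOpen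
  exact ⟨U, fun y hy => (hUO hy).1, hxU, hU, _, he.res fun y hy => (hUO hy).2⟩

/-- It is enough to compare sections over the affine open subsets on which `V` is free. -/
theorem isIso_tautologicalMap (hV : IsVectorBundle V D) (hF : IsFlagScheme V D F 𝒱)
    (hσ : IsSplittingScheme (𝒱.toGr k) t σ) {l : Fin D} (hl : k < l) (hk : 0 < (k : ℕ))
    (hm : 1 ≤ m) (hkm : 2 ≤ (k : ℕ) ∨ m ≤ 2 ∨ r = 0) :
    IsIso (tautologicalMap p hS F t σ r m) := by
  refine isIso_of_basis _ fun O x hx => ?_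
  obtain ⟨U, hUO, hxU, hU, E, hE⟩ := hV.exists_affine_frame hx
  refine ⟨U, hUO, hxU, ?_⟩
  rw [← Function.Bijective.of_comp_iff _ (isFrame_freeSec m U le_top)]
  have h : ⇑((tautologicalMap p hS F t σ r m).app U).hom ∘
      (fun a : Fin m → Γ(S, U) => ∑ n, a n • res _ U le_top (freeSec S m n)) =
      fun a => ∑ n, baseFun F t m U (a n) • twistedSection 𝒱 σ U hS r n :=
    funext (tautologicalMap_app U)
  refine h.symm ▸ ⟨fun α β hαβ => ?_, fun s => ?_⟩
  · refine sub_eq_zero.1 (eq_zero_of_sum_twistedSection (hS := hS) (r := r) hU hF hσ hE hk _ ?_)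
    simp only [Pi.sub_apply, map_sub, sub_smul, Finset.sum_sub_distrib]
    exact sub_eq_zero.2 hαβ
  · obtain ⟨α, hα⟩ := exists_eq_sum_twistedSection (hS := hS) (r := r) hV hU hF hσ hE hl hk hm hkm s
    exact ⟨α, hα.symm⟩

end TautologicalMap

end TautSection

end

theorem mainTheorem10 (p : ℕ) [Fact p.Prime] (S : Scheme.{u}) (hS : (p : Γ(S, ⊤)) = 0)
    (D d r m : ℕ) (hD : 4 ≤ D) (hd : 1 ≤ d) (hdD : d + 2 ≤ D) (hm : 1 ≤ m)
    (hdmr : 2 ≤ d ∨ m ≤ 2 ∨ r = 0)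
    (V : S.Modules) (hV : TautSection.IsVectorBundle V D)
    (Fl : Scheme.{u}) (F : Fl ⟶ S)
    (𝒱 : TautSection.CompleteFlag ((Scheme.Modules.pullback F).obj V) D)
    (hF : TautSection.IsFlagScheme V D F 𝒱)
    (Sd : Scheme.{u}) (t : Sd ⟶ Fl)
    (σ : (Scheme.Modules.pullback t).obj (𝒱.gr ⟨d, by omega⟩) ⟶
      (Scheme.Modules.pullback t).obj (𝒱.sub (Fin.succ ⟨d, by omega⟩) : Fl.Modules))
    (hσ : TautSection.IsSplittingScheme (𝒱.toGr ⟨d, by omega⟩) t σ) :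
    IsIso (TautSection.tautologicalMap p hS F t σ r m) := by
  exact TautSection.isIso_tautologicalMap hV hF hσ (l := ⟨d + 1, by omega⟩)
    (Fin.lt_def.2 (Nat.lt_succ_self d)) hd hm hdmr
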